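/- Let $k$ be a field of characteristic $0$. **The category.** Let $\mathcal H'$ be the additive $k$-linear monoidal category whose objects are finite direct sums of tensor words in two generators $Q_+$ (upward strand) and $Q_-$ (downward strand). Its morphisms are generated by the upward crossing $Q_+Q_+\to Q_+Q_+$, the cups $\mathbf 1\to Q_-Q_+$, $\mathbf 1\to Q_+Q_-$ and the caps $Q_-Q_+\to\mathbf 1$, $Q_+Q_-\to\mathbf 1$, modulo planar isotopy (the other crossings are rotations of the upward one) and Khovanov's relations: - the square of the crossing of two parallel strands (both upward or both downward) is the identity, and these crossings satisfy the braid relation; - the double crossing $Q_+Q_-\to Q_-Q_+\to Q_+Q_-$ is the identity, and the double crossing $Q_-Q_+\to Q_+Q_-\to Q_-Q_+$ is $\mathrm{id}-\mathrm{cup}\circ\mathrm{cap}$; - the counterclockwise circle equals $1$, and the left curl on an upward strand is $0$. Let $\mathcal H$ be the Karoubi envelope of $\mathcal H'$. Diagrams are read from bottom to top. The group algebra $k[S_n]$ acts on $Q_+^{\otimes n}$ and on $Q_-^{\otimes n}$ by crossings. **Objects.** For a partition $\lambda\vdash n$ fill its boxes with $1,\dots,n$ along the rows. Let $R_\lambda$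 be the average of the permutations preserving the rows, and $C_\lambda$ the signed average (each permutation weighted by its sign) of those preserving the columns. Let $f_\lambda$ be the number of standard Young tableaux of shape $\lambda$, i.e. the dimension of the Specht module of $\lambda$. Put $e_\lambda=\alpha_\lambda R_\lambda C_\lambda$ with $\alpha_\lambda=\frac{\prod_i\lambda_i!\,\prod_j\lambda^t_j!}{n!/f_\lambda}$; this is an idempotent. Set $P=(Q_+,\mathrm{id})$, $P^\lambda=(Q_+^{\otimes n},e_\lambda)$, $Q^\lambda=(Q_-^{\otimes n},e_\lambda)$, $P^{(n)}=(Q_+^{\otimes n},S_n)$ and $P^{(n)^t}=(Q_+^{\otimes n},A_n)$, where $S_n$, $A_n$ also denote the complete symmetrizer and antisymmetrizer. Write $\lambda(s^+)$ (resp. $\mu(s^-)$) for the partition obtained by adding (resp. removing) a box in row $s$, whenever this is a partition. Write $W_s^\lambda$ for the symmetrizer on the strands of row $s$ of $\lambda$. Then the following hold in $\mathcal H$. **(1)** Let $n\ge1$, $m>1$. Put $\lambda_m=(n,1^m)$, $\lambda_{m-1}=(n+1,1^{m-1})$, and $$\iota_m=(S_n\otimes A_m)\circ e_{\lambda_m},\quad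 \iota_{m-1}=m\,(S_n\otimes A_m)\circ e_{\lambda_{m-1}},\quad \rho^j=e_{\lambda_j}\circ(S_n\otimes A_m)\quad(j\in\{m-1,m\}).$$ Then $\rho^i\circ\iota_j=\delta_{ij}\,1_{P^{\lambda_j}}$ and $\iota_m\circ\rho^m+\iota_{m-1}\circ\rho^{m-1}=1_{P^{(n)}P^{(m)^t}}$. Consequently $P^{(n)}P^{(m)^t}\cong P^{(n,1^m)}\oplus P^{(n+1,1^{m-1})}$. **(2)** Let $m,n\ge0$ and $0\le s\le\min(m,n)$. If $m\ge n$, put $$\iota_s=\tbinom{n}{s}\,(S_m\otimes S_n)\circ e_{(m+n-s,s)},\qquad \rho^s=e_{(m+n-s,s)}\circ(S_m\otimes S_n).$$ If $m<n$, let $X_{a,b}$ be the crossing of $a$ strands with the $b$ strands on their right, and put $$\iota_s=\tbinom{m}{s}\,(S_m\otimes S_n)\circ X_{n,m}\circ(S_n\otimes S_m)\circ e_{(m+n-s,s)},\qquad \rho^s=e_{(m+n-s,s)}\circ(S_n\otimes S_m)\circ X_{m,n}\circ(S_m\otimes S_n).$$ Then $\rho^t\circ\iota_s=\delta_{st}\,1_{P^{(m+n-s,s)}}$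 and $\sum_{s}\iota_s\circ\rho^s=1_{P^{(m)}P^{(n)}}$. Consequently $P^{(m)}P^{(n)}\cong\bigoplus_{s=0}^{\min(m,n)}P^{(m+n-s,s)}$. **(3)** Let $\mu\vdash n$. Let $\rho_0\colon Q^\mu P\to PQ^\mu$ and $\iota_0\colon PQ^\mu\to Q^\mu P$ be the sideways crossings of the $n$ downward strands (carrying $e_\mu$) with the upward strand. For each $\lambda=\mu(s^-)$ let $X_s\in S_n$ move the last strand of row $s$ of $\mu$ to the far right, keeping the order of the other strands. Let $\mathrm{cap}$ and $\mathrm{cup}$ be the cap and cup between the last downward strand and the upward strand on its right. Put $$\rho_s=e_\lambda\circ\mathrm{cap}\circ\big((X_s\,W_s^\mu\,e_\mu)\otimes1\big),\qquad \iota_s=\frac{n\,f_\lambda}{f_\mu}\,\big((e_\mu\,X_s^{-1})\otimes1\big)\circ\mathrm{cup}\circ W_s^{\lambda}\,e_\lambda .$$ Then $\rho_0\iota_0=1_{PQ^\mu}$, $\rho_s\iota_s=1_{Q^{\mu(s^-)}}$, $\rho_i\iota_j=0$ for distinct indices $i\neq j$ (the index $0$ included), and $\iota_0\rho_0+\sum_s\iota_s\rho_s=1_{Q^\mu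 P}$. Consequently $Q^\mu P\cong PQ^\mu\oplus\bigoplus_{\lambda=\mu-\square}Q^\lambda$. **(4)** Let $\lambda$ be a partition of a number $n\geq 0$. For each $\mu=\lambda(s^+)$ let $X_s\in S_{n+1}$ move the last strand of row $s$ of $\mu$ to the far right, keeping the order of the other strands. Put $$\iota_s=(e_\lambda\otimes1)\,X_s\,W_s^{\mu}\,e_\mu,\qquad \rho_s=e_\mu\,X_s^{-1}\,\big((W_s^\lambda e_\lambda)\otimes1\big).$$ Then $\rho_s\circ\iota_r=\delta_{sr}\,1_{P^{\lambda(s^+)}}$ and $\sum_s\iota_s\circ\rho_s=1_{P^\lambda P}$. Consequently $P^\lambda P\cong\bigoplus_{\mu=\lambda+\square}P^\mu$. -/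

import Mathlib

open CategoryTheory MonoidalCategory

namespace Heis

/-! ### Young idempotents in the group algebra of the symmetric group -/

section Young

/-- The boxes of a Young diagram, ordered lexicographically (along the rows). -/
def boxes (lam : YoungDiagram) : Finset (ℕ ×ₗ ℕ) := lam.cells.map toLex.toEmbedding

theorem card_boxes (lam : YoungDiagram) : (boxes lam).card = lam.card := Finset.card_map _

theorem mem_boxes {lam : YoungDiagram} {c : ℕ × ℕ} : toLex c ∈ boxes lam ↔ c ∈ lam := by
  simp [boxes]

variable {n : ℕ} (lam : YoungDiagram) (h : lam.card = n)

/-- The standard row filling of `lam`: the order isomorphism between `Fin n` and the boxes, read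
along the rows from top to bottom. -/
def rowFilling : Fin n ≃o boxes lam := (boxes lam).orderIsoOfFin ((card_boxes lam).trans h)

/-- The row of the box with entry `i` in the standard row filling. -/
def rowOf (i : Fin n) : ℕ := (ofLex (rowFilling lam h i).1).1

/-- The column of the box with entry `i` in the standard row filling. -/
def colOf (i : Fin n) : ℕ := (ofLex (rowFilling lam h i).1).2

/-- The entry of the box `c` in the standard row filling. -/
def entry (c : ℕ × ℕ) (hc : c ∈ lam) : Fin n := (rowFilling lam h).symm ⟨toLex c, mem_boxes.2 hc⟩

theorem rowOf_entry (c : ℕ × ℕ) (hc : c ∈ lam) : rowOf lam h (entry lam h c hc) = c.1 := by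
  simp [rowOf, entry]

theorem colOf_entry (c : ℕ × ℕ) (hc : c ∈ lam) : colOf lam h (entry lam h c hc) = c.2 := by
  simp [colOf, entry]

theorem rowOf_colOf_mem (i : Fin n) : (rowOf lam h i, colOf lam h i) ∈ lam :=
  mem_boxes.1 (rowFilling lam h i).2

theorem eq_of_rowOf_colOf {i j : Fin n} (h1 : rowOf lam h i = rowOf lam h j)
    (h2 : colOf lam h i = colOf lam h j) : i = j := by
  apply (rowFilling lam h).injective
  apply Subtype.ext
  apply ofLex.injective
  exact Prod.ext h1 h2

/-- The permutations preserving the fibres of a labelling. -/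
def fibreGroup (f : Fin n → ℕ) : Subgroup (Equiv.Perm (Fin n)) where
  carrier := {σ | ∀ i, f (σ i) = f i}
  mul_mem' := fun {a b} ha hb i => by rw [Equiv.Perm.mul_apply, ha, hb]
  one_mem' := fun _ => rfl
  inv_mem' := fun {a} ha i => by rw [← ha (a⁻¹ i)]; simp

/-- The row group of the standard row filling. -/
def rowGroup : Subgroup (Equiv.Perm (Fin n)) := fibreGroup (rowOf lam h)

/-- The column group of the standard row filling. -/
def colGroup : Subgroup (Equiv.Perm (Fin n)) := fibreGroup (colOf lam h)

theorem mem_rowGroup {σ : Equiv.Perm (Fin n)} :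
    σ ∈ rowGroup lam h ↔ ∀ i, rowOf lam h (σ i) = rowOf lam h i := Iff.rfl

theorem mem_colGroup {σ : Equiv.Perm (Fin n)} :
    σ ∈ colGroup lam h ↔ ∀ i, colOf lam h (σ i) = colOf lam h i := Iff.rfl

variable (k : Type*) [Field k]

open scoped Classical in
/-- The average of `χ(σ) σ` over the elements `σ` of a group of permutations. -/
noncomputable def box (χ : Equiv.Perm (Fin n) →* ℤˣ) (G : Subgroup (Equiv.Perm (Fin n))) :
    MonoidAlgebra k (Equiv.Perm (Fin n)) :=
  (Nat.card G : k)⁻¹ • ∑ σ : Equiv.Perm (Fin n) with σ ∈ G,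
    MonoidAlgebra.single σ (((χ σ : ℤ)) : k)

/-- The symmetrizer over a group of permutations (white box). -/
noncomputable abbrev symBox (G : Subgroup (Equiv.Perm (Fin n))) :
    MonoidAlgebra k (Equiv.Perm (Fin n)) := box k 1 G

/-- The antisymmetrizer over a group of permutations (dark box). -/
noncomputable abbrev antiBox (G : Subgroup (Equiv.Perm (Fin n))) :
    MonoidAlgebra k (Equiv.Perm (Fin n)) := box k Equiv.Perm.sign G

section Box

variable {k} (χ : Equiv.Perm (Fin n) →* ℤˣ) {G : Subgroup (Equiv.Perm (Fin n))}

theorem chi_sq (σ : Equiv.Perm (Fin n)) : ((χ σ : ℤ) : k) * ((χ σ : ℤ) : k) = 1 := by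
  rcases Int.units_eq_one_or (χ σ) with h | h <;> simp [h]

theorem single_mul_box {g : Equiv.Perm (Fin n)} (hg : g ∈ G) :
    MonoidAlgebra.single g 1 * box k χ G = ((χ g : ℤ) : k) • box k χ G := by
  classical
  rw [box, mul_smul_comm, smul_comm]
  congr 1
  rw [Finset.mul_sum, Finset.smul_sum]
  refine Finset.sum_bij (fun σ _ => g * σ) ?_ ?_ ?_ ?_
  · intro σ hσ
    simp only [Finset.mem_filter, Finset.mem_univ, true_and] at hσ ⊢
    exact mul_mem hg hσ
  · intro a _ b _ hab; exact mul_left_cancel hab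
  · intro σ hσ
    simp only [Finset.mem_filter, Finset.mem_univ, true_and] at hσ
    exact ⟨g⁻¹ * σ, by simpa using mul_mem (inv_mem hg) hσ, by simp⟩
  · intro σ _
    rw [MonoidAlgebra.single_mul_single, one_mul, MonoidAlgebra.smul_single, map_mul]
    congr 1
    push_cast
    rw [smul_eq_mul, ← mul_assoc, chi_sq, one_mul]

theorem box_mul_single {g : Equiv.Perm (Fin n)} (hg : g ∈ G) :
    box k χ G * MonoidAlgebra.single g 1 = ((χ g : ℤ) : k) • box k χ G := by
  classical
  rw [box, smul_mul_assoc, smul_comm]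
  congr 1
  rw [Finset.sum_mul, Finset.smul_sum]
  refine Finset.sum_bij (fun σ _ => σ * g) ?_ ?_ ?_ ?_
  · intro σ hσ
    simp only [Finset.mem_filter, Finset.mem_univ, true_and] at hσ ⊢
    exact mul_mem hσ hg
  · intro a _ b _ hab; exact mul_right_cancel hab
  · intro σ hσ
    simp only [Finset.mem_filter, Finset.mem_univ, true_and] at hσ
    exact ⟨σ * g⁻¹, by simpa using mul_mem hσ (inv_mem hg), by simp⟩
  · intro σ _
    rw [MonoidAlgebra.single_mul_single, mul_one, MonoidAlgebra.smul_single, map_mul]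
    congr 1
    push_cast
    rw [smul_eq_mul, mul_comm, mul_assoc, chi_sq, mul_one]

theorem box_mul_box [CharZero k] : box k χ G * box k χ G = box k χ G := by
  classical
  conv_lhs => enter [1]; rw [box]
  rw [smul_mul_assoc, Finset.sum_mul]
  have : ∀ σ ∈ Finset.univ.filter (fun σ : Equiv.Perm (Fin n) => σ ∈ G),
      MonoidAlgebra.single σ ((χ σ : ℤ) : k) * box k χ G = box k χ G := by
    intro σ hσ
    simp only [Finset.mem_filter, Finset.mem_univ, true_and] at hσ
    have e : MonoidAlgebra.single σ ((χ σ : ℤ) : k) =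
        ((χ σ : ℤ) : k) • MonoidAlgebra.single σ (1 : k) := by
      rw [MonoidAlgebra.smul_single, smul_eq_mul, mul_one]
    rw [e, smul_mul_assoc, single_mul_box χ hσ, smul_smul, chi_sq, one_smul]
  rw [Finset.sum_congr rfl this, Finset.sum_const, ← Nat.cast_smul_eq_nsmul k, smul_smul]
  have hc : (Finset.univ.filter (fun σ : Equiv.Perm (Fin n) => σ ∈ G)).card = Nat.card G := by
    rw [Nat.card_eq_fintype_card, Fintype.card_subtype]
  rw [hc, inv_mul_cancel₀, one_smul]
  exact_mod_cast Nat.card_pos.ne'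

end Box

/-- The product of the row symmetrizers and the column antisymmetrizers, without the scalar that
makes it idempotent. -/
noncomputable def youngQuasi : MonoidAlgebra k (Equiv.Perm (Fin n)) :=
  symBox k (rowGroup lam h) * antiBox k (colGroup lam h)

/-- The dimension of the irreducible representation (Specht module) of shape `lam`, i.e. of the left
ideal of `k[S_n]` generated by the product of row symmetrizers and column antisymmetrizers. -/
noncomputable def spechtDim : ℕ :=
  Module.finrank k (LinearMap.range (LinearMap.mulRight k (youngQuasi lam h k)))

/-- The scalar `∏ λᵢ! ∏ λⱼ*! / (n! / dim)`. -/
noncomputable def youngScalar : k :=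
  (Nat.card (rowGroup lam h) : k) * (Nat.card (colGroup lam h) : k) /
    ((n.factorial : k) / (spechtDim lam h k : k))

/-- The Young idempotent of the standard row filling of `lam`. -/
noncomputable def young : MonoidAlgebra k (Equiv.Perm (Fin n)) :=
  youngScalar lam h k • youngQuasi lam h k

/-! The remainder of this section proves that `young` is idempotent. -/

theorem exists_colGroup (g : Equiv.Perm (Fin n))
    (H : ∀ x y, x ≠ y → colOf lam h x = colOf lam h y → rowOf lam h (g x) ≠ rowOf lam h (g y)) :
    ∃ c ∈ colGroup lam h, ∀ x, rowOf lam h (c x) = rowOf lam h (g x) := by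
  classical
  have key : ∀ x, rowOf lam h (g x) < lam.colLen (colOf lam h x) := by
    intro x₀
    set j₀ := colOf lam h x₀
    set K := lam.colLen j₀
    let A : Finset (Fin n) := Finset.univ.filter fun x => rowOf lam h (g x) < K
    let B : Finset (Fin n) := Finset.univ.filter fun x => rowOf lam h x < K
    have hAB : A.card = B.card := by
      refine Finset.card_bij (fun x _ => g x) ?_ ?_ ?_
      · intro x hx; simpa [A, B] using hx
      · intro x _ y _ hxy; exact g.injective hxy
      · intro y hy; exact ⟨g⁻¹ y, by simpa [A, B] using hy, by simp⟩
    let N := (Finset.univ : Finset (Fin n)).image (colOf lam h)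
    have hA := Finset.card_eq_sum_card_fiberwise (s := A) (f := colOf lam h) (t := N)
      (fun x _ => by simp [N])
    have hB := Finset.card_eq_sum_card_fiberwise (s := B) (f := colOf lam h) (t := N)
      (fun x _ => by simp [N])
    have hle : ∀ j ∈ N, (A.filter fun x => colOf lam h x = j).card ≤
        (B.filter fun x => colOf lam h x = j).card := by
      intro j _
      by_cases hj : K ≤ lam.colLen j
      · have h1 : (A.filter fun x => colOf lam h x = j).card ≤ (Finset.range K).card := by
          refine Finset.card_le_card_of_injOn (fun x => rowOf lam h (g x)) ?_ ?_
          · intro x hx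
            simp only [A, Finset.coe_filter, Finset.mem_filter, Finset.mem_univ, true_and,
              Set.mem_ofPred_eq] at hx
            simpa using hx.1
          · intro x hx y hy hxy
            simp only [A, Finset.coe_filter, Finset.mem_filter, Finset.mem_univ, true_and,
              Set.mem_ofPred_eq] at hx hy
            by_contra hne
            exact H x y hne (hx.2.trans hy.2.symm) hxy
        have h2 : (Finset.range K).card ≤ (B.filter fun x => colOf lam h x = j).card := by
          refine Finset.card_le_card_of_surjOn (rowOf lam h) ?_
          intro i hi
          have hi' : i < K := by simpa using hi
          have hm : (i, j) ∈ lam := YoungDiagram.mem_iff_lt_colLen.2 (by omega)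
          refine ⟨entry lam h (i, j) hm, ?_, rowOf_entry lam h _ hm⟩
          simp [B, rowOf_entry, colOf_entry, hi']
        exact h1.trans h2
      · refine Finset.card_le_card ?_
        intro x hx
        simp only [A, B, Finset.mem_filter, Finset.mem_univ, true_and] at hx ⊢
        refine ⟨?_, hx.2⟩
        have hm := YoungDiagram.mem_iff_lt_colLen.1 (rowOf_colOf_mem lam h x)
        rw [hx.2] at hm
        omega
    have heq := (Finset.sum_eq_sum_iff_of_le hle).1 (by rw [← hA, ← hB, hAB]) j₀ (by simp [N, j₀])
    have hBall : (B.filter fun x => colOf lam h x = j₀) =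
        Finset.univ.filter fun x => colOf lam h x = j₀ := by
      ext x
      simp only [B, Finset.mem_filter, Finset.mem_univ, true_and, and_iff_right_iff_imp]
      intro hx
      have hm := YoungDiagram.mem_iff_lt_colLen.1 (rowOf_colOf_mem lam h x)
      rwa [hx] at hm
    rw [hBall] at heq
    have hsub : (A.filter fun x => colOf lam h x = j₀) ⊆
        Finset.univ.filter fun x => colOf lam h x = j₀ := by
      intro x hx; simpa using (Finset.mem_filter.1 hx).2
    have hset := Finset.eq_of_subset_of_card_le hsub heq.ge
    have hx₀ : x₀ ∈ Finset.univ.filter fun x => colOf lam h x = j₀ := by simp [j₀]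
    rw [← hset] at hx₀
    simpa [A] using (Finset.mem_filter.1 hx₀).1
  have hmem : ∀ x, (rowOf lam h (g x), colOf lam h x) ∈ lam := fun x =>
    YoungDiagram.mem_iff_lt_colLen.2 (key x)
  let c : Fin n → Fin n := fun x => entry lam h _ (hmem x)
  have hcr : ∀ x, rowOf lam h (c x) = rowOf lam h (g x) := fun x => rowOf_entry lam h _ _
  have hcc : ∀ x, colOf lam h (c x) = colOf lam h x := fun x => colOf_entry lam h _ _
  have hinj : Function.Injective c := by
    intro x y hxy
    by_contra hne
    refine H x y hne ?_ ?_
    · rw [← hcc x, ← hcc y, hxy]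
    · rw [← hcr x, ← hcr y, hxy]
  exact ⟨Equiv.ofBijective c (Finite.injective_iff_bijective.1 hinj), hcc, hcr⟩

theorem eq_one_of_mem {σ : Equiv.Perm (Fin n)} (hr : σ ∈ rowGroup lam h)
    (hc : σ ∈ colGroup lam h) : σ = 1 :=
  Equiv.ext fun x => eq_of_rowOf_colOf lam h (hr x) (hc x)

/-- Invariance under the row group on the left and the column group on the right. -/
def Biinv (z : MonoidAlgebra k (Equiv.Perm (Fin n))) : Prop :=
  (∀ r ∈ rowGroup lam h, MonoidAlgebra.single r 1 * z = z) ∧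
  ∀ c ∈ colGroup lam h, z * MonoidAlgebra.single c 1 = ((Equiv.Perm.sign c : ℤ) : k) • z

variable {lam h k} in
theorem Biinv.left {z : MonoidAlgebra k (Equiv.Perm (Fin n))} (hz : Biinv lam h k z)
    {r : Equiv.Perm (Fin n)} (hr : r ∈ rowGroup lam h) (g : Equiv.Perm (Fin n)) :
    z.coeff (r * g) = z.coeff g := by
  have := congrArg (fun y => y.coeff (r * g)) (hz.1 r hr)
  simp only [MonoidAlgebra.coeff_single_mul_apply, one_mul] at this
  rw [← this]
  simp

variable {lam h k} in
theorem Biinv.right {z : MonoidAlgebra k (Equiv.Perm (Fin n))} (hz : Biinv lam h k z)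
    {c : Equiv.Perm (Fin n)} (hc : c ∈ colGroup lam h) (g : Equiv.Perm (Fin n)) :
    z.coeff (g * c) = ((Equiv.Perm.sign c : ℤ) : k) * z.coeff g := by
  have := congrArg (fun y => y.coeff (g * c)) (hz.2 c hc)
  simp only [MonoidAlgebra.coeff_mul_single_apply, mul_one, MonoidAlgebra.coeff_smul_apply,
    smul_eq_mul, mul_inv_cancel_right] at this
  rw [this, ← mul_assoc, chi_sq, one_mul]

variable {lam h k} in
theorem Biinv.eq_zero [CharZero k] {z : MonoidAlgebra k (Equiv.Perm (Fin n))} (hz : Biinv lam h k z)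
    (h1 : z.coeff 1 = 0) : z = 0 := by
  ext g
  rw [MonoidAlgebra.coeff_zero, Finsupp.zero_apply]
  by_cases H : ∀ x y, x ≠ y → colOf lam h x = colOf lam h y →
      rowOf lam h (g x) ≠ rowOf lam h (g y)
  · obtain ⟨c, hc, hrow⟩ := exists_colGroup lam h g H
    have hr : g * c⁻¹ ∈ rowGroup lam h := by
      intro x
      rw [Equiv.Perm.mul_apply, ← hrow]; simp
    have e : g = (g * c⁻¹) * (1 * c) := by simp
    rw [e, hz.left hr, hz.right hc, h1, mul_zero]
  · push Not at H
    obtain ⟨x, y, hne, hcol, hrow⟩ := H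
    have hc : Equiv.swap x y ∈ colGroup lam h := by
      intro i
      by_cases hx : i = x
      · subst hx; rw [Equiv.swap_apply_left, hcol]
      · by_cases hy : i = y
        · subst hy; rw [Equiv.swap_apply_right, hcol]
        · rw [Equiv.swap_apply_of_ne_of_ne hx hy]
    have hr : Equiv.swap (g x) (g y) ∈ rowGroup lam h := by
      intro i
      by_cases hx : i = g x
      · subst hx; rw [Equiv.swap_apply_left, hrow]
      · by_cases hy : i = g y
        · subst hy; rw [Equiv.swap_apply_right, hrow]
        · rw [Equiv.swap_apply_of_ne_of_ne hx hy]
    have e : Equiv.swap (g x) (g y) * g = g * Equiv.swap x y := by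
      rw [Equiv.mul_swap_eq_swap_mul]
    have h2 := hz.left hr g
    rw [e, hz.right hc, Equiv.Perm.sign_swap hne] at h2
    have h3 : z.coeff g + z.coeff g = 0 := by
      nth_rewrite 1 [← h2]; simp
    exact add_self_eq_zero.1 h3

theorem biinv_youngQuasi : Biinv lam h k (youngQuasi lam h k) := by
  constructor
  · intro r hr
    rw [youngQuasi, ← mul_assoc, single_mul_box _ hr]; simp
  · intro c hc
    rw [youngQuasi, mul_assoc, box_mul_single _ hc, mul_smul_comm]

theorem youngQuasi_coeff_one : (youngQuasi lam h k).coeff 1 =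
    ((Nat.card (rowGroup lam h) : k) * (Nat.card (colGroup lam h) : k))⁻¹ := by
  classical
  rw [youngQuasi, symBox, antiBox, box, box, smul_mul_smul_comm, MonoidAlgebra.coeff_smul_apply,
    Finset.sum_mul_sum, MonoidAlgebra.coeff_sum, Finsupp.finsetSum_apply,
    Finset.sum_eq_single (1 : Equiv.Perm (Fin n))]
  · rw [MonoidAlgebra.coeff_sum, Finsupp.finsetSum_apply,
      Finset.sum_eq_single (1 : Equiv.Perm (Fin n))]
    · simp [mul_comm]
    · intro c _ hne
      rw [MonoidAlgebra.single_mul_single, MonoidAlgebra.coeff_single, Finsupp.single_apply,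
        if_neg (by simpa using hne)]
    · intro hn; exact absurd (by simp [one_mem]) hn
  · intro r hr hne
    rw [MonoidAlgebra.coeff_sum, Finsupp.finsetSum_apply]
    refine Finset.sum_eq_zero fun c hc => ?_
    simp only [Finset.mem_filter, Finset.mem_univ, true_and] at hr hc
    rw [MonoidAlgebra.single_mul_single, MonoidAlgebra.coeff_single, Finsupp.single_apply,
      if_neg]
    intro hrc
    apply hne
    refine eq_one_of_mem lam h hr ?_
    rw [eq_inv_of_mul_eq_one_left hrc]
    exact inv_mem hc
  · intro hn; exact absurd (by simp [one_mem]) hn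

theorem trace_mulRight (x : MonoidAlgebra k (Equiv.Perm (Fin n))) :
    LinearMap.trace k _ (LinearMap.mulRight k x) = (n.factorial : k) * x.coeff 1 := by
  classical
  let b : Module.Basis (Equiv.Perm (Fin n)) k (MonoidAlgebra k (Equiv.Perm (Fin n))) :=
    ⟨MonoidAlgebra.coeffLinearEquiv k⟩
  rw [LinearMap.trace_eq_matrix_trace k b, Matrix.trace]
  have : ∀ g, (LinearMap.toMatrix b b (LinearMap.mulRight k x)).diag g = x.coeff 1 := by
    intro g
    rw [Matrix.diag_apply, LinearMap.toMatrix_apply]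
    have hb : b g = MonoidAlgebra.single g 1 := rfl
    rw [hb, LinearMap.mulRight_apply]
    change (MonoidAlgebra.single g 1 * x).coeff g = _
    rw [MonoidAlgebra.coeff_single_mul_apply]
    simp
  rw [Finset.sum_congr rfl (fun g _ => this g)]
  simp [Fintype.card_perm]

theorem young_mul_young [CharZero k] : young lam h k * young lam h k = young lam h k := by
  set x := youngQuasi lam h k with hx
  set u : k := (Nat.card (rowGroup lam h) : k) * (Nat.card (colGroup lam h) : k) with hu
  have hu0 : u ≠ 0 := mul_ne_zero (by exact_mod_cast Nat.card_pos.ne')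
    (by exact_mod_cast Nat.card_pos.ne')
  have hx1 : x.coeff 1 = u⁻¹ := youngQuasi_coeff_one lam h k
  have hf0 : (n.factorial : k) ≠ 0 := by exact_mod_cast n.factorial_ne_zero
  have hxx : Biinv lam h k (x * x) := by
    have hb := biinv_youngQuasi lam h k
    rw [← hx] at hb
    refine ⟨fun r hr => ?_, fun c hc => ?_⟩
    · rw [← mul_assoc, hb.1 r hr]
    · rw [mul_assoc, hb.2 c hc, mul_smul_comm]
  obtain ⟨κ, hκ⟩ : ∃ κ : k, x * x = κ • x := by
    refine ⟨(x * x).coeff 1 * u, ?_⟩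
    rw [← sub_eq_zero]
    refine Biinv.eq_zero (lam := lam) (h := h) ?_ ?_
    · have hb := biinv_youngQuasi lam h k
      rw [← hx] at hb
      refine ⟨fun r hr => ?_, fun c hc => ?_⟩
      · rw [mul_sub, hxx.1 r hr, mul_smul_comm, hb.1 r hr]
      · rw [sub_mul, hxx.2 c hc, smul_mul_assoc, hb.2 c hc, smul_sub, smul_comm]
    · rw [MonoidAlgebra.coeff_sub, Finsupp.sub_apply, MonoidAlgebra.coeff_smul_apply, hx1,
        smul_eq_mul, mul_assoc, mul_inv_cancel₀ hu0, mul_one, sub_self]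
  have htr : LinearMap.trace k _ (LinearMap.mulRight k x) = (n.factorial : k) * u⁻¹ := by
    rw [trace_mulRight, hx1]
  have htr0 : LinearMap.trace k _ (LinearMap.mulRight k x) ≠ 0 := by
    rw [htr]; exact mul_ne_zero hf0 (inv_ne_zero hu0)
  have hκ0 : κ ≠ 0 := by
    rintro rfl
    rw [zero_smul] at hκ
    apply htr0
    apply IsNilpotent.eq_zero
    apply LinearMap.isNilpotent_trace_of_isNilpotent
    refine ⟨2, ?_⟩
    rw [pow_two, Module.End.mul_eq_comp, ← LinearMap.mulRight_mul, hκ, LinearMap.mulRight_zero_eq_zero]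
  have hproj : LinearMap.IsProj (LinearMap.range (LinearMap.mulRight k x))
      (κ⁻¹ • LinearMap.mulRight k x) := by
    refine ⟨fun y => Submodule.smul_mem _ _ ⟨y, rfl⟩, ?_⟩
    rintro _ ⟨y, rfl⟩
    rw [LinearMap.smul_apply, LinearMap.mulRight_apply, LinearMap.mulRight_apply, mul_assoc, hκ,
      mul_smul_comm, smul_smul, inv_mul_cancel₀ hκ0, one_smul]
  have hdim := hproj.trace
  rw [map_smul, htr, smul_eq_mul] at hdim
  change _ = (spechtDim lam h k : k) at hdim
  have hα : youngScalar lam h k = κ⁻¹ := by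
    rw [youngScalar, ← hdim, ← hu]
    field_simp
  rw [young, smul_mul_smul_comm, ← hx, hκ, hα, smul_smul]
  congr 1
  field_simp

end Young

end Heis

namespace Heis

/-- Objects: tensor words in the two generating objects `up = Q₊` and `down = Q₋`. -/
inductive Ob : Type
  | unit : Ob
  | up : Ob
  | down : Ob
  | tensor : Ob → Ob → Ob

/-- Formal `k`-linear combinations of string diagrams.  `comp f g` puts `g` on top of `f`,
`tensor f g` puts `g` to the right of `f`.  The generators are the upward crossing, the two cups
and the two caps. -/
inductive Tm (k : Type*) : Ob → Ob → Type _
  | id (X : Ob) : Tm k X X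
  | comp {X Y Z : Ob} (f : Tm k X Y) (g : Tm k Y Z) : Tm k X Z
  | tensor {X Y X' Y' : Ob} (f : Tm k X Y) (g : Tm k X' Y') :
      Tm k (X.tensor X') (Y.tensor Y')
  | assoc (X Y Z : Ob) : Tm k ((X.tensor Y).tensor Z) (X.tensor (Y.tensor Z))
  | assocInv (X Y Z : Ob) : Tm k (X.tensor (Y.tensor Z)) ((X.tensor Y).tensor Z)
  | lunit (X : Ob) : Tm k (Ob.unit.tensor X) X
  | lunitInv (X : Ob) : Tm k X (Ob.unit.tensor X)
  | runit (X : Ob) : Tm k (X.tensor Ob.unit) X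
  | runitInv (X : Ob) : Tm k X (X.tensor Ob.unit)
  | zero (X Y : Ob) : Tm k X Y
  | add {X Y : Ob} (f g : Tm k X Y) : Tm k X Y
  | smul {X Y : Ob} (a : k) (f : Tm k X Y) : Tm k X Y
  | cross : Tm k (Ob.up.tensor Ob.up) (Ob.up.tensor Ob.up)
  | cupQP : Tm k Ob.unit (Ob.down.tensor Ob.up)
  | cupPQ : Tm k Ob.unit (Ob.up.tensor Ob.down)
  | capQP : Tm k (Ob.down.tensor Ob.up) Ob.unit
  | capPQ : Tm k (Ob.up.tensor Ob.down) Ob.unit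

namespace Tm

variable {k : Type*}

local notation:70 f:71 " ⊠ " g:70 => Tm.tensor f g
local notation:60 f:61 " ⋙ₜ " g:60 => Tm.comp f g
local notation:75 X:76 " ⊙ " Y:75 => Ob.tensor X Y

/-- Apply a diagram to the two middle factors of `(a ⊗ b) ⊗ (c ⊗ d)`. -/
def mid (a d : Ob) {b c b' c' : Ob} (f : Tm k (b ⊙ c) (b' ⊙ c')) :
    Tm k ((a ⊙ b) ⊙ (c ⊙ d)) ((a ⊙ b') ⊙ (c' ⊙ d)) :=
  assoc a b (c ⊙ d) ⋙ₜ (id a ⊠ (assocInv b c d ⋙ₜ (f ⊠ id d) ⋙ₜ assoc b' c' d)) ⋙ₜ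
    assocInv a b' (c' ⊙ d)

/-- Rotate a diagram by bending its bottom left upward strand to the top left (with a cup) and its
top right upward strand to the bottom right (with a cap). -/
def rotL {c c' : Ob} (f : Tm k (Ob.up ⊙ c) (c' ⊙ Ob.up)) :
    Tm k (c ⊙ Ob.down) (Ob.down ⊙ c') :=
  lunitInv _ ⋙ₜ (cupQP ⊠ id _) ⋙ₜ mid Ob.down Ob.down f ⋙ₜ (id _ ⊠ capPQ) ⋙ₜ runit _

/-- Rotate a diagram by bending its bottom right upward strand to the top right and its top left
upward strand to the bottom left. -/
def rotR {c c' : Ob} (f : Tm k (c ⊙ Ob.up) (Ob.up ⊙ c')) :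
    Tm k (Ob.down ⊙ c) (c' ⊙ Ob.down) :=
  runitInv _ ⋙ₜ (id _ ⊠ cupPQ) ⋙ₜ mid Ob.down Ob.down f ⋙ₜ (capQP ⊠ id _) ⋙ₜ lunit _

/-- The sideways crossing `Q₊ ⊗ Q₋ → Q₋ ⊗ Q₊`. -/
def crossPQ : Tm k (Ob.up ⊙ Ob.down) (Ob.down ⊙ Ob.up) := rotL cross

/-- The sideways crossing `Q₋ ⊗ Q₊ → Q₊ ⊗ Q₋`. -/
def crossQP : Tm k (Ob.down ⊙ Ob.up) (Ob.up ⊙ Ob.down) := rotR cross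

/-- The downward crossing `Q₋ ⊗ Q₋ → Q₋ ⊗ Q₋`. -/
def crossQQ : Tm k (Ob.down ⊙ Ob.down) (Ob.down ⊙ Ob.down) := rotL crossPQ

/-- The diagram in which `f : X ⊗ X → X ⊗ X` is applied to the second and third factors. -/
def onRight {X : Ob} (f : Tm k (X ⊙ X) (X ⊙ X)) : Tm k ((X ⊙ X) ⊙ X) ((X ⊙ X) ⊙ X) :=
  assoc X X X ⋙ₜ (id X ⊠ f) ⋙ₜ assocInv X X X

/-- An upward strand with a counterclockwise curl on its left. -/
def leftCurl : Tm k Ob.up Ob.up :=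
  lunitInv Ob.up ⋙ₜ (cupQP ⊠ id Ob.up) ⋙ₜ assoc _ _ _ ⋙ₜ (id Ob.down ⊠ cross) ⋙ₜ
    assocInv _ _ _ ⋙ₜ (capQP ⊠ id Ob.up) ⋙ₜ lunit Ob.up

/-- The relations between diagrams: those of a `k`-linear monoidal category, planar isotopy
invariance, and the local relations of the Heisenberg category. -/
inductive Rel [CommRing k] : ∀ {X Y : Ob}, Tm k X Y → Tm k X Y → Prop
  -- equivalence relation and congruence
  | refl {X Y : Ob} (f : Tm k X Y) : Rel f f
  | symm {X Y : Ob} {f g : Tm k X Y} : Rel f g → Rel g f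
  | trans {X Y : Ob} {f g h : Tm k X Y} : Rel f g → Rel g h → Rel f h
  | comp {X Y Z : Ob} {f f' : Tm k X Y} {g g' : Tm k Y Z} :
      Rel f f' → Rel g g' → Rel (f ⋙ₜ g) (f' ⋙ₜ g')
  | tensor {X Y X' Y' : Ob} {f f' : Tm k X Y} {g g' : Tm k X' Y'} :
      Rel f f' → Rel g g' → Rel (f ⊠ g) (f' ⊠ g')
  | add {X Y : Ob} {f f' g g' : Tm k X Y} : Rel f f' → Rel g g' → Rel (add f g) (add f' g')
  | smul {X Y : Ob} (a : k) {f f' : Tm k X Y} : Rel f f' → Rel (smul a f) (smul a f')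
  -- `k`-module structure on morphisms
  | add_assoc {X Y : Ob} (f g h : Tm k X Y) : Rel (add (add f g) h) (add f (add g h))
  | add_comm {X Y : Ob} (f g : Tm k X Y) : Rel (add f g) (add g f)
  | zero_add {X Y : Ob} (f : Tm k X Y) : Rel (add (zero X Y) f) f
  | smul_add {X Y : Ob} (a : k) (f g : Tm k X Y) :
      Rel (smul a (add f g)) (add (smul a f) (smul a g))
  | add_smul {X Y : Ob} (a b : k) (f : Tm k X Y) :
      Rel (smul (a + b) f) (add (smul a f) (smul b f))
  | mul_smul {X Y : Ob} (a b : k) (f : Tm k X Y) : Rel (smul (a * b) f) (smul a (smul b f))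
  | one_smul {X Y : Ob} (f : Tm k X Y) : Rel (smul 1 f) f
  | zero_smul {X Y : Ob} (f : Tm k X Y) : Rel (smul 0 f) (zero X Y)
  -- category with bilinear composition
  | id_comp {X Y : Ob} (f : Tm k X Y) : Rel (id X ⋙ₜ f) f
  | comp_id {X Y : Ob} (f : Tm k X Y) : Rel (f ⋙ₜ id Y) f
  | comp_assoc {W X Y Z : Ob} (f : Tm k W X) (g : Tm k X Y) (h : Tm k Y Z) :
      Rel ((f ⋙ₜ g) ⋙ₜ h) (f ⋙ₜ (g ⋙ₜ h))
  | add_comp {X Y Z : Ob} (f f' : Tm k X Y) (g : Tm k Y Z) :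
      Rel (add f f' ⋙ₜ g) (add (f ⋙ₜ g) (f' ⋙ₜ g))
  | comp_add {X Y Z : Ob} (f : Tm k X Y) (g g' : Tm k Y Z) :
      Rel (f ⋙ₜ add g g') (add (f ⋙ₜ g) (f ⋙ₜ g'))
  | smul_comp {X Y Z : Ob} (a : k) (f : Tm k X Y) (g : Tm k Y Z) :
      Rel (smul a f ⋙ₜ g) (smul a (f ⋙ₜ g))
  | comp_smul {X Y Z : Ob} (a : k) (f : Tm k X Y) (g : Tm k Y Z) :
      Rel (f ⋙ₜ smul a g) (smul a (f ⋙ₜ g))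
  -- monoidal category with bilinear tensor product
  | tensor_id (X Y : Ob) : Rel (id X ⊠ id Y : Tm k _ _) (id (X ⊙ Y))
  | tensor_comp {X Y Z X' Y' Z' : Ob} (f : Tm k X Y) (g : Tm k Y Z) (f' : Tm k X' Y')
      (g' : Tm k Y' Z') : Rel ((f ⊠ f') ⋙ₜ (g ⊠ g')) ((f ⋙ₜ g) ⊠ (f' ⋙ₜ g'))
  | add_tensor {X Y X' Y' : Ob} (f g : Tm k X Y) (h : Tm k X' Y') :
      Rel (add f g ⊠ h) (add (f ⊠ h) (g ⊠ h))
  | tensor_add {X Y X' Y' : Ob} (f : Tm k X Y) (g h : Tm k X' Y') :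
      Rel (f ⊠ add g h) (add (f ⊠ g) (f ⊠ h))
  | smul_tensor {X Y X' Y' : Ob} (a : k) (f : Tm k X Y) (g : Tm k X' Y') :
      Rel (smul a f ⊠ g) (smul a (f ⊠ g))
  | tensor_smul {X Y X' Y' : Ob} (a : k) (f : Tm k X Y) (g : Tm k X' Y') :
      Rel (f ⊠ smul a g) (smul a (f ⊠ g))
  | assoc_hom_inv (X Y Z : Ob) : Rel (assoc X Y Z ⋙ₜ assocInv X Y Z : Tm k _ _) (id _)
  | assoc_inv_hom (X Y Z : Ob) : Rel (assocInv X Y Z ⋙ₜ assoc X Y Z : Tm k _ _) (id _)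
  | assoc_nat {X Y X' Y' X'' Y'' : Ob} (f : Tm k X Y) (g : Tm k X' Y') (h : Tm k X'' Y'') :
      Rel (((f ⊠ g) ⊠ h) ⋙ₜ assoc Y Y' Y'') (assoc X X' X'' ⋙ₜ (f ⊠ (g ⊠ h)))
  | lunit_hom_inv (X : Ob) : Rel (lunit X ⋙ₜ lunitInv X : Tm k _ _) (id _)
  | lunit_inv_hom (X : Ob) : Rel (lunitInv X ⋙ₜ lunit X : Tm k _ _) (id _)
  | lunit_nat {X Y : Ob} (f : Tm k X Y) : Rel ((id Ob.unit ⊠ f) ⋙ₜ lunit Y) (lunit X ⋙ₜ f)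
  | runit_hom_inv (X : Ob) : Rel (runit X ⋙ₜ runitInv X : Tm k _ _) (id _)
  | runit_inv_hom (X : Ob) : Rel (runitInv X ⋙ₜ runit X : Tm k _ _) (id _)
  | runit_nat {X Y : Ob} (f : Tm k X Y) : Rel ((f ⊠ id Ob.unit) ⋙ₜ runit Y) (runit X ⋙ₜ f)
  | pentagon (W X Y Z : Ob) :
      Rel ((assoc W X Y ⊠ id Z) ⋙ₜ assoc W (X ⊙ Y) Z ⋙ₜ (id W ⊠ assoc X Y Z) : Tm k _ _)
        (assoc (W ⊙ X) Y Z ⋙ₜ assoc W X (Y ⊙ Z))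
  | triangle (X Y : Ob) :
      Rel (assoc X Ob.unit Y ⋙ₜ (id X ⊠ lunit Y) : Tm k _ _) (runit X ⊠ id Y)
  -- planar isotopy: straightening zigzags and rotating the crossing
  | zigzag_up_right : Rel (lunitInv Ob.up ⋙ₜ (cupPQ ⊠ id Ob.up) ⋙ₜ assoc _ _ _ ⋙ₜ
      (id Ob.up ⊠ capQP) ⋙ₜ runit Ob.up : Tm k _ _) (id Ob.up)
  | zigzag_up_left : Rel (runitInv Ob.up ⋙ₜ (id Ob.up ⊠ cupQP) ⋙ₜ assocInv _ _ _ ⋙ₜ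
      (capPQ ⊠ id Ob.up) ⋙ₜ lunit Ob.up : Tm k _ _) (id Ob.up)
  | zigzag_down_right : Rel (lunitInv Ob.down ⋙ₜ (cupQP ⊠ id Ob.down) ⋙ₜ assoc _ _ _ ⋙ₜ
      (id Ob.down ⊠ capPQ) ⋙ₜ runit Ob.down : Tm k _ _) (id Ob.down)
  | zigzag_down_left : Rel (runitInv Ob.down ⋙ₜ (id Ob.down ⊠ cupPQ) ⋙ₜ assocInv _ _ _ ⋙ₜ
      (capQP ⊠ id Ob.down) ⋙ₜ lunit Ob.down : Tm k _ _) (id Ob.down)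
  | cross_rot : Rel (rotL (rotL cross) : Tm k _ _) (rotR (rotR cross))
  -- double and triple points, for upward and for downward strands
  | up_double : Rel (cross ⋙ₜ cross : Tm k _ _) (id (Ob.up ⊙ Ob.up))
  | up_triple : Rel
      ((cross ⊠ id Ob.up) ⋙ₜ onRight cross ⋙ₜ (cross ⊠ id Ob.up) : Tm k _ _)
      (onRight cross ⋙ₜ (cross ⊠ id Ob.up) ⋙ₜ onRight cross)
  | down_double : Rel (crossQQ ⋙ₜ crossQQ : Tm k _ _) (id (Ob.down ⊙ Ob.down))
  | down_triple : Rel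
      ((crossQQ ⊠ id Ob.down) ⋙ₜ onRight crossQQ ⋙ₜ (crossQQ ⊠ id Ob.down) : Tm k _ _)
      (onRight crossQQ ⋙ₜ (crossQQ ⊠ id Ob.down) ⋙ₜ onRight crossQQ)
  -- the down-up double crossing is the identity minus cup-cap; the up-down one is the identity
  | down_up : Rel (crossQP ⋙ₜ crossPQ : Tm k _ _)
      (add (id (Ob.down ⊙ Ob.up)) (smul (-1) (capQP ⋙ₜ cupQP)))
  | up_down : Rel (crossPQ ⋙ₜ crossQP : Tm k _ _) (id (Ob.up ⊙ Ob.down))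
  -- the counterclockwise circle is `1` and the left curl vanishes
  | bubble : Rel (cupQP ⋙ₜ capQP : Tm k _ _) (id Ob.unit)
  | curl : Rel (leftCurl : Tm k _ _) (zero Ob.up Ob.up)

end Tm

/-- The category of tensor words in `Q₊`, `Q₋` and `k`-linear combinations of string diagrams
modulo relations. -/
@[nolint unusedArguments]
def Word (_k : Type*) : Type := Ob

variable (k : Type*) [CommRing k]

/-- Diagrams up to the relations. -/
instance homSetoid (X Y : Ob) : Setoid (Tm k X Y) where
  r := Tm.Rel
  iseqv := ⟨Tm.Rel.refl, Tm.Rel.symm, Tm.Rel.trans⟩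

instance : Category (Word k) where
  Hom X Y := Quotient (homSetoid k X Y)
  id X := ⟦Tm.id X⟧
  comp := Quotient.map₂ Tm.comp (fun _ _ hf _ _ hg => Tm.Rel.comp hf hg)
  id_comp := by rintro X Y ⟨f⟩; exact Quotient.sound (Tm.Rel.id_comp f)
  comp_id := by rintro X Y ⟨f⟩; exact Quotient.sound (Tm.Rel.comp_id f)
  assoc := by rintro W X Y Z ⟨f⟩ ⟨g⟩ ⟨h⟩; exact Quotient.sound (Tm.Rel.comp_assoc f g h)

variable {k}

/-- The morphism represented by a diagram. -/
def dia {X Y : Ob} (f : Tm k X Y) : @Quiver.Hom (Word k) _ X Y := Quotient.mk (homSetoid k X Y) f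

variable (k)

instance homZero (X Y : Word k) : Zero (X ⟶ Y) := ⟨⟦Tm.zero X Y⟧⟩

instance homAdd (X Y : Word k) : Add (X ⟶ Y) :=
  ⟨Quotient.map₂ Tm.add (fun _ _ hf _ _ hg => Tm.Rel.add hf hg)⟩

instance homNeg (X Y : Word k) : Neg (X ⟶ Y) :=
  ⟨Quotient.map (Tm.smul (-1)) (fun _ _ hf => Tm.Rel.smul (-1) hf)⟩

instance homAddCommGroup (X Y : Word k) : AddCommGroup (X ⟶ Y) where
  add_assoc := by rintro ⟨f⟩ ⟨g⟩ ⟨h⟩; exact Quotient.sound (Tm.Rel.add_assoc f g h)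
  add_comm := by rintro ⟨f⟩ ⟨g⟩; exact Quotient.sound (Tm.Rel.add_comm f g)
  zero_add := by rintro ⟨f⟩; exact Quotient.sound (Tm.Rel.zero_add f)
  add_zero := by
    rintro ⟨f⟩
    exact Quotient.sound ((Tm.Rel.add_comm _ _).trans (Tm.Rel.zero_add f))
  neg_add_cancel := by
    rintro ⟨f⟩
    refine Quotient.sound (Tm.Rel.trans (Tm.Rel.add (Tm.Rel.refl _) (Tm.Rel.one_smul f).symm) ?_)
    refine (Tm.Rel.add_smul (-1) 1 f).symm.trans ?_
    rw [neg_add_cancel]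
    exact Tm.Rel.zero_smul f
  nsmul := nsmulRec
  zsmul := zsmulRec

instance homModule (X Y : Word k) : Module k (X ⟶ Y) where
  smul a := Quotient.map (Tm.smul a) (fun _ _ hf => Tm.Rel.smul a hf)
  one_smul := by rintro ⟨f⟩; exact Quotient.sound (Tm.Rel.one_smul f)
  mul_smul := by rintro a b ⟨f⟩; exact Quotient.sound (Tm.Rel.mul_smul a b f)
  smul_zero a := by
    refine Quotient.sound (Tm.Rel.trans (Tm.Rel.smul a (Tm.Rel.zero_smul (Tm.zero X Y)).symm) ?_)
    refine (Tm.Rel.mul_smul a 0 _).symm.trans ?_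
    rw [mul_zero]
    exact Tm.Rel.zero_smul _
  smul_add := by rintro a ⟨f⟩ ⟨g⟩; exact Quotient.sound (Tm.Rel.smul_add a f g)
  add_smul := by rintro a b ⟨f⟩; exact Quotient.sound (Tm.Rel.add_smul a b f)
  zero_smul := by rintro ⟨f⟩; exact Quotient.sound (Tm.Rel.zero_smul f)

instance : Preadditive (Word k) where
  homGroup := homAddCommGroup k
  add_comp := by rintro X Y Z ⟨f⟩ ⟨g⟩ ⟨h⟩; exact Quotient.sound (Tm.Rel.add_comp f g h)
  comp_add := by rintro X Y Z ⟨f⟩ ⟨g⟩ ⟨h⟩; exact Quotient.sound (Tm.Rel.comp_add f g h)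

instance : Linear k (Word k) where
  homModule := homModule k
  smul_comp := by rintro X Y Z a ⟨f⟩ ⟨g⟩; exact Quotient.sound (Tm.Rel.smul_comp a f g)
  comp_smul := by rintro X Y Z ⟨f⟩ a ⟨g⟩; exact Quotient.sound (Tm.Rel.comp_smul a f g)

instance : MonoidalCategoryStruct (Word k) where
  tensorObj X Y := Ob.tensor X Y
  tensorUnit := Ob.unit
  tensorHom := Quotient.map₂ Tm.tensor (fun _ _ hf _ _ hg => Tm.Rel.tensor hf hg)
  whiskerLeft X _ _ f := Quotient.map (Tm.tensor (Tm.id X))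
    (fun _ _ hf => Tm.Rel.tensor (Tm.Rel.refl _) hf) f
  whiskerRight f Y := Quotient.map (fun f => Tm.tensor f (Tm.id Y))
    (fun _ _ hf => Tm.Rel.tensor hf (Tm.Rel.refl _)) f
  associator X Y Z := ⟨⟦Tm.assoc X Y Z⟧, ⟦Tm.assocInv X Y Z⟧,
    Quotient.sound (Tm.Rel.assoc_hom_inv _ _ _), Quotient.sound (Tm.Rel.assoc_inv_hom _ _ _)⟩
  leftUnitor X := ⟨⟦Tm.lunit X⟧, ⟦Tm.lunitInv X⟧,
    Quotient.sound (Tm.Rel.lunit_hom_inv _), Quotient.sound (Tm.Rel.lunit_inv_hom _)⟩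
  rightUnitor X := ⟨⟦Tm.runit X⟧, ⟦Tm.runitInv X⟧,
    Quotient.sound (Tm.Rel.runit_hom_inv _), Quotient.sound (Tm.Rel.runit_inv_hom _)⟩

instance : MonoidalCategory (Word k) := MonoidalCategory.ofTensorHom
  (id_tensorHom_id := fun X Y => Quotient.sound (Tm.Rel.tensor_id X Y))
  (id_tensorHom := by rintro X Y Z ⟨f⟩; rfl)
  (tensorHom_id := by rintro X Y ⟨f⟩ Z; rfl)
  (tensorHom_comp_tensorHom := by
    rintro _ _ _ _ _ _ ⟨f⟩ ⟨g⟩ ⟨f'⟩ ⟨g'⟩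
    exact Quotient.sound (Tm.Rel.tensor_comp f f' g g'))
  (associator_naturality := by
    rintro _ _ _ _ _ _ ⟨f⟩ ⟨g⟩ ⟨h⟩; exact Quotient.sound (Tm.Rel.assoc_nat f g h))
  (leftUnitor_naturality := by rintro _ _ ⟨f⟩; exact Quotient.sound (Tm.Rel.lunit_nat f))
  (rightUnitor_naturality := by rintro _ _ ⟨f⟩; exact Quotient.sound (Tm.Rel.runit_nat f))
  (pentagon := fun W X Y Z => Quotient.sound (Tm.Rel.pentagon W X Y Z))
  (triangle := fun X Y => Quotient.sound (Tm.Rel.triangle X Y))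

instance : MonoidalPreadditive (Word k) where
  whiskerLeft_add := by rintro X Y Z ⟨f⟩ ⟨g⟩; exact Quotient.sound (Tm.Rel.tensor_add _ f g)
  add_whiskerRight := by rintro X Y Z ⟨f⟩ ⟨g⟩; exact Quotient.sound (Tm.Rel.add_tensor f g _)
  whiskerLeft_zero := by
    intro X Y Z
    refine Quotient.sound (Tm.Rel.trans (Tm.Rel.tensor (Tm.Rel.refl _)
      (Tm.Rel.zero_smul (Tm.zero Y Z)).symm) ?_)
    exact (Tm.Rel.tensor_smul _ _ _).trans (Tm.Rel.zero_smul _)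
  zero_whiskerRight := by
    intro X Y Z
    refine Quotient.sound (Tm.Rel.trans (Tm.Rel.tensor
      (Tm.Rel.zero_smul (Tm.zero Y Z)).symm (Tm.Rel.refl _)) ?_)
    exact (Tm.Rel.smul_tensor _ _ _).trans (Tm.Rel.zero_smul _)

instance : MonoidalLinear k (Word k) where
  whiskerLeft_smul := by rintro X Y Z a ⟨f⟩; exact Quotient.sound (Tm.Rel.tensor_smul a _ f)
  smul_whiskerRight := by rintro a Y Z ⟨f⟩ X; exact Quotient.sound (Tm.Rel.smul_tensor a f _)

end Heis

namespace Heis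

/-! ### The symmetric group acting on a tensor power -/

section Coxeter

variable {N : Type*} [Monoid N]

/-- Product `g (n - d + 1) * ⋯ * g n` of `d` consecutive elements. -/
def chain (g : ℕ → N) (n : ℕ) : ℕ → N
  | 0 => 1
  | d + 1 => g (n - d) * chain g n d

theorem chain_comm (g : ℕ → N) (n : ℕ) (hc : ∀ i j, i + 1 < j → j ≤ n → g i * g j = g j * g i) :
    ∀ d i, d ≤ n + 1 → i + d < n → g i * chain g n d = chain g n d * g i
  | 0, i, _, _ => by simp [chain]
  | d + 1, i, hd, hi => by
    rw [chain, ← mul_assoc, hc i (n - d) (by omega) (by omega), mul_assoc,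
      chain_comm g n hc d i (by omega) (by omega), mul_assoc]

theorem chain_shift (g : ℕ → N) (n : ℕ)
    (h3 : ∀ i, i + 1 ≤ n → g i * g (i + 1) * g i = g (i + 1) * g i * g (i + 1))
    (hc : ∀ i j, i + 1 < j → j ≤ n → g i * g j = g j * g i) :
    ∀ d i, d ≤ n + 1 → n < i + d → i + 1 ≤ n → g (i + 1) * chain g n d = chain g n d * g i
  | 0, i, _, _, _ => by omega
  | 1, i, _, _, _ => by omega
  | d + 2, i, hd, hi, hin => by
    by_cases h : i = n - (d + 1)
    · have e : n - d = i + 1 := by omega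
      rw [chain, chain, ← h, e]
      rw [← mul_assoc, ← mul_assoc, ← h3 i hin, mul_assoc, mul_assoc,
        chain_comm g n hc d i (by omega) (by omega)]
      simp only [mul_assoc]
    · rw [chain, ← mul_assoc, ← hc (n - (d + 1)) (i + 1) (by omega) (by omega), mul_assoc,
        chain_shift g n h3 hc (d + 1) i (by omega) (by omega) hin, mul_assoc]

/-- A set of the form `chain * submonoid` is stable under the generators. -/
theorem closure_chain (g : ℕ → N) (n : ℕ) (h2 : ∀ i, i ≤ n → g i * g i = 1)
    (h3 : ∀ i, i + 1 ≤ n → g i * g (i + 1) * g i = g (i + 1) * g i * g (i + 1))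
    (hc : ∀ i j, i + 1 < j → j ≤ n → g i * g j = g j * g i) (x : N)
    (hx : x ∈ Submonoid.closure {y | ∃ i ≤ n, y = g i}) :
    ∃ d ≤ n + 1, ∃ y ∈ Submonoid.closure {y | ∃ i, i + 1 ≤ n ∧ y = g i}, x = chain g n d * y := by
  induction hx using Submonoid.closure_induction_left with
  | one => exact ⟨0, by omega, 1, one_mem _, by simp [chain]⟩
  | mul_left a ha y hy ih =>
    obtain ⟨i, hi, rfl⟩ := ha
    obtain ⟨d, hd, z, hz, rfl⟩ := ih
    rcases lt_trichotomy (i + d) n with h | h | h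
    · refine ⟨d, hd, g i * z, mul_mem (Submonoid.subset_closure ⟨i, by omega, rfl⟩) hz, ?_⟩
      rw [← mul_assoc, chain_comm g n hc d i hd h, mul_assoc]
    · refine ⟨d + 1, by omega, z, hz, ?_⟩
      rw [chain, show n - d = i by omega, mul_assoc]
    · by_cases h' : i + d = n + 1
      · obtain ⟨e, rfl⟩ : ∃ e, d = e + 1 := ⟨d - 1, by omega⟩
        refine ⟨e, by omega, z, hz, ?_⟩
        rw [chain, show n - e = i by omega, ← mul_assoc, ← mul_assoc, h2 i hi, one_mul]
      · obtain ⟨j, rfl⟩ : ∃ j, i = j + 1 := ⟨i - 1, by omega⟩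
        refine ⟨d, hd, g j * z, mul_mem (Submonoid.subset_closure ⟨j, by omega, rfl⟩) hz, ?_⟩
        rw [← mul_assoc, chain_shift g n h3 hc d j hd (by omega) (by omega), mul_assoc]

variable {M : Type*} [Monoid M]

/-- The pairs (adjacent transposition, element). -/
def gen (t : ℕ → M) (i : ℕ) : Equiv.Perm ℕ × M := (Equiv.swap i (i + 1), t i)

theorem chain_fst (t : ℕ → M) (n : ℕ) :
    ∀ d ≤ n + 1, (chain (gen t) n d).1 (n + 1) = n + 1 - d
  | 0, _ => by simp [chain]
  | d + 1, hd => by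
    rw [chain, Prod.fst_mul, Equiv.Perm.mul_apply, chain_fst t n d (by omega)]
    simp only [gen]
    rw [show n + 1 - d = n - d + 1 by omega, Equiv.swap_apply_right]
    omega

theorem closure_fix (t : ℕ → M) (n : ℕ) (x : Equiv.Perm ℕ × M)
    (hx : x ∈ Submonoid.closure {y | ∃ i, i + 1 ≤ n ∧ y = gen t i}) : x.1 (n + 1) = n + 1 := by
  induction hx using Submonoid.closure_induction with
  | mem x hx =>
    obtain ⟨i, hi, rfl⟩ := hx
    exact Equiv.swap_apply_of_ne_of_ne (by omega) (by omega)
  | one => rfl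
  | mul x y _ _ hx hy => rw [Prod.fst_mul, Equiv.Perm.mul_apply, hy, hx]

theorem perm_comm {i j : ℕ} (h : i + 1 < j) :
    Equiv.swap i (i + 1) * Equiv.swap j (j + 1) = Equiv.swap j (j + 1) * Equiv.swap i (i + 1) := by
  apply Equiv.Perm.Disjoint.commute
  intro x
  by_cases hx : x = i ∨ x = i + 1
  · right; exact Equiv.swap_apply_of_ne_of_ne (by omega) (by omega)
  · left; exact Equiv.swap_apply_of_ne_of_ne (by omega) (by omega)

theorem perm_braid (i : ℕ) :
    Equiv.swap i (i + 1) * Equiv.swap (i + 1) (i + 2) * Equiv.swap i (i + 1) =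
      Equiv.swap (i + 1) (i + 2) * Equiv.swap i (i + 1) * Equiv.swap (i + 1) (i + 2) := by
  rw [Equiv.swap_mul_swap_mul_swap (by omega) (by omega), Equiv.swap_comm i (i + 1),
    Equiv.swap_comm (i + 1) (i + 2), Equiv.swap_mul_swap_mul_swap (by omega) (by omega),
    Equiv.swap_comm]

theorem closure_unique (t : ℕ → M) : ∀ n : ℕ, (∀ i, i + 1 < n → t i * t i = 1) →
    (∀ i, i + 2 < n → t i * t (i + 1) * t i = t (i + 1) * t i * t (i + 1)) →
    (∀ i j, i + 1 < j → j + 1 < n → t i * t j = t j * t i) →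
    ∀ (σ : Equiv.Perm ℕ) (a b : M),
      (σ, a) ∈ Submonoid.closure {y | ∃ i, i + 1 < n ∧ y = gen t i} →
      (σ, b) ∈ Submonoid.closure {y | ∃ i, i + 1 < n ∧ y = gen t i} → a = b
  | 0, _, _, _, σ, a, b, ha, hb => by
    simp at ha hb; rw [ha.2, hb.2]
  | 1, _, _, _, σ, a, b, ha, hb => by
    simp at ha hb; rw [ha.2, hb.2]
  | n + 2, h2, h3, hc, σ, a, b, ha, hb => by
    have e1 : {y | ∃ i, i + 1 < n + 2 ∧ y = gen t i} = {y | ∃ i ≤ n, y = gen t i} := by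
      ext y; constructor
      · rintro ⟨i, hi, h⟩; exact ⟨i, by omega, h⟩
      · rintro ⟨i, hi, h⟩; exact ⟨i, by omega, h⟩
    have e2 : {y | ∃ i, i + 1 < n + 1 ∧ y = gen t i} = {y | ∃ i, i + 1 ≤ n ∧ y = gen t i} := by
      ext y; constructor
      · rintro ⟨i, hi, h⟩; exact ⟨i, by omega, h⟩
      · rintro ⟨i, hi, h⟩; exact ⟨i, by omega, h⟩
    have g2 : ∀ i, i ≤ n → gen t i * gen t i = 1 := fun i hi =>
      Prod.ext (Equiv.swap_mul_self _ _) (h2 i (by omega))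
    have g3 : ∀ i, i + 1 ≤ n → gen t i * gen t (i + 1) * gen t i =
        gen t (i + 1) * gen t i * gen t (i + 1) := fun i hi =>
      Prod.ext (perm_braid i) (h3 i (by omega))
    have gc : ∀ i j, i + 1 < j → j ≤ n → gen t i * gen t j = gen t j * gen t i := fun i j h hj =>
      Prod.ext (perm_comm h) (hc i j h (by omega))
    rw [e1] at ha hb
    obtain ⟨d, hd, y, hy, ey⟩ := closure_chain (gen t) n g2 g3 gc _ ha
    obtain ⟨d', hd', y', hy', ey'⟩ := closure_chain (gen t) n g2 g3 gc _ hb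
    have hs : σ (n + 1) = n + 1 - d := by
      have := congrArg (fun x => x.1 (n + 1)) ey
      simpa only [Prod.fst_mul, Equiv.Perm.mul_apply, closure_fix t n y hy,
        chain_fst t n d hd] using this
    have hs' : σ (n + 1) = n + 1 - d' := by
      have := congrArg (fun x => x.1 (n + 1)) ey'
      simpa only [Prod.fst_mul, Equiv.Perm.mul_apply, closure_fix t n y' hy',
        chain_fst t n d' hd'] using this
    obtain rfl : d = d' := by omega
    have hy1 : y.1 = y'.1 := by
      have h := congrArg Prod.fst ey
      have h' := congrArg Prod.fst ey'
      simp only [Prod.fst_mul] at h h'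
      exact mul_left_cancel (h.symm.trans h')
    have hy2 : y.2 = y'.2 := by
      refine closure_unique t (n + 1) (fun i hi => h2 i (by omega)) (fun i hi => h3 i (by omega))
        (fun i j h hj => hc i j h (by omega)) y.1 y.2 y'.2 ?_ ?_
      · rw [e2]; exact hy
      · rw [e2, hy1]; exact hy'
    have h := congrArg Prod.snd ey
    have h' := congrArg Prod.snd ey'
    simp only [Prod.snd_mul] at h h'
    rw [h, h', hy2]

/-- A permutation of `Fin n`, extended to `ℕ`. -/
def extPerm (n : ℕ) : Equiv.Perm (Fin n) →* Equiv.Perm ℕ :=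
  Equiv.Perm.extendDomainHom Fin.equivSubtype

theorem extPerm_swap {n i : ℕ} (h : i + 1 < n) :
    extPerm n (Equiv.swap ⟨i, by omega⟩ ⟨i + 1, h⟩) = Equiv.swap i (i + 1) := by
  ext x
  simp only [extPerm, Equiv.Perm.extendDomainHom_apply]
  by_cases hx : x < n
  · rw [Equiv.Perm.extendDomain_apply_subtype (p := fun i => i < n) _ _ hx]
    simp only [Equiv.swap_apply_def, Fin.equivSubtype]
    simp only [Equiv.coe_fn_symm_mk, Equiv.coe_fn_mk, Fin.mk.injEq]
    split_ifs <;> rfl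
  · rw [Equiv.Perm.extendDomain_apply_not_subtype (p := fun i => i < n) _ _ hx,
      Equiv.swap_apply_of_ne_of_ne (by omega) (by omega)]

theorem gen_mem (t : ℕ → M) {n i : ℕ} (h : i + 1 < n) :
    (Equiv.swap i (i + 1), t i) ∈ Submonoid.closure {y | ∃ i, i + 1 < n ∧ y = gen t i} :=
  Submonoid.subset_closure ⟨i, h, rfl⟩

/-- Elements of a monoid satisfying the Coxeter relations of the symmetric group define a
homomorphism from the symmetric group. -/
theorem exists_permHom (n : ℕ) (t : ℕ → M) (h2 : ∀ i, i + 1 < n → t i * t i = 1)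
    (h3 : ∀ i, i + 2 < n → t i * t (i + 1) * t i = t (i + 1) * t i * t (i + 1))
    (hc : ∀ i j, i + 1 < j → j + 1 < n → t i * t j = t j * t i) :
    ∃ φ : Equiv.Perm (Fin n) →* M, ∀ (i : ℕ) (h : i + 1 < n),
      φ (Equiv.swap ⟨i, by omega⟩ ⟨i + 1, h⟩) = t i := by
  set Γ := Submonoid.closure {y | ∃ i, i + 1 < n ∧ y = gen t i} with hΓ
  have hex : ∀ σ : Equiv.Perm (Fin n), ∃ m, (extPerm n σ, m) ∈ Γ := by
    intro σ
    cases n with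
    | zero =>
      refine ⟨1, ?_⟩
      rw [Subsingleton.elim σ 1, map_one]
      exact one_mem Γ
    | succ n =>
      have hσ : σ ∈ Submonoid.closure (Set.range fun i : Fin n =>
          Equiv.swap i.castSucc i.succ) := by
        rw [Equiv.Perm.mclosure_swap_castSucc_succ]; trivial
      induction hσ using Submonoid.closure_induction with
      | mem x hx =>
        obtain ⟨i, rfl⟩ := hx
        refine ⟨t i, ?_⟩
        have e : extPerm (n + 1) (Equiv.swap i.castSucc i.succ) = Equiv.swap (i : ℕ) (i + 1) :=
          extPerm_swap (n := n + 1) (i := i) (Nat.succ_lt_succ i.2)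
        rw [e]
        exact gen_mem t (Nat.succ_lt_succ i.2)
      | one =>
        refine ⟨1, ?_⟩
        rw [map_one]
        exact Submonoid.one_mem Γ
      | mul x y _ _ hx hy =>
        obtain ⟨a, ha⟩ := hx
        obtain ⟨b, hb⟩ := hy
        have hm := Γ.mul_mem ha hb
        rw [Prod.mk_mul_mk, ← map_mul] at hm
        exact ⟨a * b, hm⟩
  choose f hf using hex
  have huniq : ∀ σ m, (extPerm n σ, m) ∈ Γ → f σ = m := fun σ m hm =>
    closure_unique t n h2 h3 hc (extPerm n σ) _ _ (hf σ) hm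
  refine ⟨{ toFun := f, map_one' := ?_, map_mul' := ?_ }, ?_⟩
  · exact huniq 1 1 (by rw [map_one]; exact one_mem Γ)
  · intro x y
    have hm := Γ.mul_mem (hf x) (hf y)
    rw [Prod.mk_mul_mk, ← map_mul] at hm
    exact huniq _ _ hm
  · intro i h
    refine huniq _ _ ?_
    rw [extPerm_swap h]
    exact gen_mem t h

end Coxeter

section TensorPower

variable {C : Type*} [Category C] [MonoidalCategory C]

/-- `f` applied to the second and third factors. -/
abbrev onLast (Y : C) {X : C} (f : X ⊗ X ⟶ X ⊗ X) : (Y ⊗ X) ⊗ X ⟶ (Y ⊗ X) ⊗ X :=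
  (α_ Y X X).hom ≫ Y ◁ f ≫ (α_ Y X X).inv

variable (C) in
/-- An object with an endomorphism of its tensor square satisfying the relations of the symmetric
groups. -/
structure SymStrand where
  X : C
  c : X ⊗ X ⟶ X ⊗ X
  double : c ≫ c = 𝟙 (X ⊗ X)
  triple : c ▷ X ≫ onLast X c ≫ c ▷ X = onLast X c ≫ c ▷ X ≫ onLast X c

variable (S : SymStrand C)

/-- The `n`-th tensor power, i.e. `n` parallel strands. -/
@[reducible] def pow : ℕ → C
  | 0 => 𝟙_ C
  | n + 1 => pow n ⊗ S.X

/-- The crossing of the strands `i` and `i + 1` among `n` strands (counted from `0` on the left);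
the identity if `n ≤ i + 1`. -/
def crossAt : (n i : ℕ) → (pow S n ⟶ pow S n)
  | 0, _ => 𝟙 _
  | 1, _ => 𝟙 _
  | n + 2, i => if i = n then onLast (pow S n) S.c else crossAt (n + 1) i ▷ S.X

theorem onLast_sq (Y : C) : onLast Y S.c ≫ onLast Y S.c = 𝟙 _ := by
  simp [onLast, ← MonoidalCategory.whiskerLeft_comp_assoc, S.double]

theorem onLast_braid (Y : C) :
    onLast Y S.c ▷ S.X ≫ onLast (Y ⊗ S.X) S.c ≫ onLast Y S.c ▷ S.X =
      onLast (Y ⊗ S.X) S.c ≫ onLast Y S.c ▷ S.X ≫ onLast (Y ⊗ S.X) S.c := by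
  have h := congrArg (fun f => ((α_ Y S.X S.X).hom ▷ S.X ≫ (α_ Y (S.X ⊗ S.X) S.X).hom) ≫ Y ◁ f ≫
    ((α_ Y (S.X ⊗ S.X) S.X).inv ≫ (α_ Y S.X S.X).inv ▷ S.X)) S.triple
  have e1 : onLast Y S.c ▷ S.X = ((α_ Y S.X S.X).hom ▷ S.X ≫ (α_ Y (S.X ⊗ S.X) S.X).hom) ≫
      Y ◁ (S.c ▷ S.X) ≫ ((α_ Y (S.X ⊗ S.X) S.X).inv ≫ (α_ Y S.X S.X).inv ▷ S.X) := by
    simp [onLast]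
  have e2 : onLast (Y ⊗ S.X) S.c = ((α_ Y S.X S.X).hom ▷ S.X ≫ (α_ Y (S.X ⊗ S.X) S.X).hom) ≫
      Y ◁ (onLast S.X S.c) ≫ ((α_ Y (S.X ⊗ S.X) S.X).inv ≫ (α_ Y S.X S.X).inv ▷ S.X) := by
    simp only [onLast]
    monoidal
  rw [e1, e2]
  simp only [MonoidalCategory.whiskerLeft_comp, Category.assoc] at h ⊢
  simpa using h

theorem crossAt_last (n : ℕ) : crossAt S (n + 2) n = onLast (pow S n) S.c := if_pos rfl

theorem crossAt_of_ne {n i : ℕ} (h : i ≠ n) :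
    crossAt S (n + 2) i = crossAt S (n + 1) i ▷ S.X := if_neg h

theorem crossAt_double : ∀ n i, crossAt S n i ≫ crossAt S n i = 𝟙 _
  | 0, _ => Category.id_comp _
  | 1, _ => Category.id_comp _
  | n + 2, i => by
    by_cases h : i = n
    · subst h
      rw [crossAt_last]
      exact onLast_sq S _
    · rw [crossAt_of_ne S h, ← comp_whiskerRight, crossAt_double (n + 1) i, id_whiskerRight]

theorem crossAt_triple : ∀ n i, i + 2 < n →
    crossAt S n i ≫ crossAt S n (i + 1) ≫ crossAt S n i =
      crossAt S n (i + 1) ≫ crossAt S n i ≫ crossAt S n (i + 1)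
  | 0, i, h => by omega
  | 1, i, h => by omega
  | 2, i, h => by omega
  | n + 3, i, h => by
    by_cases hi : i = n
    · subst hi
      rw [crossAt_of_ne S (n := i + 1) (by omega), crossAt_last S i, crossAt_last S (i + 1)]
      exact onLast_braid S _
    · rw [crossAt_of_ne S (n := n + 1) (i := i) (by omega),
        crossAt_of_ne S (n := n + 1) (i := i + 1) (by omega)]
      simp only [← comp_whiskerRight]
      rw [crossAt_triple (n + 2) i (by omega)]

theorem crossAt_comm : ∀ n i j, i + 1 < j → j + 1 < n →
    crossAt S n i ≫ crossAt S n j = crossAt S n j ≫ crossAt S n i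
  | 0, i, j, h, h' => by omega
  | 1, i, j, h, h' => by omega
  | 2, i, j, h, h' => by omega
  | n + 3, i, j, h, h' => by
    by_cases hj : j = n + 1
    · subst hj
      rw [crossAt_of_ne S (n := n + 1) (i := i) (by omega),
        crossAt_of_ne S (n := n) (i := i) (by omega), crossAt_last S (n + 1)]
      rw [associator_naturality_left_assoc, ← whisker_exchange_assoc]
      simp
    · rw [crossAt_of_ne S (n := n + 1) (i := i) (by omega),
        crossAt_of_ne S (n := n + 1) (i := j) (by omega)]
      simp only [← comp_whiskerRight]
      rw [crossAt_comm (n + 2) i j h (by omega)]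

theorem exists_permDiagram (n : ℕ) :
    ∃ φ : Equiv.Perm (Fin n) →* End (pow S n), ∀ (i : ℕ) (h : i + 1 < n),
      φ (Equiv.swap ⟨i, by omega⟩ ⟨i + 1, h⟩) = crossAt S n i := by
  refine exists_permHom (M := End (pow S n)) n (fun i => crossAt S n i)
    (fun i _ => crossAt_double S n i) (fun i h => ?_) (fun i j h h' => ?_)
  · simp only [End.mul_def]
    rw [crossAt_triple S n i h]
  · exact (crossAt_comm S n i j h h').symm

/-- The homomorphism `S_n → End(X^{⊗ n})` sending the adjacent transposition `(i, i + 1)` to the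
crossing of the strands `i` and `i + 1`.  The diagram of `σ` connects the strand at position `i` at
the bottom with position `σ i` at the top. -/
noncomputable def permDiagram (n : ℕ) : Equiv.Perm (Fin n) →* End (pow S n) :=
  (exists_permDiagram S n).choose

/-- The induced homomorphism `k[S_n] → End(X^{⊗ n})`. -/
noncomputable def algDiagram (k : Type*) [CommRing k] [Preadditive C] [Linear k C] (n : ℕ) :
    MonoidAlgebra k (Equiv.Perm (Fin n)) →ₐ[k] End (pow S n) :=
  MonoidAlgebra.lift k _ _ (permDiagram S n)

/-- The strands of a tensor power split into the first `m` and the last `n`. -/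
def splitIso (m : ℕ) : (n : ℕ) → (pow S (m + n) ≅ pow S m ⊗ pow S n)
  | 0 => (ρ_ (pow S m)).symm
  | n + 1 => whiskerRightIso (splitIso m n) S.X ≪≫ α_ (pow S m) (pow S n) S.X

/-- `n` strands are `m` strands if `n = m`. -/
def castIso {n m : ℕ} (h : n = m) : pow S n ≅ pow S m := eqToIso (by rw [h])

end TensorPower

end Heis

namespace Heis

/-! ### Partitions: hooks, two rows, adding and removing a box -/

section Diagrams

theorem card_ofRowLens (w : List ℕ) (hw : w.SortedGE) :
    (YoungDiagram.ofRowLens w hw).card = w.sum := by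
  change (YoungDiagram.cellsOfRowLens w).card = w.sum
  clear hw
  induction w with
  | nil => rfl
  | cons a w ih =>
    rw [YoungDiagram.cellsOfRowLens, Finset.card_union_of_disjoint, Finset.card_map, ih]
    · simp
    · rw [Finset.disjoint_left]
      rintro ⟨i, j⟩ h1 h2
      simp only [Finset.mem_product, Finset.mem_singleton, Finset.mem_map, Prod.exists] at h1 h2
      obtain ⟨a', b', -, he⟩ := h2
      have := congrArg Prod.fst he
      simp at this
      omega

/-- The hook `(a, 1^b)`, for `a ≥ 1`. -/
def hook (a b : ℕ) (ha : 1 ≤ a) : YoungDiagram :=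
  YoungDiagram.ofRowLens (a :: List.replicate b 1) (by
    rw [List.sortedGE_iff_pairwise]
    simp [List.pairwise_replicate, ha])

theorem card_hook (a b : ℕ) (ha : 1 ≤ a) : (hook a b ha).card = a + b := by
  simp [hook, card_ofRowLens]

/-- The partition `(a, b)`, for `b ≤ a`. -/
def twoRow (a b : ℕ) (hab : b ≤ a) : YoungDiagram :=
  YoungDiagram.ofRowLens [a, b] (by
    rw [List.sortedGE_iff_pairwise]
    simp [hab])

theorem card_twoRow (a b : ℕ) (hab : b ≤ a) : (twoRow a b hab).card = a + b := by
  simp [twoRow, card_ofRowLens]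

/-- The rows (counted from `0`) of `mu` at the end of which a box can be removed. -/
def removableRows (mu : YoungDiagram) : Finset ℕ :=
  (Finset.range (mu.colLen 0)).filter fun s => mu.rowLen (s + 1) < mu.rowLen s

/-- The rows (counted from `0`, including the first empty row) of `lam` at the end of which a box
can be added. -/
def addableRows (lam : YoungDiagram) : Finset ℕ :=
  (Finset.range (lam.colLen 0 + 1)).filter fun s => ∀ t < s, lam.rowLen s < lam.rowLen t

/-- The diagram `mu(s⁻)`: the last box of the row `s` is removed. -/
def removeBox (mu : YoungDiagram) (s : removableRows mu) : YoungDiagram where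
  cells := mu.cells.erase (s.1, mu.rowLen s.1 - 1)
  isLowerSet := by
    have hs := (Finset.mem_filter.1 s.2).2
    rintro ⟨i, j⟩ ⟨i', j'⟩ ⟨hi, hj⟩ hm
    simp only [Finset.coe_erase, Set.mem_sdiff, Finset.mem_coe, YoungDiagram.mem_cells,
      Set.mem_singleton_iff, Prod.mk.injEq] at hm ⊢
    refine ⟨mu.isLowerSet (a := (i, j)) ⟨hi, hj⟩ hm.1, ?_⟩
    rintro ⟨rfl, rfl⟩
    obtain ⟨hm, hne⟩ := hm
    have hij := YoungDiagram.mem_iff_lt_rowLen.1 hm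
    simp only at hi hj
    rcases hi.lt_or_eq with h | h
    · have := mu.rowLen_anti _ _ (Nat.succ_le_of_lt h)
      simp only [Nat.succ_eq_add_one] at this
      omega
    · subst h
      exact hne ⟨rfl, by omega⟩

theorem lastBox_mem (mu : YoungDiagram) (s : removableRows mu) :
    (s.1, mu.rowLen s.1 - 1) ∈ mu := by
  have hs := (Finset.mem_filter.1 s.2).2
  exact YoungDiagram.mem_iff_lt_rowLen.2 (by omega)

theorem card_removeBox (mu : YoungDiagram) (s : removableRows mu) {n : ℕ} (h : mu.card = n) :
    (removeBox mu s).card = n - 1 := by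
  rw [← h]
  exact Finset.card_erase_of_mem (lastBox_mem mu s)

theorem eq_pred_add_one (mu : YoungDiagram) (s : removableRows mu) {n : ℕ} (h : mu.card = n) :
    n = (n - 1) + 1 := by
  have : 0 < mu.card := Finset.card_pos.2 ⟨_, lastBox_mem mu s⟩
  omega

/-- The diagram `lam(s⁺)`: a box is added at the end of the row `s`. -/
def addBox (lam : YoungDiagram) (s : addableRows lam) : YoungDiagram where
  cells := insert (s.1, lam.rowLen s.1) lam.cells
  isLowerSet := by
    have hs := (Finset.mem_filter.1 s.2).2
    rintro ⟨i, j⟩ ⟨i', j'⟩ ⟨hi, hj⟩ hm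
    simp only [Finset.coe_insert, Set.mem_insert_iff, Finset.mem_coe, YoungDiagram.mem_cells,
      Prod.mk.injEq] at hm ⊢
    simp only at hi hj
    rcases hm with ⟨rfl, rfl⟩ | hm
    · rcases hi.lt_or_eq with h | h
      · right
        exact YoungDiagram.mem_iff_lt_rowLen.2 (lt_of_le_of_lt hj (hs _ h))
      · subst h
        rcases hj.lt_or_eq with h | h
        · right; exact YoungDiagram.mem_iff_lt_rowLen.2 h
        · left; exact ⟨rfl, h⟩
    · right; exact lam.isLowerSet (a := (i, j)) ⟨hi, hj⟩ hm

theorem newBox_mem (lam : YoungDiagram) (s : addableRows lam) :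
    (s.1, lam.rowLen s.1) ∈ addBox lam s := Finset.mem_insert_self _ _

theorem card_addBox (lam : YoungDiagram) (s : addableRows lam) {n : ℕ} (h : lam.card = n) :
    (addBox lam s).card = n + 1 := by
  rw [← h]
  refine Finset.card_insert_of_notMem fun hm => ?_
  exact lt_irrefl _ (YoungDiagram.mem_iff_lt_rowLen.1 ((YoungDiagram.mem_cells _).1 hm))

end Diagrams

/-! ### Special elements of the symmetric group and its group algebra -/

/-- The permutation moving `p` to the last position and keeping the order of the other elements. -/
def moveToLast : {n : ℕ} → (p : Fin n) → Equiv.Perm (Fin n)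
  | _ + 1, p => (finSuccEquiv' p).trans (finSuccEquiv' (Fin.last _)).symm

/-- The permutation moving the first `m` elements behind the last `n`, keeping the order of the
first `m` and that of the last `n`. -/
def blockSwap (m n : ℕ) : Equiv.Perm (Fin (m + n)) :=
  finAddFlip.trans (finCongr (Nat.add_comm n m))

/-- The symmetrizer on the entries of the row `s` of the standard row filling of `lam`. -/
noncomputable def rowBox (k : Type*) [Field k] {n : ℕ} (lam : YoungDiagram) (h : lam.card = n)
    (s : ℕ) : MonoidAlgebra k (Equiv.Perm (Fin n)) :=
  symBox k (fixingSubgroup (Equiv.Perm (Fin n)) {i | rowOf lam h i ≠ s})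

/-! ### The Heisenberg category -/

open Limits Idempotents

section Category

variable (k : Type*)

/-- The object `Q₊`: an upward strand. -/
def up : Word k := Ob.up

/-- The object `Q₋`: a downward strand. -/
def down : Word k := Ob.down

variable [CommRing k]

/-- The upward strand with the upward crossing. -/
def upStrand : SymStrand (Word k) where
  X := up k
  c := dia (k := k) Tm.cross
  double := Quotient.sound Tm.Rel.up_double
  triple := Quotient.sound Tm.Rel.up_triple

/-- The downward strand with the downward crossing. -/
def downStrand : SymStrand (Word k) where
  X := down k
  c := dia (k := k) Tm.crossQQ
  double := Quotient.sound Tm.Rel.down_double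
  triple := Quotient.sound Tm.Rel.down_triple

/-- The Heisenberg category: the Karoubi envelope of the additive closure of the category of
diagrams. -/
abbrev Heisenberg := Karoubi (Mat_ (Word k))

instance : HasBinaryBiproducts (Heisenberg k) := hasBinaryBiproducts_of_finite_biproducts _

/-- The inclusion of the idempotents between words into the Heisenberg category. -/
noncomputable def toHeis : Karoubi (Word k) ⥤ Heisenberg k :=
  (functorExtension₂ (Word k) (Mat_ (Word k))).obj (Mat_.embedding (Word k))

variable {k}

/-- The tensor product `(X, e) ⊗ (X', e') = (X ⊗ X', e ⊗ e')`. -/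
def tens (A B : Karoubi (Word k)) : Karoubi (Word k) where
  X := A.X ⊗ B.X
  p := A.p ⊗ₘ B.p
  idem := by rw [MonoidalCategory.tensorHom_comp_tensorHom, A.idem, B.idem]

/-- The morphism `(X, e) ⟶ (X', e')` of the Heisenberg category given by `e' ∘ f ∘ e`, for a
diagram `f : X ⟶ X'`. -/
noncomputable def between (A B : Karoubi (Word k)) (f : A.X ⟶ B.X) : (toHeis k).obj A ⟶ (toHeis k).obj B :=
  (toHeis k).map ⟨A.p ≫ f ≫ B.p, by simp⟩

variable (k) in
/-- The sideways crossing `Q₋ⁿ ⊗ Q₊ → Q₊ ⊗ Q₋ⁿ`. -/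
def sideQP : (n : ℕ) → (pow (downStrand k) n ⊗ up k ⟶ up k ⊗ pow (downStrand k) n)
  | 0 => (λ_ (up k)).hom ≫ (ρ_ (up k)).inv
  | n + 1 => (α_ _ (down k) (up k)).hom ≫ pow (downStrand k) n ◁ dia (k := k) Tm.crossQP ≫
      (α_ _ (up k) (down k)).inv ≫ sideQP n ▷ down k ≫ (α_ _ _ _).hom

variable (k) in
/-- The sideways crossing `Q₊ ⊗ Q₋ⁿ → Q₋ⁿ ⊗ Q₊`. -/
def sidePQ : (n : ℕ) → (up k ⊗ pow (downStrand k) n ⟶ pow (downStrand k) n ⊗ up k)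
  | 0 => (ρ_ (up k)).hom ≫ (λ_ (up k)).inv
  | n + 1 => (α_ _ _ _).inv ≫ sidePQ n ▷ down k ≫ (α_ _ (up k) (down k)).hom ≫
      pow (downStrand k) n ◁ dia (k := k) Tm.crossPQ ≫ (α_ _ (down k) (up k)).inv

variable (k) in
/-- Connect the last of the `n + 1` downward strands with the upward strand on their right by a
cap. -/
def capLast (n : ℕ) : pow (downStrand k) (n + 1) ⊗ up k ⟶ pow (downStrand k) n :=
  (α_ _ (down k) (up k)).hom ≫ pow (downStrand k) n ◁ dia (k := k) Tm.capQP ≫ (ρ_ _).hom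

variable (k) in
/-- Create a last downward strand and an upward strand on its right by a cup. -/
def cupLast (n : ℕ) : pow (downStrand k) n ⟶ pow (downStrand k) (n + 1) ⊗ up k :=
  (ρ_ _).inv ≫ pow (downStrand k) n ◁ dia (k := k) Tm.cupQP ≫ (α_ _ (down k) (up k)).inv

end Category

section Objects

variable (k : Type*) [Field k] {n : ℕ}

/-- The diagram of an element of `k[Sₙ]` on `n` upward strands. -/
noncomputable def upDia (x : MonoidAlgebra k (Equiv.Perm (Fin n))) :
    pow (upStrand k) n ⟶ pow (upStrand k) n := algDiagram (upStrand k) k n x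

/-- The diagram of an element of `k[Sₙ]` on `n` downward strands. -/
noncomputable def downDia (x : MonoidAlgebra k (Equiv.Perm (Fin n))) :
    pow (downStrand k) n ⟶ pow (downStrand k) n := algDiagram (downStrand k) k n x

/-- The diagram of a permutation on `n` upward strands. -/
noncomputable def upPerm (σ : Equiv.Perm (Fin n)) : pow (upStrand k) n ⟶ pow (upStrand k) n :=
  permDiagram (upStrand k) n σ

/-- The diagram of a permutation on `n` downward strands. -/
noncomputable def downPerm (σ : Equiv.Perm (Fin n)) :
    pow (downStrand k) n ⟶ pow (downStrand k) n :=
  permDiagram (downStrand k) n σ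

/-- The crossing of `m` upward strands with `n` upward strands. -/
noncomputable def thickCross (m n : ℕ) :
    pow (upStrand k) m ⊗ pow (upStrand k) n ⟶ pow (upStrand k) n ⊗ pow (upStrand k) m :=
  (splitIso (upStrand k) m n).inv ≫ upPerm k (blockSwap m n) ≫
    (castIso (upStrand k) (Nat.add_comm m n)).hom ≫ (splitIso (upStrand k) n m).hom

variable {k} in
/-- The object `(Q₊ⁿ, x)` given by an idempotent `x` of `k[Sₙ]`. -/
noncomputable def upOb (x : MonoidAlgebra k (Equiv.Perm (Fin n))) (hx : x * x = x) :
    Karoubi (Word k) where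
  X := pow (upStrand k) n
  p := upDia k x
  idem := (map_mul (algDiagram (upStrand k) k n) x x).symm.trans
    (congrArg (algDiagram (upStrand k) k n) hx)

variable {k} in
/-- The object `(Q₋ⁿ, x)` given by an idempotent `x` of `k[Sₙ]`. -/
noncomputable def downOb (x : MonoidAlgebra k (Equiv.Perm (Fin n))) (hx : x * x = x) :
    Karoubi (Word k) where
  X := pow (downStrand k) n
  p := downDia k x
  idem := (map_mul (algDiagram (downStrand k) k n) x x).symm.trans
    (congrArg (algDiagram (downStrand k) k n) hx)

/-- The object `P`. -/
def P1 : Karoubi (Word k) := ⟨up k, 𝟙 (up k), Category.comp_id _⟩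

variable [CharZero k]

/-- The object `P^λ`. -/
noncomputable def P (lam : YoungDiagram) (h : lam.card = n) : Karoubi (Word k) :=
  upOb (young lam h k) (young_mul_young lam h k)

/-- The object `Q^λ`. -/
noncomputable def Q (lam : YoungDiagram) (h : lam.card = n) : Karoubi (Word k) :=
  downOb (young lam h k) (young_mul_young lam h k)

/-- The object `P^{(n)}`, given by the complete symmetrizer. -/
noncomputable def Psym (n : ℕ) : Karoubi (Word k) :=
  upOb (symBox k (⊤ : Subgroup (Equiv.Perm (Fin n)))) (box_mul_box _)

/-- The object `P^{(n)^t}`, given by the complete antisymmetrizer. -/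
noncomputable def Palt (n : ℕ) : Karoubi (Word k) :=
  upOb (antiBox k (⊤ : Subgroup (Equiv.Perm (Fin n)))) (box_mul_box _)

/-! ### The inclusions and projections -/

namespace Hook

/-- The inclusion `P^{(n, 1^m)} → P^{(n)} P^{(m)^t}`. -/
noncomputable def iotaTop (n m : ℕ) (hn : 1 ≤ n) :
    (toHeis k).obj (P k (hook n m hn) (card_hook n m hn)) ⟶
      (toHeis k).obj (tens (Psym k n) (Palt k m)) :=
  between (P k (hook n m hn) (card_hook n m hn)) (tens (Psym k n) (Palt k m))
    (splitIso (upStrand k) n m).hom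

/-- The projection `P^{(n)} P^{(m)^t} → P^{(n, 1^m)}`. -/
noncomputable def rhoTop (n m : ℕ) (hn : 1 ≤ n) :
    (toHeis k).obj (tens (Psym k n) (Palt k m)) ⟶
      (toHeis k).obj (P k (hook n m hn) (card_hook n m hn)) :=
  between (tens (Psym k n) (Palt k m)) (P k (hook n m hn) (card_hook n m hn))
    (splitIso (upStrand k) n m).inv

theorem card_low (n m : ℕ) (hm : 1 < m) :
    (hook (n + 1) (m - 1) (Nat.le_add_left 1 n)).card = n + m := by
  rw [card_hook]; omega

/-- The inclusion `P^{(n + 1, 1^(m - 1))} → P^{(n)} P^{(m)^t}`, with the factor `m`. -/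
noncomputable def iotaLow (n m : ℕ) (hm : 1 < m) :
    (toHeis k).obj (P k (hook (n + 1) (m - 1) (Nat.le_add_left 1 n)) (card_low n m hm)) ⟶
      (toHeis k).obj (tens (Psym k n) (Palt k m)) :=
  between (P k (hook (n + 1) (m - 1) (Nat.le_add_left 1 n)) (card_low n m hm))
    (tens (Psym k n) (Palt k m)) ((m : k) • (splitIso (upStrand k) n m).hom)

/-- The projection `P^{(n)} P^{(m)^t} → P^{(n + 1, 1^(m - 1))}`. -/
noncomputable def rhoLow (n m : ℕ) (hm : 1 < m) :
    (toHeis k).obj (tens (Psym k n) (Palt k m)) ⟶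
      (toHeis k).obj (P k (hook (n + 1) (m - 1) (Nat.le_add_left 1 n)) (card_low n m hm)) :=
  between (tens (Psym k n) (Palt k m))
    (P k (hook (n + 1) (m - 1) (Nat.le_add_left 1 n)) (card_low n m hm))
    (splitIso (upStrand k) n m).inv

end Hook

namespace TwoRow

/-- The partition `(m + n - s, s)`, for `0 ≤ s ≤ min m n`. -/
def shape (m n : ℕ) (s : Fin (min m n + 1)) : YoungDiagram :=
  twoRow (m + n - s) s (by have := s.2; omega)

theorem card_shape (m n : ℕ) (s : Fin (min m n + 1)) : (shape m n s).card = m + n := by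
  have := s.2
  rw [shape, card_twoRow]; omega

/-- The diagram from `m + n` strands to `m` and `n` strands.  If `m < n`, the strands are first
split into `n` and `m`, symmetrized, and then crossed. -/
noncomputable def splitDia (m n : ℕ) :
    pow (upStrand k) (m + n) ⟶ pow (upStrand k) m ⊗ pow (upStrand k) n :=
  if m < n then
    (castIso (upStrand k) (Nat.add_comm m n)).hom ≫ (splitIso (upStrand k) n m).hom ≫
      (tens (Psym k n) (Psym k m)).p ≫ thickCross k n m
  else (splitIso (upStrand k) m n).hom

/-- The diagram from `m` and `n` strands to `m + n` strands.  If `m < n`, the strands are first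
crossed and symmetrized in groups of `n` and `m`. -/
noncomputable def mergeDia (m n : ℕ) :
    pow (upStrand k) m ⊗ pow (upStrand k) n ⟶ pow (upStrand k) (m + n) :=
  if m < n then
    thickCross k m n ≫ (tens (Psym k n) (Psym k m)).p ≫ (splitIso (upStrand k) n m).inv ≫
      (castIso (upStrand k) (Nat.add_comm m n)).inv
  else (splitIso (upStrand k) m n).inv

/-- The inclusion `P^{(m + n - s, s)} → P^{(m)} P^{(n)}`. -/
noncomputable def iota (m n : ℕ) (s : Fin (min m n + 1)) :
    (toHeis k).obj (P k (shape m n s) (card_shape m n s)) ⟶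
      (toHeis k).obj (tens (Psym k m) (Psym k n)) :=
  between (P k (shape m n s) (card_shape m n s)) (tens (Psym k m) (Psym k n))
    (((min m n).choose s : k) • splitDia k m n)

/-- The projection `P^{(m)} P^{(n)} → P^{(m + n - s, s)}`. -/
noncomputable def rho (m n : ℕ) (s : Fin (min m n + 1)) :
    (toHeis k).obj (tens (Psym k m) (Psym k n)) ⟶
      (toHeis k).obj (P k (shape m n s) (card_shape m n s)) :=
  between (tens (Psym k m) (Psym k n)) (P k (shape m n s) (card_shape m n s)) (mergeDia k m n)

end TwoRow

namespace QP

variable (mu : YoungDiagram) (h : mu.card = n)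

/-- The projection `Q^μ P → P Q^μ`. -/
noncomputable def rhoZero :
    (toHeis k).obj (tens (Q k mu h) (P1 k)) ⟶ (toHeis k).obj (tens (P1 k) (Q k mu h)) :=
  between (tens (Q k mu h) (P1 k)) (tens (P1 k) (Q k mu h)) (sideQP k n)

/-- The inclusion `P Q^μ → Q^μ P`. -/
noncomputable def iotaZero :
    (toHeis k).obj (tens (P1 k) (Q k mu h)) ⟶ (toHeis k).obj (tens (Q k mu h) (P1 k)) :=
  between (tens (P1 k) (Q k mu h)) (tens (Q k mu h) (P1 k)) (sidePQ k n)

variable (s : removableRows mu)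

/-- The projection `Q^μ P → Q^{μ(s⁻)}`: symmetrize the row `s`, move its last strand to the right,
and connect it with the upward strand by a cap. -/
noncomputable def rho :
    (toHeis k).obj (tens (Q k mu h) (P1 k)) ⟶
      (toHeis k).obj (Q k (removeBox mu s) (card_removeBox mu s h)) :=
  between (tens (Q k mu h) (P1 k)) (Q k (removeBox mu s) (card_removeBox mu s h))
    ((downDia k (rowBox k mu h s) ≫
        downPerm k (moveToLast (entry mu h _ (lastBox_mem mu s))) ≫
        (castIso (downStrand k) (eq_pred_add_one mu s h)).hom) ▷ up k ≫
      capLast k (n - 1))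

/-- The inclusion `Q^{μ(s⁻)} → Q^μ P`: symmetrize the row `s`, create a last strand and an upward
strand by a cup, and move the former to the end of the row `s`.  The scalar is
`n dim(μ(s⁻)) / dim(μ)`. -/
noncomputable def iota :
    (toHeis k).obj (Q k (removeBox mu s) (card_removeBox mu s h)) ⟶
      (toHeis k).obj (tens (Q k mu h) (P1 k)) :=
  between (Q k (removeBox mu s) (card_removeBox mu s h)) (tens (Q k mu h) (P1 k))
    (((n : k) * (spechtDim (removeBox mu s) (card_removeBox mu s h) k : k) /
        (spechtDim mu h k : k)) •
      (downDia k (rowBox k (removeBox mu s) (card_removeBox mu s h) s) ≫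
        cupLast k (n - 1) ≫
        ((castIso (downStrand k) (eq_pred_add_one mu s h)).inv ≫
          downPerm k (moveToLast (entry mu h _ (lastBox_mem mu s)))⁻¹) ▷ up k))

end QP

namespace PP

variable (lam : YoungDiagram) (h : lam.card = n) (s : addableRows lam)

/-- The inclusion `P^{λ(s⁺)} → P^λ P`: symmetrize the row `s` and move its last strand to the
right. -/
noncomputable def iota :
    (toHeis k).obj (P k (addBox lam s) (card_addBox lam s h)) ⟶
      (toHeis k).obj (tens (P k lam h) (P1 k)) :=
  between (P k (addBox lam s) (card_addBox lam s h)) (tens (P k lam h) (P1 k))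
    (upDia k (rowBox k (addBox lam s) (card_addBox lam s h) s) ≫
      upPerm k (moveToLast (entry (addBox lam s) (card_addBox lam s h) _ (newBox_mem lam s))))

/-- The projection `P^λ P → P^{λ(s⁺)}`: symmetrize the row `s` and move the last strand to its
end. -/
noncomputable def rho :
    (toHeis k).obj (tens (P k lam h) (P1 k)) ⟶
      (toHeis k).obj (P k (addBox lam s) (card_addBox lam s h)) :=
  between (tens (P k lam h) (P1 k)) (P k (addBox lam s) (card_addBox lam s h))
    (upDia k (rowBox k lam h s) ▷ up k ≫
      upPerm k
        (moveToLast (entry (addBox lam s) (card_addBox lam s h) _ (newBox_mem lam s)))⁻¹)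

end PP

end Objects

end Heis

/-! The decompositions that involve only upward strands are images of identities in group algebras
of symmetric groups. In `k[S_N]` one has an idempotent `z` and wants `z = ∑ a_s b_s` with `b_s a_t =
δ_{st} e_{μ_s}`. Vanishing for distinct shapes is `young_mul_mul_young_of_ne`: one order of the
product is killed by the dominance order, and the other follows because the group algebra is
semiprime. For equal shapes, the elements invariant under the rows on the left and alternating under
the columns on the right form a line, so `e_μ z e_μ` is a multiple of `e_μ`, and only the scalar has
to be found. For adding and removing a box it comes from the absorption rule `e_μ e_λ e_μ = e_μ` for
a subdiagram `λ` with compatible filling (`young_mul_push_mul_young`); for hooks and two rows it is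
the proportion of permutations of one block that do not give zero.

Completeness is a dimension count. Right multiplication by `x` on `k[S_N]` has trace `N!` times the
coefficient of `x` at `1`, and `z - ∑ a_s b_s` is an idempotent whose trace is its rank; it is zero
as soon as the dimensions agree (`exists_trace_eq_sum_add`). The required dimensions come from the
branching rules, and these are obtained by the same argument. The trace gives the inequalities `∑
f_{λ+□} ≤ (n + 1) f_λ` and `∑ f_{μ-□} ≤ f_μ`; the commutation of adding and removing boxes in
Young's lattice (`sum_add_remove`) forces equality in both, by induction on `n`
(`spechtDim_branching`). The dimensions of hooks and two-row shapes follow.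

For `Q^μ P` the diagrams enter. Rotating the crossing yields the rules by which a downward crossing
slides through caps, cups and upward strands. Hence the double sideways crossing of `n + 1` downward
strands with an upward one is the identity minus the sum, over all strands, of the diagram in which
that strand is capped and cupped with the upward one (`Strands.sideQP_comp_sidePQ`). A permutation
between a cup and a cap gives the conditional expectation `k[S_{n+1}] → k[S_n]`. So the sum over
strands is the Casimir element of this Frobenius extension, and cutting it by `e_μ` on both sides
turns it into a sum over the removable boxes of `μ` (`sum_balanced_young`); the scalar `n f_λ / f_μ`
normalizes the conditional expectation of a conjugate of `e_μ` between two copies of `e_λ`. -/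

namespace Heis

/-! ### The trace form on the group algebra and semiprimeness -/

section GroupAlgebra

variable {k : Type*} [Field k] {n : ℕ}

theorem coeff_one_mul_comm (x y : MonoidAlgebra k (Equiv.Perm (Fin n))) :
    (x * y).coeff 1 = (y * x).coeff 1 := by
  induction x using MonoidAlgebra.induction_linear with
  | zero => simp
  | add a b ha hb =>
    simp only [add_mul, mul_add, MonoidAlgebra.coeff_add, Finsupp.add_apply, ha, hb]
  | single m r => simp [MonoidAlgebra.coeff_single_mul_apply, MonoidAlgebra.coeff_mul_single_apply,
      mul_comm]

/-- The coefficient at `1` is, up to the factor `n!`, the trace of right multiplication, and a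
nilpotent operator has trace zero. -/
theorem coeff_one_eq_zero_of_sq [CharZero k] {x : MonoidAlgebra k (Equiv.Perm (Fin n))}
    (h : x * x = 0) : x.coeff 1 = 0 := by
  have h1 := trace_mulRight k x
  have h2 : LinearMap.trace k _ (LinearMap.mulRight k x) = 0 := by
    apply IsNilpotent.eq_zero
    apply LinearMap.isNilpotent_trace_of_isNilpotent
    refine ⟨2, ?_⟩
    rw [pow_two, Module.End.mul_eq_comp, ← LinearMap.mulRight_mul, h,
      LinearMap.mulRight_zero_eq_zero]
  rw [h2] at h1
  exact (mul_eq_zero.1 h1.symm).resolve_left (by exact_mod_cast n.factorial_ne_zero)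

/-- The group algebra of the symmetric group is semiprime. -/
theorem eq_zero_of_mul_mul_eq_zero [CharZero k] {z : MonoidAlgebra k (Equiv.Perm (Fin n))}
    (h : ∀ a, z * a * z = 0) : z = 0 := by
  ext g
  -- The coefficient of `z` at `g` is that of `z g⁻¹` at `1`, and `z g⁻¹` has square zero by
  -- hypothesis.
  have h1 : (z * MonoidAlgebra.single g⁻¹ 1).coeff 1 = 0 := by
    apply coeff_one_eq_zero_of_sq
    rw [← mul_assoc, h, zero_mul]
  simpa [MonoidAlgebra.coeff_mul_single_apply] using h1

end GroupAlgebra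

/-! ### Orthogonality of Young idempotents and the scalars in their products -/

section Young

variable {k : Type*} [Field k] {n : ℕ} (lam : YoungDiagram) (h : lam.card = n)

theorem colLen_card_filter (i j : ℕ) :
    (Finset.univ.filter fun x : Fin n => rowOf lam h x < i ∧ colOf lam h x = j).card =
      min i (lam.colLen j) := by
  rw [← Finset.card_range (min i (lam.colLen j))]
  refine Finset.card_bij (fun x _ => rowOf lam h x) ?_ ?_ ?_
  · intro x hx
    simp only [Finset.mem_filter, Finset.mem_univ, true_and] at hx
    have := YoungDiagram.mem_iff_lt_colLen.1 (rowOf_colOf_mem lam h x)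
    rw [hx.2] at this
    simp [hx.1, this]
  · intro x hx y hy hxy
    simp only [Finset.mem_filter, Finset.mem_univ, true_and] at hx hy
    exact eq_of_rowOf_colOf lam h hxy (hx.2.trans hy.2.symm)
  · intro r hr
    simp only [Finset.mem_range, lt_min_iff] at hr
    have hm : (r, j) ∈ lam := YoungDiagram.mem_iff_lt_colLen.2 hr.2
    exact ⟨entry lam h _ hm, by simp [rowOf_entry, colOf_entry, hr.1], rowOf_entry lam h _ hm⟩

theorem card_filter_rowOf_eq (i : ℕ) :
    (Finset.univ.filter fun x : Fin n => rowOf lam h x = i).card = lam.rowLen i := by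
  rw [← Finset.card_range (lam.rowLen i)]
  refine Finset.card_bij (fun x _ => colOf lam h x) ?_ ?_ ?_
  · intro x hx
    simp only [Finset.mem_filter, Finset.mem_univ, true_and] at hx
    have := YoungDiagram.mem_iff_lt_rowLen.1 (rowOf_colOf_mem lam h x)
    rw [hx] at this
    simp [this]
  · intro x hx y hy hxy
    simp only [Finset.mem_filter, Finset.mem_univ, true_and] at hx hy
    exact eq_of_rowOf_colOf lam h (hx.trans hy.symm) hxy
  · intro r hr
    simp only [Finset.mem_range] at hr
    have hm : (i, r) ∈ lam := YoungDiagram.mem_iff_lt_rowLen.2 hr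
    exact ⟨entry lam h _ hm, by simp [rowOf_entry], colOf_entry lam h _ hm⟩

theorem card_filter_rowOf_lt (i : ℕ) :
    (Finset.univ.filter fun x : Fin n => rowOf lam h x < i).card =
      ∑ t ∈ Finset.range i, lam.rowLen t := by
  rw [Finset.card_eq_sum_card_fiberwise (f := rowOf lam h) (t := Finset.range i)
    (fun x hx => by simpa using hx)]
  refine Finset.sum_congr rfl fun t ht => ?_
  rw [← card_filter_rowOf_eq lam h, Finset.filter_filter]
  congr 1
  ext x
  simp only [Finset.mem_range] at ht
  simp only [Finset.mem_filter, Finset.mem_univ, true_and]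
  constructor
  · exact fun hx => hx.2
  · exact fun hx => ⟨hx ▸ ht, hx⟩

theorem eq_of_rowLen {lam mu : YoungDiagram} (h : ∀ i, lam.rowLen i = mu.rowLen i) : lam = mu := by
  apply YoungDiagram.ext
  ext ⟨i, j⟩
  rw [YoungDiagram.mem_cells, YoungDiagram.mem_cells, YoungDiagram.mem_iff_lt_rowLen,
    YoungDiagram.mem_iff_lt_rowLen, h]

variable {lam h} {mu : YoungDiagram} {h' : mu.card = n}

/-- If `g` moves no two entries of a row of `mu` to the same column of `lam`, then `lam` dominates
`mu`. -/
theorem sum_rowLen_le_of_injOn {g : Equiv.Perm (Fin n)}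
    (H : ∀ x y, x ≠ y → rowOf mu h' x = rowOf mu h' y → colOf lam h (g x) ≠ colOf lam h (g y))
    (i : ℕ) : ∑ t ∈ Finset.range i, mu.rowLen t ≤ ∑ t ∈ Finset.range i, lam.rowLen t := by
  rw [← card_filter_rowOf_lt mu h', ← card_filter_rowOf_lt lam h]
  -- Compare column by column of `lam`. Column `j` has `min i (colLen j)` boxes in the first `i`
  -- rows. At most that many entries of the first `i` rows of `mu` land in it: they lie in distinct
  -- rows of `mu`, and they occupy distinct boxes of the column.
  let N := (Finset.univ : Finset (Fin n)).image (colOf lam h)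
  rw [Finset.card_eq_sum_card_fiberwise (f := fun x => colOf lam h (g x)) (t := N)
      (fun x _ => by simp [N]),
    Finset.card_eq_sum_card_fiberwise (f := colOf lam h) (t := N) (fun x _ => by simp [N])]
  refine Finset.sum_le_sum fun j _ => ?_
  rw [Finset.filter_filter, Finset.filter_filter, colLen_card_filter, le_min_iff]
  constructor
  · rw [← Finset.card_range i]
    refine Finset.card_le_card_of_injOn (rowOf mu h') ?_ ?_
    · intro x hx
      simp only [Finset.coe_filter, Finset.mem_univ, true_and, Set.mem_ofPred_eq] at hx
      simpa using hx.1
    · intro x hx y hy hxy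
      simp only [Finset.coe_filter, Finset.mem_univ, true_and, Set.mem_ofPred_eq] at hx hy
      by_contra hne
      exact H x y hne hxy (hx.2.trans hy.2.symm)
  · rw [← Finset.card_range (lam.colLen j)]
    refine Finset.card_le_card_of_injOn (fun x => rowOf lam h (g x)) ?_ ?_
    · intro x hx
      simp only [Finset.coe_filter, Finset.mem_univ, true_and, Set.mem_ofPred_eq] at hx
      have := YoungDiagram.mem_iff_lt_colLen.1 (rowOf_colOf_mem lam h (g x))
      rw [hx.2] at this
      simpa using this
    · intro x hx y hy hxy
      simp only [Finset.coe_filter, Finset.mem_univ, true_and, Set.mem_ofPred_eq] at hx hy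
      exact g.injective (eq_of_rowOf_colOf lam h hxy (hx.2.trans hy.2.symm))

theorem swap_mem_fibreGroup {f : Fin n → ℕ} {x y : Fin n} (hxy : f x = f y) :
    Equiv.swap x y ∈ fibreGroup f := by
  intro i
  by_cases hx : i = x
  · subst hx; rw [Equiv.swap_apply_left, hxy]
  · by_cases hy : i = y
    · subst hy; rw [Equiv.swap_apply_right, hxy]
    · rw [Equiv.swap_apply_of_ne_of_ne hx hy]

/-- The transposition of `x` and `y` is absorbed by the symmetrizer with sign `+`; moved through `g`
it is absorbed by the antisymmetrizer with sign `-`. So the product equals its own negative. -/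
theorem anti_single_sym_eq_zero [CharZero k] {G H : Subgroup (Equiv.Perm (Fin n))}
    {g : Equiv.Perm (Fin n)} {x y : Fin n} (hne : x ≠ y) (hH : Equiv.swap x y ∈ H)
    (hG : Equiv.swap (g x) (g y) ∈ G) :
    antiBox k G * MonoidAlgebra.single g 1 * symBox k H = 0 := by
  have h1 : antiBox k G * MonoidAlgebra.single (Equiv.swap (g x) (g y)) 1 = - antiBox k G := by
    rw [antiBox, box_mul_single _ hG, Equiv.Perm.sign_swap (by simpa using hne)]
    simp
  have h2 : MonoidAlgebra.single (Equiv.swap x y) 1 * symBox k H = symBox k H := by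
    rw [symBox, single_mul_box _ hH]; simp
  have h3 : antiBox k G * MonoidAlgebra.single g 1 * symBox k H =
      - (antiBox k G * MonoidAlgebra.single g 1 * symBox k H) := by
    conv_lhs => rw [← h2]
    rw [← neg_mul, ← neg_mul, ← h1]
    simp only [mul_assoc]
    rw [← mul_assoc (MonoidAlgebra.single g 1), ← mul_assoc (MonoidAlgebra.single _ 1),
      MonoidAlgebra.single_mul_single, MonoidAlgebra.single_mul_single, Equiv.mul_swap_eq_swap_mul]
  have h4 : (2 : k) • (antiBox k G * MonoidAlgebra.single g 1 * symBox k H) = 0 := by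
    rw [two_smul]
    nth_rewrite 1 [h3]
    exact neg_add_cancel _
  exact (smul_eq_zero.1 h4).resolve_left two_ne_zero

theorem mul_eq_zero_of_single {x y : MonoidAlgebra k (Equiv.Perm (Fin n))}
    (h : ∀ g, x * MonoidAlgebra.single g 1 * y = 0) (a : MonoidAlgebra k (Equiv.Perm (Fin n))) :
    x * a * y = 0 := by
  induction a using MonoidAlgebra.induction_on with
  | of g => exact h g
  | add a b ha hb => rw [mul_add, add_mul, ha, hb, add_zero]
  | smul r a ha => rw [mul_smul_comm, smul_mul_assoc, ha, smul_zero]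

/-- If the product is nonzero for some `a`, then `lam` dominates `mu`. Hence for `lam ≠ mu` at least
one order of the factors always gives zero. If it is the opposite order, then `z = e_lam a e_mu`
satisfies `z b z = 0` for all `b`, and semiprimeness applies. -/
theorem young_mul_mul_young_of_ne [CharZero k] (hne : lam ≠ mu)
    (a : MonoidAlgebra k (Equiv.Perm (Fin n))) : young lam h k * a * young mu h' k = 0 := by
  have key : ∀ {lam mu : YoungDiagram} {h : lam.card = n} {h' : mu.card = n},
      (¬ ∀ i, ∑ t ∈ Finset.range i, mu.rowLen t ≤ ∑ t ∈ Finset.range i, lam.rowLen t) →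
      ∀ a, young lam h k * a * young mu h' k = 0 := by
    intro lam mu h h' H a
    have : antiBox k (colGroup lam h) * a * symBox k (rowGroup mu h') = 0 := by
      apply mul_eq_zero_of_single
      intro g
      by_contra hg
      apply H
      apply sum_rowLen_le_of_injOn (h := h) (h' := h') (g := g)
      intro x y hxy hr hc
      exact hg (anti_single_sym_eq_zero hxy (swap_mem_fibreGroup hr) (swap_mem_fibreGroup hc))
    rw [young, young, youngQuasi, youngQuasi, smul_mul_assoc, smul_mul_smul_comm,
      mul_assoc (symBox k (rowGroup lam h)), ← mul_assoc (symBox k (rowGroup lam h) * _),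
      mul_assoc (symBox k (rowGroup lam h)), this, mul_zero, zero_mul, smul_zero]
  by_cases H : ∀ i, ∑ t ∈ Finset.range i, mu.rowLen t ≤ ∑ t ∈ Finset.range i, lam.rowLen t
  · apply eq_zero_of_mul_mul_eq_zero
    intro b
    have : young mu h' k * b * young lam h k = 0 := by
      apply key
      intro H'
      have hs : ∀ i, ∑ t ∈ Finset.range i, mu.rowLen t = ∑ t ∈ Finset.range i, lam.rowLen t :=
        fun i => le_antisymm (H i) (H' i)
      refine hne (eq_of_rowLen fun i => ?_)
      have h1 := hs i
      have h2 := hs (i + 1)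
      rw [Finset.sum_range_succ, Finset.sum_range_succ, h1] at h2
      omega
    calc young lam h k * a * young mu h' k * b * (young lam h k * a * young mu h' k)
        = young lam h k * a * (young mu h' k * b * young lam h k) * a * young mu h' k := by
          simp only [mul_assoc]
      _ = 0 := by rw [this]; simp
  · exact key H a

variable (lam h)

theorem youngQuasi_coeff_one_ne_zero [CharZero k] : (youngQuasi lam h k).coeff 1 ≠ 0 := by
  rw [youngQuasi_coeff_one]
  exact inv_ne_zero (mul_ne_zero (by exact_mod_cast Nat.card_pos.ne')
    (by exact_mod_cast Nat.card_pos.ne'))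

theorem spechtDim_ne_zero [CharZero k] : spechtDim lam h k ≠ 0 := by
  intro h0
  have h1 := Submodule.finrank_eq_zero.1 h0
  have h2 : youngQuasi lam h k ∈ LinearMap.range (LinearMap.mulRight k (youngQuasi lam h k)) :=
    ⟨1, by simp⟩
  rw [h1, Submodule.mem_bot] at h2
  apply youngQuasi_coeff_one_ne_zero lam h (k := k)
  rw [h2]; simp

/-- The row and column orders in the normalizing scalar cancel against the coefficient of the
product of boxes. This is how dimensions enter all later scalar computations. -/
theorem young_coeff_one [CharZero k] :
    (young lam h k).coeff 1 = (spechtDim lam h k : k) / (n.factorial : k) := by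
  have h1 : (Nat.card (rowGroup lam h) : k) ≠ 0 := by exact_mod_cast Nat.card_pos.ne'
  have h2 : (Nat.card (colGroup lam h) : k) ≠ 0 := by exact_mod_cast Nat.card_pos.ne'
  have h3 : (n.factorial : k) ≠ 0 := by exact_mod_cast n.factorial_ne_zero
  have h4 : (spechtDim lam h k : k) ≠ 0 := by exact_mod_cast spechtDim_ne_zero lam h
  rw [young, MonoidAlgebra.coeff_smul_apply, youngQuasi_coeff_one, youngScalar, smul_eq_mul]
  field_simp

theorem young_coeff_one_ne_zero [CharZero k] : (young lam h k).coeff 1 ≠ 0 := by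
  rw [young_coeff_one]
  exact div_ne_zero (by exact_mod_cast spechtDim_ne_zero lam h)
    (by exact_mod_cast n.factorial_ne_zero)

theorem youngScalar_ne_zero [CharZero k] : youngScalar lam h k ≠ 0 := by
  intro h0
  apply young_coeff_one_ne_zero lam h (k := k)
  rw [young, h0]; simp

variable {lam h}

theorem Biinv.smul {z : MonoidAlgebra k (Equiv.Perm (Fin n))} (hz : Biinv lam h k z) (c : k) :
    Biinv lam h k (c • z) :=
  ⟨fun r hr => by rw [mul_smul_comm, hz.1 r hr],
    fun r hr => by rw [smul_mul_assoc, hz.2 r hr, smul_comm]⟩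

theorem Biinv.sub {z w : MonoidAlgebra k (Equiv.Perm (Fin n))} (hz : Biinv lam h k z)
    (hw : Biinv lam h k w) : Biinv lam h k (z - w) :=
  ⟨fun r hr => by rw [mul_sub, hz.1 r hr, hw.1 r hr],
    fun r hr => by rw [sub_mul, hz.2 r hr, hw.2 r hr, smul_sub]⟩

theorem biinv_young : Biinv lam h k (young lam h k) := (biinv_youngQuasi lam h k).smul _

theorem Biinv.mul_mul {z w : MonoidAlgebra k (Equiv.Perm (Fin n))} (hz : Biinv lam h k z)
    (hw : Biinv lam h k w) (a : MonoidAlgebra k (Equiv.Perm (Fin n))) : Biinv lam h k (z * a * w) :=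
  ⟨fun r hr => by rw [← mul_assoc, ← mul_assoc, hz.1 r hr],
    fun r hr => by rw [mul_assoc, hw.2 r hr, mul_smul_comm]⟩

/-- Biinvariant elements are determined by their coefficient at `1`, so they form the line spanned
by the Young idempotent. -/
theorem Biinv.eq_smul_young [CharZero k] {z : MonoidAlgebra k (Equiv.Perm (Fin n))}
    (hz : Biinv lam h k z) : z = (z.coeff 1 / (young lam h k).coeff 1) • young lam h k := by
  rw [← sub_eq_zero]
  apply (hz.sub (biinv_young.smul _)).eq_zero
  rw [MonoidAlgebra.coeff_sub, Finsupp.sub_apply, MonoidAlgebra.coeff_smul_apply, smul_eq_mul,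
    div_mul_cancel₀ _ (young_coeff_one_ne_zero lam h), sub_self]

/-- The product is biinvariant, and its coefficient at `1` simplifies because that coefficient is a
trace form and the Young idempotent squares to itself. -/
theorem young_mul_mul_young [CharZero k] (a : MonoidAlgebra k (Equiv.Perm (Fin n))) :
    young lam h k * a * young lam h k =
      ((young lam h k * a).coeff 1 / (young lam h k).coeff 1) • young lam h k := by
  rw [(biinv_young.mul_mul biinv_young a).eq_smul_young, coeff_one_mul_comm, ← mul_assoc,
    young_mul_young]

variable (lam h)

theorem youngQuasi_mul_youngQuasi [CharZero k] :
    youngQuasi lam h k * youngQuasi lam h k = (youngScalar lam h k)⁻¹ • youngQuasi lam h k := by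
  have h1 := young_mul_young lam h k
  have h2 := youngScalar_ne_zero lam h (k := k)
  rw [young, smul_mul_smul_comm] at h1
  have h3 := congrArg (fun x => ((youngScalar lam h k)⁻¹ * (youngScalar lam h k)⁻¹) • x) h1
  simp only [smul_smul] at h3
  rw [show (youngScalar lam h k)⁻¹ * (youngScalar lam h k)⁻¹ *
      (youngScalar lam h k * youngScalar lam h k) = 1 by field_simp, one_smul] at h3
  rw [h3]
  congr 1
  field_simp

theorem sym_mul_mul_anti [CharZero k] (a : MonoidAlgebra k (Equiv.Perm (Fin n))) : ∃ c : k,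
    symBox k (rowGroup lam h) * a * antiBox k (colGroup lam h) = c • youngQuasi lam h k := by
  have hb : Biinv lam h k (symBox k (rowGroup lam h) * a * antiBox k (colGroup lam h)) := by
    constructor
    · intro r hr
      rw [← mul_assoc, ← mul_assoc, single_mul_box _ hr]; simp
    · intro c hc
      rw [mul_assoc, box_mul_single _ hc, mul_smul_comm]
  rw [hb.eq_smul_young, young, smul_smul]
  exact ⟨_, rfl⟩

/-- The reversed product `CR` is quasi-idempotent with the same scalar as `RC`. The difference `w`
of the two sides satisfies `w = w R = C w` and `R C w = 0`; since `R a C` is a multiple of `R C`,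
one gets `w a w = 0` for all `a`. -/
theorem anti_mul_sym_sq [CharZero k] :
    antiBox k (colGroup lam h) * symBox k (rowGroup lam h) * antiBox k (colGroup lam h) *
      symBox k (rowGroup lam h) =
    (youngScalar lam h k)⁻¹ • (antiBox k (colGroup lam h) * symBox k (rowGroup lam h)) := by
  set C := antiBox k (colGroup lam h)
  set R := symBox k (rowGroup lam h)
  set κ := (youngScalar lam h k)⁻¹
  have hC : C * C = C := box_mul_box _
  have hR : R * R = R := box_mul_box _
  have hq : R * C * (R * C) = κ • (R * C) := youngQuasi_mul_youngQuasi lam h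
  rw [← sub_eq_zero]
  set w := C * R * C * R - κ • (C * R) with hw
  have hwR : w = w * R := by
    simp only [hw, sub_mul, smul_mul_assoc, mul_assoc, hR]
  have hwC : w = C * w := by
    simp only [hw, mul_sub, mul_smul_comm, ← mul_assoc, hC]
  have hRCw : R * C * w = 0 := by
    have : R * C * w = (R * C * (R * C) - κ • (R * C)) * R := by
      rw [mul_assoc, ← hwC, hw, mul_sub, sub_mul, mul_smul_comm, smul_mul_assoc]
      simp only [mul_assoc]
    rw [this, hq, sub_self, zero_mul]
  apply eq_zero_of_mul_mul_eq_zero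
  intro a
  obtain ⟨c, hc⟩ := sym_mul_mul_anti lam h a
  rw [hwR, mul_assoc w R a]
  conv_lhs => enter [2]; rw [← hwR, hwC]
  rw [← mul_assoc, mul_assoc w, hc, mul_assoc, smul_mul_assoc, youngQuasi, hRCw, smul_zero,
    mul_zero]

end Young

end Heis


namespace Heis

/-! ### Completeness of a decomposition by comparing traces -/

section Trace

variable {k : Type*} [Field k]

/-- A family of orthogonal splittings below an idempotent `P` exhausts `P` if the traces agree. -/
theorem exists_trace_eq_sum_add {ι : Type*} [Fintype ι] {V : Type*} [AddCommGroup V] [Module k V]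
    [Module.Finite k V] {W : ι → Type*} [∀ s, AddCommGroup (W s)] [∀ s, Module k (W s)]
    [∀ s, Module.Finite k (W s)] (P : V →ₗ[k] V) (i : ∀ s, W s →ₗ[k] V) (r : ∀ s, V →ₗ[k] W s)
    (e : ∀ s, W s →ₗ[k] W s) (hP : P ∘ₗ P = P) (hPi : ∀ s, P ∘ₗ i s = i s)
    (hrP : ∀ s, r s ∘ₗ P = r s) (hri : ∀ s, r s ∘ₗ i s = e s)
    (hne : ∀ s t, s ≠ t → r s ∘ₗ i t = 0) (hie : ∀ s, i s ∘ₗ e s = i s) :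
    ∃ d : ℕ, LinearMap.trace k V P = ∑ s, LinearMap.trace k (W s) (e s) + d ∧
      (d = 0 → P = ∑ s, i s ∘ₗ r s) := by
  classical
  set S : V →ₗ[k] V := ∑ s, i s ∘ₗ r s with hS
  have hPS : P ∘ₗ S = S := by
    rw [hS, ← Module.End.mul_eq_comp, Finset.mul_sum]
    exact Finset.sum_congr rfl fun s _ => by
      rw [Module.End.mul_eq_comp, ← LinearMap.comp_assoc, hPi]
  have hSP : S ∘ₗ P = S := by
    rw [hS, ← Module.End.mul_eq_comp, Finset.sum_mul]
    exact Finset.sum_congr rfl fun s _ => by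
      rw [Module.End.mul_eq_comp, LinearMap.comp_assoc, hrP]
  have hSS : S ∘ₗ S = S := by
    conv_lhs => rw [hS, ← Module.End.mul_eq_comp, Finset.sum_mul]
    refine Finset.sum_congr rfl fun s _ => ?_
    rw [Finset.mul_sum, Finset.sum_eq_single s]
    · rw [Module.End.mul_eq_comp, LinearMap.comp_assoc, ← LinearMap.comp_assoc (r s), hri,
        ← LinearMap.comp_assoc, hie]
    · intro t _ hst
      rw [Module.End.mul_eq_comp, LinearMap.comp_assoc, ← LinearMap.comp_assoc (r t),
        hne s t hst.symm]
      simp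
    · simp
  -- What the splittings miss is again an idempotent, so its trace is the rank, the natural number
  -- `d`. The rank is zero only if `P = S`.
  have hQ : IsIdempotentElem (P - S) := by
    change (P - S) ∘ₗ (P - S) = P - S
    rw [LinearMap.sub_comp, LinearMap.comp_sub, LinearMap.comp_sub, hP, hPS, hSP, hSS]
    abel
  have htr := (LinearMap.IsIdempotentElem.isProj_range _ hQ).trace
  refine ⟨Module.finrank k (LinearMap.range (P - S)), ?_, ?_⟩
  · rw [← htr, map_sub, hS, map_sum]
    have : ∀ s, LinearMap.trace k V (i s ∘ₗ r s) = LinearMap.trace k (W s) (e s) := fun s => by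
      rw [LinearMap.trace_comp_comm', hri]
    simp only [this]
    abel
  · intro h0
    have := Submodule.finrank_eq_zero.1 h0
    rw [LinearMap.range_eq_bot, sub_eq_zero] at this
    exact this

/-- The trace comparison for right multiplications on `k[S_n]`. Right multiplication reverses
products, so `b s` plays the role of the inclusion and `a s` that of the projection. The trace
belonging to `young (mu s)` is the dimension of the Specht module. -/
theorem exists_factorial_mul_coeff_eq [CharZero k] {n : ℕ} {ι : Type*} [Fintype ι]
    (z : MonoidAlgebra k (Equiv.Perm (Fin n)))
    (mu : ι → YoungDiagram) (h : ∀ s, (mu s).card = n)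
    (a b : ι → MonoidAlgebra k (Equiv.Perm (Fin n))) (hz : z * z = z) (hza : ∀ s, z * a s = a s)
    (hbz : ∀ s, b s * z = b s) (hba : ∀ s, b s * a s = young (mu s) (h s) k)
    (hne : ∀ s t, s ≠ t → b s * a t = 0) (hyb : ∀ s, young (mu s) (h s) k * b s = b s) :
    ∃ d : ℕ, (n.factorial : k) * z.coeff 1 = ∑ s, (spechtDim (mu s) (h s) k : k) + d ∧
      (d = 0 → z = ∑ s, a s * b s) := by
  obtain ⟨d, hd, h0⟩ := exists_trace_eq_sum_add (k := k) (LinearMap.mulRight k z)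
    (fun s => LinearMap.mulRight k (b s)) (fun s => LinearMap.mulRight k (a s))
    (fun s => LinearMap.mulRight k (young (mu s) (h s) k))
    (by rw [← LinearMap.mulRight_mul, hz]) (fun s => by rw [← LinearMap.mulRight_mul, hbz])
    (fun s => by rw [← LinearMap.mulRight_mul, hza])
    (fun s => by rw [← LinearMap.mulRight_mul, hba])
    (fun s t hst => by
      rw [← LinearMap.mulRight_mul, hne t s hst.symm, LinearMap.mulRight_zero_eq_zero])
    (fun s => by rw [← LinearMap.mulRight_mul, hyb])
  refine ⟨d, ?_, fun hd0 => ?_⟩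
  · rw [trace_mulRight] at hd
    rw [hd]
    congr 1
    refine Finset.sum_congr rfl fun s _ => ?_
    have : (n.factorial : k) ≠ 0 := by exact_mod_cast n.factorial_ne_zero
    rw [trace_mulRight, young_coeff_one, mul_div_cancel₀ _ this]
  · have := congrArg (fun f => f 1) (h0 hd0)
    simpa using this

end Trace

/-! ### Subgroup embeddings and absorption of Young idempotents -/

section Push

variable (k : Type*) [Field k] {n N : ℕ}

/-- The homomorphism of group algebras induced by an embedding. -/
noncomputable def push (ι : Fin n ↪ Fin N) :
    MonoidAlgebra k (Equiv.Perm (Fin n)) →ₐ[k] MonoidAlgebra k (Equiv.Perm (Fin N)) :=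
  MonoidAlgebra.mapDomainAlgHom k k (Equiv.Perm.viaEmbeddingHom ι)

variable {k}

theorem push_single (ι : Fin n ↪ Fin N) (σ : Equiv.Perm (Fin n)) (r : k) :
    push k ι (MonoidAlgebra.single σ r) =
      MonoidAlgebra.single (Equiv.Perm.viaEmbeddingHom ι σ) r := by
  simp [push]

theorem viaEmbeddingHom_apply_apply (ι : Fin n ↪ Fin N) (σ : Equiv.Perm (Fin n)) (x : Fin n) :
    Equiv.Perm.viaEmbeddingHom ι σ (ι x) = ι (σ x) := Equiv.Perm.viaEmbedding_apply _ _ _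

theorem viaEmbeddingHom_apply_of_notMem (ι : Fin n ↪ Fin N) (σ : Equiv.Perm (Fin n)) {x : Fin N}
    (hx : x ∉ Set.range ι) : Equiv.Perm.viaEmbeddingHom ι σ x = x :=
  Equiv.Perm.viaEmbedding_apply_of_notMem _ _ _ hx

theorem sign_viaEmbeddingHom (ι : Fin n ↪ Fin N) (σ : Equiv.Perm (Fin n)) :
    Equiv.Perm.sign (Equiv.Perm.viaEmbeddingHom ι σ) = Equiv.Perm.sign σ := by
  rw [Equiv.Perm.viaEmbeddingHom_apply, Equiv.Perm.viaEmbedding]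
  convert Equiv.Perm.sign_extendDomain _ _

theorem viaEmbeddingHom_mem_fibreGroup {ι : Fin n ↪ Fin N} {f : Fin n → ℕ} {g : Fin N → ℕ}
    (hfg : ∀ i, g (ι i) = f i) {σ : Equiv.Perm (Fin n)} (hσ : σ ∈ fibreGroup f) :
    Equiv.Perm.viaEmbeddingHom ι σ ∈ fibreGroup g := by
  intro x
  by_cases hx : x ∈ Set.range ι
  · obtain ⟨i, rfl⟩ := hx
    rw [viaEmbeddingHom_apply_apply, hfg, hfg, hσ i]
  · rw [viaEmbeddingHom_apply_of_notMem ι σ hx]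

theorem push_coeff_one (ι : Fin n ↪ Fin N) (x : MonoidAlgebra k (Equiv.Perm (Fin n))) :
    (push k ι x).coeff 1 = x.coeff 1 := by
  induction x using MonoidAlgebra.induction_linear with
  | zero => simp
  | add a b ha hb => simp [ha, hb]
  | single m r =>
    rw [push_single, MonoidAlgebra.coeff_single, MonoidAlgebra.coeff_single, Finsupp.single_apply,
      Finsupp.single_apply]
    congr 1
    rw [← map_one (Equiv.Perm.viaEmbeddingHom ι),
      (Equiv.Perm.viaEmbeddingHom_injective ι).eq_iff]

/-- The pushforward of a box is absorbed on the left. -/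
theorem box_average_mul [CharZero k] {χ : Equiv.Perm (Fin n) →* ℤˣ}
    {G : Subgroup (Equiv.Perm (Fin n))}
    {A : Type*} [Ring A] [Algebra k A] (φ : MonoidAlgebra k (Equiv.Perm (Fin n)) →ₐ[k] A) {y : A}
    (h : ∀ g ∈ G, φ (MonoidAlgebra.single g 1) * y = ((χ g : ℤ) : k) • y) :
    φ (box k χ G) * y = y := by
  classical
  rw [box, map_smul, map_sum, smul_mul_assoc, Finset.sum_mul]
  have : ∀ σ ∈ Finset.univ.filter (fun σ : Equiv.Perm (Fin n) => σ ∈ G),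
      φ (MonoidAlgebra.single σ ((χ σ : ℤ) : k)) * y = y := by
    intro σ hσ
    simp only [Finset.mem_filter, Finset.mem_univ, true_and] at hσ
    have e : MonoidAlgebra.single σ ((χ σ : ℤ) : k) =
        ((χ σ : ℤ) : k) • MonoidAlgebra.single σ (1 : k) := by
      rw [MonoidAlgebra.smul_single, smul_eq_mul, mul_one]
    rw [e, map_smul, smul_mul_assoc, h σ hσ, smul_smul, chi_sq, one_smul]
  rw [Finset.sum_congr rfl this, Finset.sum_const, ← Nat.cast_smul_eq_nsmul k, smul_smul]
  have hc : (Finset.univ.filter (fun σ : Equiv.Perm (Fin n) => σ ∈ G)).card = Nat.card G := by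
    rw [Nat.card_eq_fintype_card, Fintype.card_subtype]
  rw [hc, inv_mul_cancel₀, one_smul]
  exact_mod_cast Nat.card_pos.ne'

theorem mul_box_average [CharZero k] {χ : Equiv.Perm (Fin n) →* ℤˣ}
    {G : Subgroup (Equiv.Perm (Fin n))}
    {A : Type*} [Ring A] [Algebra k A] (φ : MonoidAlgebra k (Equiv.Perm (Fin n)) →ₐ[k] A) {y : A}
    (h : ∀ g ∈ G, y * φ (MonoidAlgebra.single g 1) = ((χ g : ℤ) : k) • y) :
    y * φ (box k χ G) = y := by
  classical
  rw [box, map_smul, map_sum, mul_smul_comm, Finset.mul_sum]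
  have : ∀ σ ∈ Finset.univ.filter (fun σ : Equiv.Perm (Fin n) => σ ∈ G),
      y * φ (MonoidAlgebra.single σ ((χ σ : ℤ) : k)) = y := by
    intro σ hσ
    simp only [Finset.mem_filter, Finset.mem_univ, true_and] at hσ
    have e : MonoidAlgebra.single σ ((χ σ : ℤ) : k) =
        ((χ σ : ℤ) : k) • MonoidAlgebra.single σ (1 : k) := by
      rw [MonoidAlgebra.smul_single, smul_eq_mul, mul_one]
    rw [e, map_smul, mul_smul_comm, h σ hσ, smul_smul, chi_sq, one_smul]
  rw [Finset.sum_congr rfl this, Finset.sum_const, ← Nat.cast_smul_eq_nsmul k, smul_smul]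
  have hc : (Finset.univ.filter (fun σ : Equiv.Perm (Fin n) => σ ∈ G)).card = Nat.card G := by
    rw [Nat.card_eq_fintype_card, Fintype.card_subtype]
  rw [hc, inv_mul_cancel₀, one_smul]
  exact_mod_cast Nat.card_pos.ne'

theorem push_symBox_mul [CharZero k] {ι : Fin n ↪ Fin N} {G : Subgroup (Equiv.Perm (Fin n))}
    {H : Subgroup (Equiv.Perm (Fin N))} (hGH : ∀ σ ∈ G, Equiv.Perm.viaEmbeddingHom ι σ ∈ H) :
    push k ι (symBox k G) * symBox k H = symBox k H :=
  box_average_mul (push k ι) fun g hg => by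
    rw [push_single, symBox, single_mul_box _ (hGH g hg)]; simp

theorem antiBox_mul_push [CharZero k] {ι : Fin n ↪ Fin N} {G : Subgroup (Equiv.Perm (Fin n))}
    {H : Subgroup (Equiv.Perm (Fin N))} (hGH : ∀ σ ∈ G, Equiv.Perm.viaEmbeddingHom ι σ ∈ H) :
    antiBox k H * push k ι (antiBox k G) = antiBox k H :=
  mul_box_average (push k ι) fun g hg => by
    rw [push_single, antiBox, box_mul_single _ (hGH g hg), sign_viaEmbeddingHom]

/-- The Young idempotent of a subdiagram is absorbed between two copies of that of the diagram. -/
theorem young_mul_push_mul_young [CharZero k] {lam mu : YoungDiagram} (h : lam.card = n)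
    (h' : mu.card = N) {ι : Fin n ↪ Fin N} (hr : ∀ i, rowOf mu h' (ι i) = rowOf lam h i)
    (hc : ∀ i, colOf mu h' (ι i) = colOf lam h i) :
    young mu h' k * push k ι (young lam h k) * young mu h' k = young mu h' k := by
  have e1 := push_symBox_mul (k := k) (G := rowGroup lam h) (H := rowGroup mu h')
    (fun σ hσ => viaEmbeddingHom_mem_fibreGroup hr hσ)
  have e2 := antiBox_mul_push (k := k) (G := colGroup lam h) (H := colGroup mu h')
    (fun σ hσ => viaEmbeddingHom_mem_fibreGroup hc hσ)
  have e3 := congrArg (push k ι) (anti_mul_sym_sq lam h (k := k))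
  have e4 := young_mul_young mu h' k
  have h0 := youngScalar_ne_zero lam h (k := k)
  simp only [map_mul, map_smul] at e3
  simp only [young, youngQuasi, map_smul, map_mul] at e4 ⊢
  set R := symBox k (rowGroup mu h')
  set C := antiBox k (colGroup mu h')
  set R' := push k ι (symBox k (rowGroup lam h))
  set C' := push k ι (antiBox k (colGroup lam h))
  set β := youngScalar lam h k
  -- The boxes of the subdiagram are created from `R` and `C` so that the middle becomes `C'R'C'R'`.
  -- Quasi-idempotence collapses it to `β⁻¹ C'R'`, which is absorbed again; the normalization of
  -- `young lam` cancels `β⁻¹`.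
  have key : R * C * (R' * C') * (R * C) = β⁻¹ • (R * C * (R * C)) := by
    calc R * C * (R' * C') * (R * C) = R * (C * C') * (R' * C') * (R' * R * C) := by rw [e1, e2]
      _ = R * C * (C' * R' * C' * R') * R * C := by simp only [mul_assoc]
      _ = β⁻¹ • (R * (C * C') * (R' * R) * C) := by
        rw [e3]; simp only [mul_assoc, smul_mul_assoc, mul_smul_comm]
      _ = β⁻¹ • (R * C * (R * C)) := by rw [e1, e2]; simp only [mul_assoc]
  simp only [smul_mul_assoc, mul_smul_comm, smul_smul] at e4 ⊢
  rw [key, smul_smul, ← e4]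
  congr 1
  field_simp

end Push

/-! ### The extension `k[S_n] ⊂ k[S_{n + 1}]` and its conditional expectation -/

section Last

variable {n : ℕ}

theorem moveToLast_self (p : Fin (n + 1)) : moveToLast p p = Fin.last n := by
  simp [moveToLast]

theorem moveToLast_succAbove (p : Fin (n + 1)) (i : Fin n) :
    moveToLast p (p.succAbove i) = i.castSucc := by
  simp [moveToLast]

theorem moveToLast_inv_castSucc (p : Fin (n + 1)) (i : Fin n) :
    (moveToLast p)⁻¹ i.castSucc = p.succAbove i := by
  rw [Equiv.Perm.inv_eq_iff_eq, moveToLast_succAbove]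

theorem moveToLast_inv_last (p : Fin (n + 1)) : (moveToLast p)⁻¹ (Fin.last n) = p := by
  rw [Equiv.Perm.inv_eq_iff_eq, moveToLast_self]

/-- The homomorphism `S_n → S_{n + 1}` fixing the last point. -/
noncomputable abbrev addLast (n : ℕ) : Equiv.Perm (Fin n) →* Equiv.Perm (Fin (n + 1)) :=
  Equiv.Perm.viaEmbeddingHom Fin.castSuccEmb

theorem addLast_castSucc (σ : Equiv.Perm (Fin n)) (i : Fin n) :
    addLast n σ i.castSucc = (σ i).castSucc := viaEmbeddingHom_apply_apply Fin.castSuccEmb σ i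

theorem addLast_last (σ : Equiv.Perm (Fin n)) : addLast n σ (Fin.last n) = Fin.last n :=
  viaEmbeddingHom_apply_of_notMem _ _ (by rintro ⟨i, hi⟩; exact (Fin.castSucc_lt_last i).ne hi)

/-- Since the order of the other points is kept, conjugation replaces the embedding that omits the
last point by the one that omits `p`. -/
theorem moveToLast_conj (p : Fin (n + 1)) (σ : Equiv.Perm (Fin n)) :
    (moveToLast p)⁻¹ * addLast n σ * moveToLast p =
      Equiv.Perm.viaEmbeddingHom p.succAboveEmb σ := by
  ext x : 1
  rcases Fin.eq_self_or_eq_succAbove p x with rfl | ⟨i, rfl⟩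
  · rw [viaEmbeddingHom_apply_of_notMem _ _ (by rintro ⟨i, hi⟩; exact Fin.succAbove_ne _ _ hi),
      Equiv.Perm.mul_apply, Equiv.Perm.mul_apply, moveToLast_self, addLast_last,
      moveToLast_inv_last]
  · rw [Equiv.Perm.mul_apply, Equiv.Perm.mul_apply, moveToLast_succAbove, addLast_castSucc,
      moveToLast_inv_castSucc]
    exact (viaEmbeddingHom_apply_apply p.succAboveEmb σ i).symm

theorem exists_addLast_eq {σ : Equiv.Perm (Fin (n + 1))} (h : σ (Fin.last n) = Fin.last n) :
    ∃ τ, addLast n τ = σ := by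
  have h1 : ∀ i : Fin n, σ i.castSucc ≠ Fin.last n := fun i hi =>
    (Fin.castSucc_lt_last i).ne (σ.injective (hi.trans h.symm))
  let f : Fin n → Fin n := fun i => (σ i.castSucc).castPred (h1 i)
  have hf : Function.Injective f := by
    intro i j hij
    have h2 : σ i.castSucc = σ j.castSucc := Fin.castPred_inj.1 hij
    exact Fin.castSucc_injective _ (σ.injective h2)
  refine ⟨Equiv.ofBijective f (Finite.injective_iff_bijective.1 hf), ?_⟩
  ext x : 1
  induction x using Fin.lastCases with
  | last => rw [addLast_last, h]
  | cast i => rw [addLast_castSucc]; simp [f]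

variable (k : Type*) [Field k]

/-- The homomorphism of group algebras induced by `S_n → S_{n + 1}`. -/
noncomputable abbrev incl (n : ℕ) : MonoidAlgebra k (Equiv.Perm (Fin n)) →ₐ[k]
    MonoidAlgebra k (Equiv.Perm (Fin (n + 1))) := push k Fin.castSuccEmb

/-- The projection `k[S_{n + 1}] → k[S_n]` that kills the permutations moving the last point. -/
noncomputable def restr (n : ℕ) : MonoidAlgebra k (Equiv.Perm (Fin (n + 1))) →ₗ[k]
    MonoidAlgebra k (Equiv.Perm (Fin n)) where
  toFun := MonoidAlgebra.comapDomain (addLast n)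
    (Equiv.Perm.viaEmbeddingHom_injective _)
  map_add' := MonoidAlgebra.comapDomain_add _ _
  map_smul' r x := by ext; simp [MonoidAlgebra.coeff_comapDomain]

variable {k}

theorem restr_coeff (x : MonoidAlgebra k (Equiv.Perm (Fin (n + 1)))) (σ : Equiv.Perm (Fin n)) :
    (restr k n x).coeff σ = x.coeff (addLast n σ) := by
  simp [restr, MonoidAlgebra.coeff_comapDomain]

theorem restr_coeff_one (x : MonoidAlgebra k (Equiv.Perm (Fin (n + 1)))) :
    (restr k n x).coeff 1 = x.coeff 1 := by rw [restr_coeff, map_one]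

theorem restr_single_addLast (σ : Equiv.Perm (Fin n)) (r : k) :
    restr k n (MonoidAlgebra.single (addLast n σ) r) = MonoidAlgebra.single σ r :=
  MonoidAlgebra.comapDomain_single_map _ (Equiv.Perm.viaEmbeddingHom_injective _) _ _

theorem restr_single_of_ne {σ : Equiv.Perm (Fin (n + 1))} (h : σ (Fin.last n) ≠ Fin.last n)
    (r : k) : restr k n (MonoidAlgebra.single σ r) = 0 :=
  MonoidAlgebra.comapDomain_single_of_not_mem_range
    (by rintro ⟨τ, rfl⟩; exact h (addLast_last τ)) (Equiv.Perm.viaEmbeddingHom_injective _)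

theorem restr_incl_mul (a : MonoidAlgebra k (Equiv.Perm (Fin n)))
    (x : MonoidAlgebra k (Equiv.Perm (Fin (n + 1)))) :
    restr k n (incl k n a * x) = a * restr k n x := by
  induction a using MonoidAlgebra.induction_linear with
  | zero => simp
  | add a b ha hb => simp only [map_add, add_mul, ha, hb]
  | single m r =>
    ext σ
    rw [restr_coeff, push_single, MonoidAlgebra.coeff_single_mul_apply,
      MonoidAlgebra.coeff_single_mul_apply, restr_coeff,
      map_mul (addLast n), map_inv (addLast n)]

theorem incl_restr_single (σ : Equiv.Perm (Fin (n + 1))) (r : k) :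
    incl k n (restr k n (MonoidAlgebra.single σ r)) =
      if σ (Fin.last n) = Fin.last n then MonoidAlgebra.single σ r else 0 := by
  split_ifs with h
  · obtain ⟨τ, rfl⟩ := exists_addLast_eq h
    rw [restr_single_addLast, push_single]
  · rw [restr_single_of_ne h, map_zero]

/-- The permutations `moveToLast p` are representatives of the cosets `S_n \ S_{n + 1}`, and
together with their inverses they form dual bases for `restr`. For a permutation `σ` only the index
`p = σ (last)` contributes. -/
theorem sum_moveToLast_mul_incl_restr (b : MonoidAlgebra k (Equiv.Perm (Fin (n + 1)))) :
    ∑ p, MonoidAlgebra.single (moveToLast p)⁻¹ 1 *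
      incl k n (restr k n (MonoidAlgebra.single (moveToLast p) 1 * b)) = b := by
  induction b using MonoidAlgebra.induction_linear with
  | zero => simp
  | add a b ha hb => simp only [mul_add, map_add, Finset.sum_add_distrib, ha, hb]
  | single σ r =>
    rw [Finset.sum_eq_single (σ (Fin.last n))]
    · rw [MonoidAlgebra.single_mul_single, incl_restr_single, if_pos (by
        rw [Equiv.Perm.mul_apply, moveToLast_self]), MonoidAlgebra.single_mul_single]
      simp
    · intro p _ hp
      rw [MonoidAlgebra.single_mul_single, incl_restr_single, if_neg, mul_zero]
      rw [Equiv.Perm.mul_apply, ← Equiv.Perm.eq_inv_iff_eq, moveToLast_inv_last]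
      exact hp.symm
    · simp

theorem moveToLast_conj_incl (p : Fin (n + 1)) (a : MonoidAlgebra k (Equiv.Perm (Fin n))) :
    MonoidAlgebra.single (moveToLast p)⁻¹ 1 * incl k n a * MonoidAlgebra.single (moveToLast p) 1 =
      push k p.succAboveEmb a := by
  induction a using MonoidAlgebra.induction_linear with
  | zero => simp
  | add a b ha hb => simp only [map_add, mul_add, add_mul, ha, hb]
  | single m r =>
    rw [push_single, push_single, MonoidAlgebra.single_mul_single, MonoidAlgebra.single_mul_single,
      moveToLast_conj]
    simp

end Last

/-! ### Row fillings of a diagram and of the diagram with one box removed -/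

section Filling

variable {n : ℕ} {lam : YoungDiagram} (h : lam.card = n)

/-- A finite linear order has only one increasing enumeration, so any explicit increasing list of
boxes must be the row filling. All concrete fillings are computed in this way. -/
theorem rowFilling_eq {f : Fin n → ℕ ×ₗ ℕ} (hf : StrictMono f) (hm : ∀ i, ofLex (f i) ∈ lam)
    (i : Fin n) : (rowFilling lam h i : ℕ ×ₗ ℕ) = f i := by
  have := Finset.orderEmbOfFin_unique ((card_boxes lam).trans h) (f := f)
    (fun x => mem_boxes.2 (hm x)) hf
  rw [this]
  rfl

theorem rowOf_eq {f : Fin n → ℕ ×ₗ ℕ} (hf : StrictMono f) (hm : ∀ i, ofLex (f i) ∈ lam)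
    (i : Fin n) : rowOf lam h i = (ofLex (f i)).1 := by
  rw [rowOf, rowFilling_eq h hf hm]

theorem colOf_eq {f : Fin n → ℕ ×ₗ ℕ} (hf : StrictMono f) (hm : ∀ i, ofLex (f i) ∈ lam)
    (i : Fin n) : colOf lam h i = (ofLex (f i)).2 := by
  rw [colOf, rowFilling_eq h hf hm]

variable {mu : YoungDiagram} (h' : mu.card = n + 1) {c : ℕ × ℕ} (hc : c ∈ mu)

theorem succAbove_entry_mem (hcells : lam.cells = mu.cells.erase c) (i : Fin n) :
    ofLex (rowFilling mu h' ((entry mu h' c hc).succAbove i) : ℕ ×ₗ ℕ) ∈ lam := by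
  rw [← YoungDiagram.mem_cells, hcells, Finset.mem_erase, YoungDiagram.mem_cells]
  refine ⟨fun he => ?_, mem_boxes.1 (rowFilling mu h' _).2⟩
  have : rowFilling mu h' ((entry mu h' c hc).succAbove i) =
      rowFilling mu h' (entry mu h' c hc) := by
    apply Subtype.ext
    rw [entry, OrderIso.apply_symm_apply]
    exact ofLex.injective he
  exact Fin.succAbove_ne _ _ ((rowFilling mu h').injective this)

theorem strictMono_succAbove_entry : StrictMono fun i : Fin n =>
    (rowFilling mu h' ((entry mu h' c hc).succAbove i) : ℕ ×ₗ ℕ) := fun _ _ hij =>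
  (rowFilling mu h').strictMono (Fin.strictMono_succAbove _ hij)

/-- Reading the boxes of `lam` along the rows is reading those of `mu` with the box `c` skipped, and
`succAbove` skips its entry. -/
theorem rowOf_succAbove (hcells : lam.cells = mu.cells.erase c) (i : Fin n) :
    rowOf mu h' ((entry mu h' c hc).succAbove i) = rowOf lam h i :=
  (rowOf_eq h (strictMono_succAbove_entry h' hc) (succAbove_entry_mem h' hc hcells) i).symm

theorem colOf_succAbove (hcells : lam.cells = mu.cells.erase c) (i : Fin n) :
    colOf mu h' ((entry mu h' c hc).succAbove i) = colOf lam h i :=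
  (colOf_eq h (strictMono_succAbove_entry h' hc) (succAbove_entry_mem h' hc hcells) i).symm

/-- After conjugation the idempotent of `lam` acts on the strands of `mu` other than the one of the
box `c`, where the two fillings agree; the absorption rule applies. -/
theorem young_mul_conj_mul_young {k : Type*} [Field k] [CharZero k]
    (hcells : lam.cells = mu.cells.erase c) :
    young mu h' k * (MonoidAlgebra.single (moveToLast (entry mu h' c hc))⁻¹ 1 *
      incl k n (young lam h k) * MonoidAlgebra.single (moveToLast (entry mu h' c hc)) 1) *
      young mu h' k = young mu h' k := by
  rw [moveToLast_conj_incl]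
  exact young_mul_push_mul_young h h' (rowOf_succAbove h h' hc hcells)
    (colOf_succAbove h h' hc hcells)

end Filling

end Heis


namespace Heis

/-! ### Adding and removing boxes in Young's lattice -/

section Corners

theorem rowLen_eq_of_mem {mu : YoungDiagram} {i m : ℕ} (h : ∀ j, (i, j) ∈ mu ↔ j < m) :
    mu.rowLen i = m := by
  have h1 := h (mu.rowLen i)
  have h2 := h m
  rw [YoungDiagram.mem_iff_lt_rowLen] at h1 h2
  omega

theorem rowLen_addBox (lam : YoungDiagram) (s : addableRows lam) (i : ℕ) :
    (addBox lam s).rowLen i = lam.rowLen i + if i = s.1 then 1 else 0 := by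
  apply rowLen_eq_of_mem
  intro j
  rw [← YoungDiagram.mem_cells, addBox, Finset.mem_insert, YoungDiagram.mem_cells,
    YoungDiagram.mem_iff_lt_rowLen, Prod.mk.injEq]
  split_ifs with h
  · subst h; omega
  · omega

theorem rowLen_removeBox (mu : YoungDiagram) (s : removableRows mu) (i : ℕ) :
    (removeBox mu s).rowLen i = mu.rowLen i - if i = s.1 then 1 else 0 := by
  apply rowLen_eq_of_mem
  intro j
  rw [← YoungDiagram.mem_cells, removeBox, Finset.mem_erase, YoungDiagram.mem_cells,
    YoungDiagram.mem_iff_lt_rowLen, Ne, Prod.mk.injEq]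
  split_ifs with h
  · subst h; omega
  · omega

theorem rowLen_pos_iff {mu : YoungDiagram} {s : ℕ} : 0 < mu.rowLen s ↔ s < mu.colLen 0 := by
  rw [← YoungDiagram.mem_iff_lt_rowLen, YoungDiagram.mem_iff_lt_colLen]

theorem mem_removableRows {mu : YoungDiagram} {s : ℕ} :
    s ∈ removableRows mu ↔ mu.rowLen (s + 1) < mu.rowLen s := by
  rw [removableRows, Finset.mem_filter, Finset.mem_range, ← rowLen_pos_iff]
  omega

theorem mem_addableRows {lam : YoungDiagram} {s : ℕ} :
    s ∈ addableRows lam ↔ s = 0 ∨ lam.rowLen s < lam.rowLen (s - 1) := by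
  rw [addableRows, Finset.mem_filter, Finset.mem_range]
  constructor
  · rintro ⟨-, h⟩
    rcases Nat.eq_zero_or_pos s with h0 | h0
    · exact Or.inl h0
    · exact Or.inr (h _ (by omega))
  · rintro h
    refine ⟨?_, fun t ht => ?_⟩
    · rcases h with rfl | h
      · omega
      · have := rowLen_pos_iff.1 (by omega : 0 < lam.rowLen (s - 1))
        omega
    · have := lam.rowLen_anti t (s - 1) (by omega)
      omega

theorem cells_addBox (lam : YoungDiagram) (s : addableRows lam) :
    lam.cells = (addBox lam s).cells.erase (s.1, lam.rowLen s.1) := by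
  rw [addBox, Finset.erase_insert]
  rw [YoungDiagram.mem_cells, YoungDiagram.mem_iff_lt_rowLen]
  exact lt_irrefl _

theorem addBox_injective (lam : YoungDiagram) : Function.Injective (addBox lam) := by
  intro s t h
  by_contra hne
  have h1 := rowLen_addBox lam s s.1
  rw [h, rowLen_addBox, if_pos rfl, if_neg (fun e => hne (Subtype.ext e))] at h1
  omega

theorem removeBox_injective (mu : YoungDiagram) : Function.Injective (removeBox mu) := by
  intro s t h
  by_contra hne
  have h1 := rowLen_removeBox mu s s.1
  have h2 := mem_removableRows.1 s.2
  rw [h, rowLen_removeBox, if_pos rfl, if_neg (fun e => hne (Subtype.ext e))] at h1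
  omega

theorem coe_mem_removableRows_addBox (lam : YoungDiagram) (s : addableRows lam) :
    s.1 ∈ removableRows (addBox lam s) := by
  have := lam.rowLen_anti s.1 (s.1 + 1) (by omega)
  rw [mem_removableRows, rowLen_addBox, rowLen_addBox, if_pos rfl, if_neg (by omega)]
  omega

theorem coe_mem_addableRows_removeBox (mu : YoungDiagram) (s : removableRows mu) :
    s.1 ∈ addableRows (removeBox mu s) := by
  have h2 := mem_removableRows.1 s.2
  rw [mem_addableRows]
  by_cases h : s.1 = 0
  · exact Or.inl h
  · right
    have := mu.rowLen_anti (s.1 - 1) s.1 (by omega)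
    rw [rowLen_removeBox, rowLen_removeBox, if_pos rfl, if_neg (by omega)]
    omega

theorem addBox_removeBox (mu : YoungDiagram) (s : removableRows mu) :
    addBox (removeBox mu s) ⟨s.1, coe_mem_addableRows_removeBox mu s⟩ = mu := by
  have h2 := mem_removableRows.1 s.2
  apply eq_of_rowLen
  intro i
  rw [rowLen_addBox, rowLen_removeBox]
  by_cases h : i = s.1
  · subst h; simp only [if_pos]; omega
  · simp [h]

/-- Apart from the first row, a row is addable exactly if the row above it is removable. -/
theorem card_addableRows (lam : YoungDiagram) :
    (addableRows lam).card = (removableRows lam).card + 1 := by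
  have : addableRows lam =
      insert 0 ((removableRows lam).map ⟨Nat.succ, Nat.succ_injective⟩) := by
    ext s
    rw [mem_addableRows, Finset.mem_insert, Finset.mem_map]
    refine or_congr_right' fun h0 => ?_
    constructor
    · intro h
      refine ⟨s - 1, mem_removableRows.2 ?_, ?_⟩
      · rwa [Nat.sub_add_cancel (by omega)]
      · simp only [Function.Embedding.coeFn_mk]; omega
    · rintro ⟨t, ht, rfl⟩
      exact mem_removableRows.1 ht
  rw [this, Finset.card_insert_of_notMem (by simp), Finset.card_map]

/-- Add a box to the row `s`, if possible. -/
def addBoxOrSelf (lam : YoungDiagram) (s : ℕ) : YoungDiagram :=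
  if h : s ∈ addableRows lam then addBox lam ⟨s, h⟩ else lam

/-- Remove a box from the row `s`, if possible. -/
def removeBoxOrSelf (lam : YoungDiagram) (s : ℕ) : YoungDiagram :=
  if h : s ∈ removableRows lam then removeBox lam ⟨s, h⟩ else lam

theorem sum_addBox (lam : YoungDiagram) (f : YoungDiagram → ℕ) :
    ∑ s : addableRows lam, f (addBox lam s) = ∑ s ∈ addableRows lam, f (addBoxOrSelf lam s) := by
  rw [← Finset.sum_coe_sort (addableRows lam) fun s => f (addBoxOrSelf lam s)]
  refine Finset.sum_congr rfl fun s _ => ?_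
  rw [addBoxOrSelf, dif_pos s.2]

theorem sum_removeBox (lam : YoungDiagram) (f : YoungDiagram → ℕ) :
    ∑ s : removableRows lam, f (removeBox lam s) =
      ∑ s ∈ removableRows lam, f (removeBoxOrSelf lam s) := by
  rw [← Finset.sum_coe_sort (removableRows lam) fun s => f (removeBoxOrSelf lam s)]
  refine Finset.sum_congr rfl fun s _ => ?_
  rw [removeBoxOrSelf, dif_pos s.2]

theorem rowLen_addBoxOrSelf {lam : YoungDiagram} {s : ℕ} (h : s ∈ addableRows lam) (i : ℕ) :
    (addBoxOrSelf lam s).rowLen i = lam.rowLen i + if i = s then 1 else 0 := by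
  rw [addBoxOrSelf, dif_pos h, rowLen_addBox]

theorem rowLen_removeBoxOrSelf {lam : YoungDiagram} {s : ℕ} (h : s ∈ removableRows lam) (i : ℕ) :
    (removeBoxOrSelf lam s).rowLen i = lam.rowLen i - if i = s then 1 else 0 := by
  rw [removeBoxOrSelf, dif_pos h, rowLen_removeBox]

/-- In distinct rows the two operations do not obstruct each other; the delicate case is `r = t +
1`, where both conditions compare the same two adjacent rows. -/
theorem mem_add_remove_iff (lam : YoungDiagram) {r t : ℕ} (hrt : r ≠ t) :
    r ∈ addableRows lam ∧ t ∈ removableRows (addBoxOrSelf lam r) ↔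
      r ∈ addableRows (removeBoxOrSelf lam t) ∧ t ∈ removableRows lam := by
  constructor
  · rintro ⟨h1, h2⟩
    have h3 := mem_removableRows.1 h2
    rw [rowLen_addBoxOrSelf h1, rowLen_addBoxOrSelf h1, if_neg hrt.symm] at h3
    have h4 : t ∈ removableRows lam := mem_removableRows.2 (by omega)
    refine ⟨?_, h4⟩
    rw [mem_addableRows] at h1 ⊢
    rw [rowLen_removeBoxOrSelf h4, rowLen_removeBoxOrSelf h4, if_neg hrt]
    rcases h1 with h1 | h1
    · exact Or.inl h1
    · by_cases h0 : r = 0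
      · exact Or.inl h0
      · right
        by_cases h5 : r - 1 = t
        · obtain rfl : r = t + 1 := by omega
          simp only [Nat.add_sub_cancel, if_true] at h3 ⊢
          omega
        · rw [if_neg h5]; omega
  · rintro ⟨h1, h2⟩
    have h3 := mem_addableRows.1 h1
    rw [rowLen_removeBoxOrSelf h2, rowLen_removeBoxOrSelf h2, if_neg hrt] at h3
    have h4 : r ∈ addableRows lam := mem_addableRows.2 (by omega)
    refine ⟨h4, ?_⟩
    rw [mem_removableRows] at h2 ⊢
    rw [rowLen_addBoxOrSelf h4, rowLen_addBoxOrSelf h4, if_neg hrt.symm]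
    by_cases h5 : t + 1 = r
    · subst h5
      simp only [Nat.add_sub_cancel, if_true] at h3 ⊢
      omega
    · rw [if_neg h5]; omega

/-- Adding and then removing a box, compared with removing and then adding a box. -/
theorem sum_add_remove (lam : YoungDiagram) (f : YoungDiagram → ℕ) :
    ∑ r : addableRows lam, ∑ t : removableRows (addBox lam r), f (removeBox (addBox lam r) t) =
      f lam + ∑ t : removableRows lam, ∑ r : addableRows (removeBox lam t),
        f (addBox (removeBox lam t) r) := by
  simp only [sum_removeBox, sum_addBox]
  rw [sum_addBox lam fun mu => ∑ t ∈ removableRows mu, f (removeBoxOrSelf mu t),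
    sum_removeBox lam fun mu => ∑ t ∈ addableRows mu, f (addBoxOrSelf mu t)]
  -- The terms in which the same row is used twice return `lam`. There is one such term for each
  -- addable row on the left and one for each removable row on the right, and the former number
  -- exceeds the latter by one.
  have h1 : ∀ r ∈ addableRows lam,
      ∑ t ∈ removableRows (addBoxOrSelf lam r), f (removeBoxOrSelf (addBoxOrSelf lam r) t) =
        f lam + ∑ t ∈ (removableRows (addBoxOrSelf lam r)).erase r,
          f (removeBoxOrSelf (addBoxOrSelf lam r) t) := by
    intro r hr
    have hm : r ∈ removableRows (addBoxOrSelf lam r) := by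
      rw [addBoxOrSelf, dif_pos hr]
      exact coe_mem_removableRows_addBox lam ⟨r, hr⟩
    have he : removeBoxOrSelf (addBoxOrSelf lam r) r = lam := by
      apply eq_of_rowLen
      intro i
      rw [rowLen_removeBoxOrSelf hm, rowLen_addBoxOrSelf hr]
      omega
    rw [← Finset.add_sum_erase _ _ hm, he]
  have h2 : ∀ t ∈ removableRows lam,
      ∑ r ∈ addableRows (removeBoxOrSelf lam t), f (addBoxOrSelf (removeBoxOrSelf lam t) r) =
        f lam + ∑ r ∈ (addableRows (removeBoxOrSelf lam t)).erase t,
          f (addBoxOrSelf (removeBoxOrSelf lam t) r) := by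
    intro t ht
    have hm : t ∈ addableRows (removeBoxOrSelf lam t) := by
      rw [removeBoxOrSelf, dif_pos ht]
      exact coe_mem_addableRows_removeBox lam ⟨t, ht⟩
    have he : addBoxOrSelf (removeBoxOrSelf lam t) t = lam := by
      apply eq_of_rowLen
      intro i
      have := mem_removableRows.1 ht
      rw [rowLen_addBoxOrSelf hm, rowLen_removeBoxOrSelf ht]
      split_ifs with hi
      · subst hi; omega
      · rfl
    rw [← Finset.add_sum_erase _ _ hm, he]
  rw [Finset.sum_congr rfl h1, Finset.sum_congr rfl h2, Finset.sum_add_distrib,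
    Finset.sum_add_distrib, Finset.sum_const, Finset.sum_const, card_addableRows, add_smul,
    one_smul,
    add_comm _ (f lam), add_assoc]
  congr 2
  -- The remaining terms use distinct rows, where the order of adding and removing can be exchanged.
  rw [Finset.sum_comm' (s' := fun t => (addableRows (removeBoxOrSelf lam t)).erase t)
    (t' := removableRows lam)]
  · refine Finset.sum_congr rfl fun t ht => Finset.sum_congr rfl fun r hr => ?_
    rw [Finset.mem_erase] at hr
    obtain ⟨h3, h4⟩ := (mem_add_remove_iff lam hr.1).2 ⟨hr.2, ht⟩
    congr 1
    apply eq_of_rowLen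
    intro i
    rw [rowLen_removeBoxOrSelf h4, rowLen_addBoxOrSelf h3, rowLen_addBoxOrSelf hr.2,
      rowLen_removeBoxOrSelf ht]
    have h5 := hr.1
    have h6 := mem_removableRows.1 ht
    split_ifs <;> subst_vars <;> omega
  · intro r t
    rw [Finset.mem_erase, Finset.mem_erase]
    constructor
    · rintro ⟨h3, h4, h5⟩
      have := (mem_add_remove_iff lam h4.symm).1 ⟨h3, h5⟩
      exact ⟨⟨h4.symm, this.1⟩, this.2⟩
    · rintro ⟨⟨h3, h4⟩, h5⟩
      have := (mem_add_remove_iff lam h3).2 ⟨h4, h5⟩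
      exact ⟨this.1, h3.symm, this.2⟩

end Corners

/-! ### Branching rules for Specht modules -/

section Branching

variable {k : Type*} [Field k] [CharZero k] {n : ℕ}

section Induction

variable (lam : YoungDiagram) (h : lam.card = n)

/-- The permutation that moves the last strand of the row `s` of `lam(s⁺)` to the right. -/
noncomputable abbrev addPerm (s : addableRows lam) : Equiv.Perm (Fin (n + 1)) :=
  moveToLast (entry (addBox lam s) (card_addBox lam s h) _ (newBox_mem lam s))

/-- Half of the branching rule for induction, as an inequality with defect `d`: absorption gives the
splitting of each summand, distinct shapes are orthogonal, and the idempotent of `lam` in `k[S_{n +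
1}]` has trace `(n + 1) f_lam`. The decomposition becomes available once the defect is known to
vanish. -/
theorem exists_sum_addBox_add : ∃ d : ℕ,
    (n + 1) * spechtDim lam h k =
      ∑ s : addableRows lam, spechtDim (addBox lam s) (card_addBox lam s h) k + d ∧
    (d = 0 → incl k n (young lam h k) =
      ∑ s : addableRows lam, (incl k n (young lam h k) * MonoidAlgebra.single (addPerm lam h s) 1 *
        young (addBox lam s) (card_addBox lam s h) k) *
        (young (addBox lam s) (card_addBox lam s h) k *
          MonoidAlgebra.single (addPerm lam h s)⁻¹ 1 * incl k n (young lam h k))) := by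
  have hz : incl k n (young lam h k) * incl k n (young lam h k) = incl k n (young lam h k) := by
    rw [← map_mul, young_mul_young]
  obtain ⟨d, hd, h0⟩ := exists_factorial_mul_coeff_eq (k := k) (incl k n (young lam h k))
    (fun s => addBox lam s) (fun s => card_addBox lam s h)
    (fun s => incl k n (young lam h k) * MonoidAlgebra.single (addPerm lam h s) 1 *
        young (addBox lam s) (card_addBox lam s h) k)
    (fun s => young (addBox lam s) (card_addBox lam s h) k *
          MonoidAlgebra.single (addPerm lam h s)⁻¹ 1 * incl k n (young lam h k)) hz
    (fun s => by rw [← mul_assoc, ← mul_assoc, hz]) (fun s => by rw [mul_assoc, hz])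
    (fun s => by
      have := young_mul_conj_mul_young (k := k) h (card_addBox lam s h) (newBox_mem lam s)
        (cells_addBox lam s)
      refine Eq.trans ?_ this
      simp only [mul_assoc]
      rw [← mul_assoc (incl k n _) (incl k n _), hz])
    (fun s t hst => by
      rw [← young_mul_mul_young_of_ne (k := k) (h := card_addBox lam s h)
        (h' := card_addBox lam t h) (fun e => hst (addBox_injective lam e))
        (MonoidAlgebra.single (addPerm lam h s)⁻¹ 1 * incl k n (young lam h k) *
          (incl k n (young lam h k) * MonoidAlgebra.single (addPerm lam h t) 1))]
      simp only [mul_assoc])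
    (fun s => by rw [← mul_assoc, ← mul_assoc, young_mul_young])
  refine ⟨d, ?_, h0⟩
  rw [push_coeff_one, young_coeff_one, Nat.factorial_succ] at hd
  have hf : (n.factorial : k) ≠ 0 := by exact_mod_cast n.factorial_ne_zero
  have e : (((n + 1) * n.factorial : ℕ) : k) * ((spechtDim lam h k : k) / (n.factorial : k)) =
      ((n + 1 : ℕ) : k) * (spechtDim lam h k : k) := by
    push_cast
    field_simp
  rw [e] at hd
  exact_mod_cast hd

end Induction

section Restriction

variable (mu : YoungDiagram) (h : mu.card = n + 1)

/-- The permutation that moves the last strand of the row `s` of `mu` to the right. -/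
noncomputable abbrev removePerm (s : removableRows mu) : Equiv.Perm (Fin (n + 1)) :=
  moveToLast (entry mu h _ (lastBox_mem mu s))

theorem card_removeBox' {mu : YoungDiagram} (h : mu.card = n + 1) (s : removableRows mu) :
    (removeBox mu s).card = n :=
  card_removeBox mu s h

/-- The product is a multiple of the Young idempotent of the smaller shape. As `restr` preserves the
coefficient at `1`, absorption shows that the coefficient deciding the multiple is that of `young
mu`; the quotient of the two coefficients is inverse to the scalar in front. -/
theorem young_mul_restr_mul_young (s : removableRows mu) :
    ((((n + 1 : ℕ) : k) * (spechtDim (removeBox mu s) (card_removeBox' h s) k : k)) /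
        (spechtDim mu h k : k)) •
      (young (removeBox mu s) (card_removeBox' h s) k *
        restr k n (MonoidAlgebra.single (removePerm mu h s) 1 * young mu h k *
          MonoidAlgebra.single (removePerm mu h s)⁻¹ 1) *
        young (removeBox mu s) (card_removeBox' h s) k) =
      young (removeBox mu s) (card_removeBox' h s) k := by
  have e := young_mul_conj_mul_young (k := k) (card_removeBox' h s) h (lastBox_mem mu s) rfl
  have e1 : (young (removeBox mu s) (card_removeBox' h s) k *
      restr k n (MonoidAlgebra.single (removePerm mu h s) 1 * young mu h k *
        MonoidAlgebra.single (removePerm mu h s)⁻¹ 1)).coeff 1 = (young mu h k).coeff 1 := by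
    rw [← restr_incl_mul, restr_coeff_one]
    conv_rhs => rw [← e, mul_assoc, coeff_one_mul_comm, mul_assoc, young_mul_young]
    rw [← mul_assoc, coeff_one_mul_comm]
    simp only [mul_assoc]
  rw [young_mul_mul_young, e1, smul_smul, young_coeff_one, young_coeff_one, Nat.factorial_succ]
  have h1 : (n.factorial : k) ≠ 0 := by exact_mod_cast n.factorial_ne_zero
  have h2 : (spechtDim mu h k : k) ≠ 0 := by exact_mod_cast spechtDim_ne_zero mu h
  have h3 : (spechtDim (removeBox mu s) (card_removeBox' h s) k : k) ≠ 0 := by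
    exact_mod_cast spechtDim_ne_zero _ _
  have h4 : ((n + 1 : ℕ) : k) ≠ 0 := by exact_mod_cast n.succ_ne_zero
  conv_rhs => rw [← one_smul k (young _ _ k)]
  congr 1
  push_cast at h4 ⊢
  field_simp

/-- The counterpart for restriction, again with a defect `d`. The inclusions and projections now
relate different group algebras, so the trace comparison is applied to linear maps rather than to
elements. -/
theorem exists_sum_removeBox_add : ∃ d : ℕ,
    spechtDim mu h k =
      ∑ s : removableRows mu, spechtDim (removeBox mu s) (card_removeBox' h s) k + d ∧
    (d = 0 → ∀ x, x * young mu h k = ∑ s : removableRows mu,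
      ((((n + 1 : ℕ) : k) * (spechtDim (removeBox mu s) (card_removeBox' h s) k : k)) /
        (spechtDim mu h k : k)) •
      (incl k n (restr k n (x * young mu h k * MonoidAlgebra.single (removePerm mu h s)⁻¹ 1) *
        young (removeBox mu s) (card_removeBox' h s) k) *
        MonoidAlgebra.single (removePerm mu h s) 1 * young mu h k)) := by
  let E : ∀ s : removableRows mu, MonoidAlgebra k (Equiv.Perm (Fin n)) := fun s =>
    young (removeBox mu s) (card_removeBox' h s) k
  let c : removableRows mu → k := fun s =>
    (((n + 1 : ℕ) : k) * (spechtDim (removeBox mu s) (card_removeBox' h s) k : k)) /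
        (spechtDim mu h k : k)
  -- These are `i_s y = y e_λ X_s e_μ` and `r_s x = c_s restr(x e_μ X_s⁻¹) e_λ`, where `λ = μ(s⁻)`.
  -- Their composite is right multiplication by an element between Young idempotents, so it is given
  -- by the preceding lemma or is zero.
  let i : ∀ s : removableRows mu, MonoidAlgebra k (Equiv.Perm (Fin n)) →ₗ[k]
      MonoidAlgebra k (Equiv.Perm (Fin (n + 1))) := fun s =>
    LinearMap.mulRight k (MonoidAlgebra.single (removePerm mu h s) 1 * young mu h k) ∘ₗ
      (incl k n).toLinearMap ∘ₗ LinearMap.mulRight k (E s)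
  let r : ∀ s : removableRows mu, MonoidAlgebra k (Equiv.Perm (Fin (n + 1))) →ₗ[k]
      MonoidAlgebra k (Equiv.Perm (Fin n)) := fun s =>
    c s • (LinearMap.mulRight k (E s) ∘ₗ restr k n ∘ₗ
      LinearMap.mulRight k (young mu h k * MonoidAlgebra.single (removePerm mu h s)⁻¹ 1))
  have hy := young_mul_young mu h k
  have hE : ∀ s, E s * E s = E s := fun s => young_mul_young _ _ k
  have hi : ∀ s y, i s y = incl k n (y * E s) *
      (MonoidAlgebra.single (removePerm mu h s) 1 * young mu h k) := fun s y => by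
    simp only [i, LinearMap.comp_apply, LinearMap.mulRight_apply, AlgHom.toLinearMap_apply]
  have hr : ∀ s x, r s x = c s • (restr k n (x * (young mu h k *
      MonoidAlgebra.single (removePerm mu h s)⁻¹ 1)) * E s) := fun s x => by
    simp only [r, LinearMap.smul_apply, LinearMap.comp_apply, LinearMap.mulRight_apply]
  have hri : ∀ s t y, r s (i t y) = c s • (y * (E t * restr k n (
      MonoidAlgebra.single (removePerm mu h t) 1 * young mu h k *
        MonoidAlgebra.single (removePerm mu h s)⁻¹ 1) * E s)) := by
    intro s t y
    rw [hi, hr]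
    congr 1
    rw [mul_assoc (incl k n _), restr_incl_mul]
    simp only [mul_assoc]
    rw [← mul_assoc (young mu h k) (young mu h k), hy]
  obtain ⟨d, hd, h0⟩ := exists_trace_eq_sum_add (k := k) (LinearMap.mulRight k (young mu h k))
    i r (fun s => LinearMap.mulRight k (E s))
    (by rw [← LinearMap.mulRight_mul, hy])
    (fun s => by
      refine LinearMap.ext fun y => ?_
      simp only [i, LinearMap.comp_apply, LinearMap.mulRight_apply, mul_assoc, hy])
    (fun s => by
      refine LinearMap.ext fun y => ?_
      simp only [r, LinearMap.smul_apply, LinearMap.comp_apply, LinearMap.mulRight_apply]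
      rw [mul_assoc y, ← mul_assoc (young mu h k), hy])
    (fun s => by
      refine LinearMap.ext fun y => ?_
      rw [LinearMap.comp_apply, hri, ← mul_smul_comm, LinearMap.mulRight_apply]
      exact congrArg (y * ·) (young_mul_restr_mul_young mu h s))
    (fun s t hst => by
      refine LinearMap.ext fun y => ?_
      rw [LinearMap.comp_apply, hri, young_mul_mul_young_of_ne
        (fun e => hst (removeBox_injective mu e).symm), mul_zero, smul_zero]
      rfl)
    (fun s => by
      refine LinearMap.ext fun y => ?_
      simp only [i, LinearMap.comp_apply, LinearMap.mulRight_apply, mul_assoc, hE])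
  refine ⟨d, ?_, fun hd0 x => ?_⟩
  · have ht : ∀ {m : ℕ} {nu : YoungDiagram} (h : nu.card = m),
        LinearMap.trace k _ (LinearMap.mulRight k (young nu h k)) = (spechtDim nu h k : k) := by
      intro m nu h
      have : (m.factorial : k) ≠ 0 := by exact_mod_cast m.factorial_ne_zero
      rw [trace_mulRight, young_coeff_one, mul_div_cancel₀ _ this]
    simp only [E, ht] at hd
    exact_mod_cast hd
  · have := congrArg (fun f => f x) (h0 hd0)
    simp only [LinearMap.mulRight_apply, LinearMap.sum_apply, LinearMap.comp_apply] at this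
    refine this.trans (Finset.sum_congr rfl fun s _ => ?_)
    rw [hr, map_smul, hi, mul_assoc _ (E s) (E s), hE, ← mul_assoc, ← mul_assoc]

end Restriction

variable (k)

/-- The branching rules for the dimensions of the Specht modules. -/
theorem spechtDim_branching (n : ℕ) :
    (∀ (lam : YoungDiagram) (h : lam.card = n),
      ∑ s : addableRows lam, spechtDim (addBox lam s) (card_addBox lam s h) k =
        (n + 1) * spechtDim lam h k) ∧
    ∀ (mu : YoungDiagram) (h : mu.card = n + 1),
      ∑ s : removableRows mu, spechtDim (removeBox mu s) (card_removeBox' h s) k =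
        spechtDim mu h k := by
  -- Dimensions as a function of the diagram alone, so that sums over different sizes can be
  -- compared without carrying proofs of the size.
  let f : YoungDiagram → ℕ := fun lam => spechtDim lam rfl k
  have hf : ∀ {m : ℕ} {lam : YoungDiagram} (h : lam.card = m), spechtDim lam h k = f lam := by
    rintro m lam rfl; rfl
  have hle : ∀ {m : ℕ} {mu : YoungDiagram} (_ : mu.card = m + 1),
      ∑ s : removableRows mu, f (removeBox mu s) ≤ f mu := by
    intro m mu h
    obtain ⟨d, hd, -⟩ := exists_sum_removeBox_add (k := k) mu h
    simp only [hf] at hd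
    omega
  simp only [hf]
  have step : ∀ n : ℕ, (∀ lam : YoungDiagram, lam.card = n →
      ∑ t : removableRows lam, ∑ r : addableRows (removeBox lam t), f (addBox (removeBox lam t) r) =
        n * f lam) →
      (∀ lam : YoungDiagram, lam.card = n →
        ∑ s : addableRows lam, f (addBox lam s) = (n + 1) * f lam) ∧
      ∀ mu : YoungDiagram, mu.card = n + 1 →
        ∑ s : removableRows mu, f (removeBox mu s) = f mu := by
    intro n H
    -- Adding and then removing a box gives `f lam` more than removing and then adding, hence `f lam
    -- + n f lam`.
    have h1 : ∀ lam : YoungDiagram, lam.card = n →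
        ∑ r : addableRows lam, ∑ t : removableRows (addBox lam r), f (removeBox (addBox lam r) t) =
          (n + 1) * f lam := by
      intro lam h
      rw [sum_add_remove, H lam h]
      ring
    -- The chain `(n + 1) f lam = ∑ ∑ f(lam + □ - □) ≤ ∑ f(lam + □) ≤ (n + 1) f lam` forces equality
    -- throughout.
    have h2 : ∀ lam : YoungDiagram, lam.card = n →
        ∑ s : addableRows lam, f (addBox lam s) = (n + 1) * f lam := by
      intro lam h
      apply le_antisymm
      · obtain ⟨d, hd, -⟩ := exists_sum_addBox_add (k := k) lam h
        simp only [hf] at hd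
        omega
      · rw [← h1 lam h]
        exact Finset.sum_le_sum fun r _ => hle (card_addBox lam r h)
    refine ⟨h2, fun mu h => ?_⟩
    -- Without a removable row all rows have the same length, and the row of index `colLen 0` is
    -- empty; so `mu` would be empty.
    have hne : (removableRows mu).Nonempty := by
      by_contra hne
      have h0 := card_addableRows mu
      rw [Finset.not_nonempty_iff_eq_empty.1 hne, Finset.card_empty, zero_add] at h0
      have h3 : ∀ i, mu.rowLen i = mu.rowLen 0 := by
        intro i
        induction i with
        | zero => rfl
        | succ i ih =>
          have h4 : i ∉ removableRows mu := fun hi => hne ⟨i, hi⟩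
          rw [mem_removableRows] at h4
          have := mu.rowLen_anti i (i + 1) (by omega)
          omega
      have h5 := h3 (mu.colLen 0)
      have h6 : ¬ 0 < mu.rowLen (mu.colLen 0) := by rw [rowLen_pos_iff]; omega
      have h7 : mu.cells = ∅ := by
        ext ⟨i, j⟩
        rw [YoungDiagram.mem_cells, YoungDiagram.mem_iff_lt_rowLen, h3]
        simp
        omega
      have h8 : mu.cells.card = n + 1 := h
      rw [h7] at h8
      simp at h8
    obtain ⟨t, ht⟩ := hne
    have h4 := card_removeBox' h ⟨t, ht⟩
    -- Equality of the sums gives equality for every shape obtained by adding a box; `mu` is such a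
    -- shape, being obtained from any of its `removeBox`.
    have h5 := (Finset.sum_eq_sum_iff_of_le fun r (_ : r ∈ Finset.univ) =>
      hle (card_addBox (removeBox mu ⟨t, ht⟩) r h4)).1
        ((h1 _ h4).trans (h2 _ h4).symm) ⟨t, coe_mem_addableRows_removeBox mu ⟨t, ht⟩⟩
        (Finset.mem_univ _)
    rwa [addBox_removeBox mu ⟨t, ht⟩] at h5
  have main : ∀ lam : YoungDiagram, lam.card = n →
      ∑ t : removableRows lam, ∑ r : addableRows (removeBox lam t), f (addBox (removeBox lam t) r) =
        n * f lam := by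
    induction n with
    | zero =>
      intro lam h
      rw [zero_mul]
      refine Finset.sum_eq_zero fun t _ => ?_
      have := eq_pred_add_one lam t h
      omega
    | succ n ih =>
      intro lam h
      obtain ⟨h1, h2⟩ := step n ih
      rw [← h2 lam h, Finset.mul_sum]
      refine Finset.sum_congr rfl fun t _ => ?_
      rw [h1 _ (card_removeBox' h t)]
  exact step n main

variable {k}

theorem incl_young_eq_sum (lam : YoungDiagram) (h : lam.card = n) :
    incl k n (young lam h k) =
      ∑ s : addableRows lam, (incl k n (young lam h k) * MonoidAlgebra.single (addPerm lam h s) 1 *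
        young (addBox lam s) (card_addBox lam s h) k) *
        (young (addBox lam s) (card_addBox lam s h) k *
          MonoidAlgebra.single (addPerm lam h s)⁻¹ 1 * incl k n (young lam h k)) := by
  obtain ⟨d, hd, h0⟩ := exists_sum_addBox_add (k := k) lam h
  rw [(spechtDim_branching k n).1 lam h] at hd
  exact h0 (by omega)

/-- The Casimir element of `k[S_{n + 1}]` over `k[S_n]`, cut by the Young idempotent of `mu`, under
a balanced bilinear map. -/
theorem sum_balanced_young {M : Type*} [AddCommGroup M] [Module k M]
    (Φ : MonoidAlgebra k (Equiv.Perm (Fin (n + 1))) →ₗ[k]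
      MonoidAlgebra k (Equiv.Perm (Fin (n + 1))) →ₗ[k] M)
    (hΦ : ∀ a y b, Φ (a * incl k n y) b = Φ a (incl k n y * b))
    (mu : YoungDiagram) (h : mu.card = n + 1) :
    ∑ p, Φ (young mu h k * MonoidAlgebra.single (moveToLast p)⁻¹ 1)
        (MonoidAlgebra.single (moveToLast p) 1 * young mu h k) =
      ∑ s : removableRows mu,
        ((((n + 1 : ℕ) : k) * (spechtDim (removeBox mu s) (card_removeBox' h s) k : k)) /
          (spechtDim mu h k : k)) •
        Φ (young mu h k * MonoidAlgebra.single (removePerm mu h s)⁻¹ 1 *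
            incl k n (young (removeBox mu s) (card_removeBox' h s) k))
          (MonoidAlgebra.single (removePerm mu h s) 1 * young mu h k) := by
  obtain ⟨d, hd, h0⟩ := exists_sum_removeBox_add (k := k) mu h
  rw [(spechtDim_branching k n).2 mu h] at hd
  replace h0 := h0 (by omega)
  -- Each `X_p e_μ` is expanded by the completeness of restriction, and the coefficients from
  -- `k[S_n]` are moved into the first argument.
  have h1 : ∀ p, Φ (young mu h k * MonoidAlgebra.single (moveToLast p)⁻¹ 1)
        (MonoidAlgebra.single (moveToLast p) 1 * young mu h k) = ∑ s : removableRows mu,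
        ((((n + 1 : ℕ) : k) * (spechtDim (removeBox mu s) (card_removeBox' h s) k : k)) /
          (spechtDim mu h k : k)) •
        Φ (young mu h k * (MonoidAlgebra.single (moveToLast p)⁻¹ 1 *
          incl k n (restr k n (MonoidAlgebra.single (moveToLast p) 1 * (young mu h k *
            MonoidAlgebra.single (removePerm mu h s)⁻¹ 1)))) *
            incl k n (young (removeBox mu s) (card_removeBox' h s) k))
          (MonoidAlgebra.single (removePerm mu h s) 1 * young mu h k) := by
    intro p
    rw [h0, map_sum]
    refine Finset.sum_congr rfl fun s _ => ?_
    rw [map_smul, hΦ, ← mul_assoc (young mu h k), hΦ, ← mul_assoc, ← mul_assoc, ← map_mul,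
      ← mul_assoc]
  simp only [h1]
  rw [Finset.sum_comm]
  refine Finset.sum_congr rfl fun s _ => ?_
  -- The sum over `p` now stands in the first argument only, and the dual bases collapse it to `e_μ
  -- X_s⁻¹`.
  rw [← Finset.smul_sum, ← LinearMap.sum_apply, ← map_sum, ← Finset.sum_mul, ← Finset.mul_sum,
    sum_moveToLast_mul_incl_restr, ← mul_assoc, young_mul_young]

end Branching

end Heis


namespace Heis

/-! ### Symmetrizers on two blocks of strands -/

section Blocks

variable {k : Type*} [Field k] {m n N : ℕ}

theorem card_top_perm : Nat.card (⊤ : Subgroup (Equiv.Perm (Fin n))) = n.factorial := by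
  rw [Subgroup.card_top, Nat.card_eq_fintype_card, Fintype.card_perm, Fintype.card_fin]

theorem box_top (χ : Equiv.Perm (Fin n) →* ℤˣ) : box k χ ⊤ =
    (n.factorial : k)⁻¹ • ∑ σ : Equiv.Perm (Fin n), ((χ σ : ℤ) : k) • MonoidAlgebra.single σ 1 := by
  rw [box, card_top_perm]
  simp [MonoidAlgebra.smul_single]

theorem box_top_coeff_one (χ : Equiv.Perm (Fin n) →* ℤˣ) :
    (box k χ ⊤).coeff 1 = (n.factorial : k)⁻¹ := by
  classical
  rw [box_top, MonoidAlgebra.coeff_smul_apply, MonoidAlgebra.coeff_sum, Finsupp.finsetSum_apply,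
    Finset.sum_eq_single 1]
  · simp
  · intro σ _ hσ
    rw [MonoidAlgebra.coeff_smul_apply, MonoidAlgebra.coeff_single, Finsupp.single_apply,
      if_neg hσ, smul_zero]
  · simp

/-- Average of a box over the permutations that preserve a subset, when the other permutations do
not contribute. -/
theorem mul_push_box_mul [CharZero k] (ι : Fin m ↪ Fin N) (χ : Equiv.Perm (Fin m) →* ℤˣ)
    {X Y W : MonoidAlgebra k (Equiv.Perm (Fin N))} (p : Fin m → Bool) {s : ℕ}
    (hs : Fintype.card {a // p a = true} = s)
    (h1 : ∀ τ : Equiv.Perm (Fin m), p ∘ τ = p → ((χ τ : ℤ) : k) •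
      (X * MonoidAlgebra.single (Equiv.Perm.viaEmbeddingHom ι τ) 1 * Y) = W)
    (h0 : ∀ τ : Equiv.Perm (Fin m), p ∘ τ ≠ p →
      X * MonoidAlgebra.single (Equiv.Perm.viaEmbeddingHom ι τ) 1 * Y = 0) :
    X * push k ι (box k χ ⊤) * Y = ((m.choose s : ℕ) : k)⁻¹ • W := by
  classical
  rw [box_top, map_smul, map_sum, mul_smul_comm, smul_mul_assoc, Finset.mul_sum, Finset.sum_mul]
  have h2 : ∀ τ ∈ (Finset.univ : Finset (Equiv.Perm (Fin m))),
      X * push k ι (((χ τ : ℤ) : k) • MonoidAlgebra.single τ 1) * Y =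
      if p ∘ τ = p then W else 0 := by
    intro τ _
    rw [map_smul, push_single, mul_smul_comm, smul_mul_assoc]
    split_ifs with h
    · exact h1 τ h
    · rw [h0 τ h, smul_zero]
  rw [Finset.sum_congr rfl h2, ← Finset.sum_filter, Finset.sum_const, ← Nat.cast_smul_eq_nsmul k,
    smul_smul]
  congr 1
  -- The contributing permutations are those that preserve the subset, `s! (m - s)!` in number, out
  -- of `m!`.
  have h3 := DomMulAct.stabilizer_card p
  have h4 : Fintype.card {a // p a = false} = m - s := by
    rw [← hs]
    have := Fintype.card_subtype_compl (fun a => p a = true)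
    simpa using this
  have hsm : s ≤ m := by
    rw [← hs]
    simpa using Fintype.card_subtype_le (fun a => p a = true)
  rw [Fintype.prod_bool, hs, h4, Fintype.card_subtype] at h3
  rw [h3]
  have h5 := Nat.choose_mul_factorial_mul_factorial hsm
  have h6 : (m.factorial : k) ≠ 0 := by exact_mod_cast m.factorial_ne_zero
  have h7 : ((m.choose s : ℕ) : k) ≠ 0 := by exact_mod_cast (Nat.choose_pos hsm).ne'
  rw [inv_mul_eq_iff_eq_mul₀ h6, ← h5]
  push_cast
  field_simp

/-- If no point entered the subset, its preimage under `τ` would be contained in it, and equal to it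
by cardinality. -/
theorem exists_of_comp_ne {p : Fin m → Bool} {τ : Equiv.Perm (Fin m)} (h : p ∘ τ ≠ p) :
    ∃ x, p x = false ∧ p (τ x) = true := by
  by_contra! H
  apply h
  have hsub : (Finset.univ.filter fun x => p (τ x) = true) ⊆
      Finset.univ.filter fun x => p x = true := by
    intro x hx
    simp only [Finset.mem_filter, Finset.mem_univ, true_and] at hx ⊢
    by_contra hx'
    exact H x (by simpa using hx') hx
  have hcard : (Finset.univ.filter fun x => p x = true).card ≤
      (Finset.univ.filter fun x => p (τ x) = true).card := by
    refine Finset.card_le_card_of_injOn (fun x => τ⁻¹ x) ?_ ?_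
    · intro x hx; simpa using hx
    · intro x _ y _ hxy; exact (τ⁻¹).injective hxy
  have heq := Finset.eq_of_subset_of_card_le hsub hcard
  funext x
  have := Finset.ext_iff.1 heq x
  simp only [Finset.mem_filter, Finset.mem_univ, true_and] at this
  rw [Function.comp_apply, Bool.eq_iff_iff]
  exact this

theorem viaEmbeddingHom_castAdd_castAdd (σ : Equiv.Perm (Fin m)) (i : Fin m) :
    Equiv.Perm.viaEmbeddingHom (Fin.castAddEmb n) σ (Fin.castAdd n i) = Fin.castAdd n (σ i) :=
  viaEmbeddingHom_apply_apply (Fin.castAddEmb n) σ i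

theorem viaEmbeddingHom_castAdd_natAdd (σ : Equiv.Perm (Fin m)) (i : Fin n) :
    Equiv.Perm.viaEmbeddingHom (Fin.castAddEmb n) σ (Fin.natAdd m i) = Fin.natAdd m i := by
  apply viaEmbeddingHom_apply_of_notMem
  rintro ⟨j, hj⟩
  have := congrArg Fin.val hj
  have h2 := j.2
  simp at this
  omega

theorem viaEmbeddingHom_natAdd_natAdd (σ : Equiv.Perm (Fin n)) (i : Fin n) :
    Equiv.Perm.viaEmbeddingHom (Fin.natAddEmb m) σ (Fin.natAdd m i) = Fin.natAdd m (σ i) :=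
  viaEmbeddingHom_apply_apply (Fin.natAddEmb m) σ i

theorem viaEmbeddingHom_natAdd_castAdd (σ : Equiv.Perm (Fin n)) (i : Fin m) :
    Equiv.Perm.viaEmbeddingHom (Fin.natAddEmb m) σ (Fin.castAdd n i) = Fin.castAdd n i := by
  apply viaEmbeddingHom_apply_of_notMem
  rintro ⟨j, hj⟩
  have := congrArg Fin.val hj
  have h2 := i.2
  simp at this
  omega

theorem viaEmbeddingHom_castAdd_mul_natAdd (σ : Equiv.Perm (Fin m)) (τ : Equiv.Perm (Fin n)) :
    Equiv.Perm.viaEmbeddingHom (Fin.castAddEmb n) σ *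
        Equiv.Perm.viaEmbeddingHom (Fin.natAddEmb m) τ =
      Equiv.Perm.viaEmbeddingHom (Fin.natAddEmb m) τ *
        Equiv.Perm.viaEmbeddingHom (Fin.castAddEmb n) σ := by
  ext x : 1
  rw [Equiv.Perm.mul_apply, Equiv.Perm.mul_apply]
  induction x using Fin.addCases with
  | left i =>
    rw [viaEmbeddingHom_natAdd_castAdd, viaEmbeddingHom_castAdd_castAdd,
      viaEmbeddingHom_natAdd_castAdd]
  | right i =>
    rw [viaEmbeddingHom_castAdd_natAdd, viaEmbeddingHom_natAdd_natAdd,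
      viaEmbeddingHom_castAdd_natAdd]

theorem viaEmbeddingHom_castAdd_mul_natAdd_eq_one {σ : Equiv.Perm (Fin m)}
    {τ : Equiv.Perm (Fin n)}
    (h : Equiv.Perm.viaEmbeddingHom (Fin.castAddEmb n) σ *
        Equiv.Perm.viaEmbeddingHom (Fin.natAddEmb m) τ = 1) : σ = 1 ∧ τ = 1 := by
  constructor
  · ext i : 1
    have := congrArg (fun g : Equiv.Perm (Fin (m + n)) => g (Fin.castAdd n i)) h
    simp only [Equiv.Perm.mul_apply] at this
    rw [viaEmbeddingHom_natAdd_castAdd, viaEmbeddingHom_castAdd_castAdd] at this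
    exact Fin.castAdd_injective _ _ this
  · ext i : 1
    have := congrArg (fun g : Equiv.Perm (Fin (m + n)) => g (Fin.natAdd m i)) h
    simp only [Equiv.Perm.mul_apply] at this
    rw [viaEmbeddingHom_natAdd_natAdd, viaEmbeddingHom_castAdd_natAdd] at this
    exact Fin.natAdd_injective _ _ this

/-- The element of `k[S_{m + n}]` given by `x` on the first `m` and `y` on the last `n` points. -/
noncomputable def blockMul (x : MonoidAlgebra k (Equiv.Perm (Fin m)))
    (y : MonoidAlgebra k (Equiv.Perm (Fin n))) : MonoidAlgebra k (Equiv.Perm (Fin (m + n))) :=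
  push k (Fin.castAddEmb n) x * push k (Fin.natAddEmb m) y

theorem push_castAdd_mul_push_natAdd (x : MonoidAlgebra k (Equiv.Perm (Fin m)))
    (y : MonoidAlgebra k (Equiv.Perm (Fin n))) :
    push k (Fin.castAddEmb n) x * push k (Fin.natAddEmb m) y =
      push k (Fin.natAddEmb m) y * push k (Fin.castAddEmb n) x := by
  induction x using MonoidAlgebra.induction_linear with
  | zero => simp
  | add a b ha hb => simp only [map_add, mul_add, add_mul, ha, hb]
  | single σ r =>
    induction y using MonoidAlgebra.induction_linear with
    | zero => simp
    | add a b ha hb => simp only [map_add, mul_add, add_mul, ha, hb]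
    | single τ t =>
      simp only [push_single, MonoidAlgebra.single_mul_single]
      rw [viaEmbeddingHom_castAdd_mul_natAdd, mul_comm]

theorem blockMul_mul_self {x : MonoidAlgebra k (Equiv.Perm (Fin m))}
    {y : MonoidAlgebra k (Equiv.Perm (Fin n))} (hx : x * x = x) (hy : y * y = y) :
    blockMul x y * blockMul x y = blockMul x y := by
  unfold blockMul
  conv_lhs => enter [2]; rw [push_castAdd_mul_push_natAdd]
  rw [mul_assoc, ← mul_assoc (push k _ y), ← map_mul, hy, ← push_castAdd_mul_push_natAdd,
    ← mul_assoc, ← map_mul, hx]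

theorem blockMul_coeff_one (x : MonoidAlgebra k (Equiv.Perm (Fin m)))
    (y : MonoidAlgebra k (Equiv.Perm (Fin n))) :
    (blockMul x y).coeff 1 = x.coeff 1 * y.coeff 1 := by
  unfold blockMul
  induction x using MonoidAlgebra.induction_linear with
  | zero => simp
  | add a b ha hb =>
    simp only [map_add, add_mul, MonoidAlgebra.coeff_add, Finsupp.add_apply, ha, hb]
  | single σ r =>
    induction y using MonoidAlgebra.induction_linear with
    | zero => simp
    | add a b ha hb =>
      simp only [map_add, mul_add, MonoidAlgebra.coeff_add, Finsupp.add_apply, ha, hb]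
    | single τ t =>
      simp only [push_single, MonoidAlgebra.single_mul_single, MonoidAlgebra.coeff_single,
        Finsupp.single_apply]
      by_cases h : Equiv.Perm.viaEmbeddingHom (Fin.castAddEmb n) σ *
          Equiv.Perm.viaEmbeddingHom (Fin.natAddEmb m) τ = 1
      · obtain ⟨rfl, rfl⟩ := viaEmbeddingHom_castAdd_mul_natAdd_eq_one h
        simp
      · rw [if_neg h]
        by_cases hσ : σ = 1
        · by_cases hτ : τ = 1
          · subst hσ hτ; simp at h
          · simp [hτ]
        · simp [hσ]

/-- The left side is the trace of right multiplication by the block idempotent; its value is the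
index of `S_m × S_n` in `S_{m + n}`, the dimension of an induced one-dimensional representation. -/
theorem factorial_mul_blockMul_coeff_one [CharZero k] (χ : Equiv.Perm (Fin m) →* ℤˣ)
    (χ' : Equiv.Perm (Fin n) →* ℤˣ) : ((m + n).factorial : k) *
      (blockMul (box k χ ⊤) (box k χ' ⊤)).coeff 1 = ((m + n).choose n : ℕ) := by
  rw [blockMul_coeff_one, box_top_coeff_one, box_top_coeff_one,
    ← Nat.add_choose_mul_factorial_mul_factorial]
  have h1 : (m.factorial : k) ≠ 0 := by exact_mod_cast m.factorial_ne_zero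
  have h2 : (n.factorial : k) ≠ 0 := by exact_mod_cast n.factorial_ne_zero
  push_cast
  field_simp

/-- Only the column antisymmetrizer on the left of `z` and the row symmetrizer on its right matter.
The scalar can be found before normalization. -/
theorem young_mul_mul_young_of_smul [CharZero k] {lam : YoungDiagram} (h : lam.card = n)
    {z : MonoidAlgebra k (Equiv.Perm (Fin n))} {c : k}
    (hz : antiBox k (colGroup lam h) * z * symBox k (rowGroup lam h) =
      c • (antiBox k (colGroup lam h) * symBox k (rowGroup lam h))) :
    young lam h k * z * young lam h k = c • young lam h k := by
  have h1 := young_mul_young lam h k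
  simp only [young, youngQuasi, smul_mul_assoc, mul_smul_comm, smul_smul] at h1 ⊢
  have h2 : symBox k (rowGroup lam h) * antiBox k (colGroup lam h) * z *
      (symBox k (rowGroup lam h) * antiBox k (colGroup lam h)) =
      c • (symBox k (rowGroup lam h) * antiBox k (colGroup lam h) *
      (symBox k (rowGroup lam h) * antiBox k (colGroup lam h))) := by
    rw [mul_assoc (symBox k _), mul_assoc (symBox k _), ← mul_assoc (_ * z), hz]
    simp only [mul_assoc, smul_mul_assoc, mul_smul_comm]
  rw [h2, smul_smul, mul_comm _ c, ← smul_smul, h1, smul_smul]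

/-- An idempotent is decomposed by the Young idempotents of distinct shapes that it contains with
multiplicity one, if the dimensions agree. -/
theorem eq_sum_of_young_mul_mul_young [CharZero k] {ι : Type*} [Fintype ι]
    {z : MonoidAlgebra k (Equiv.Perm (Fin n))} (hz : z * z = z) (mu : ι → YoungDiagram)
    (h : ∀ s, (mu s).card = n) (hmu : Function.Injective mu) (c : ι → k) (hc : ∀ s, c s ≠ 0)
    (he : ∀ s, young (mu s) (h s) k * z * young (mu s) (h s) k = (c s)⁻¹ • young (mu s) (h s) k)
    (hdim : (n.factorial : k) * z.coeff 1 = ∑ s, (spechtDim (mu s) (h s) k : k)) :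
    z = ∑ s, c s • (z * young (mu s) (h s) k * (young (mu s) (h s) k * z)) := by
  obtain ⟨d, hd, h0⟩ := exists_factorial_mul_coeff_eq z mu h
    (fun s => c s • (z * young (mu s) (h s) k)) (fun s => young (mu s) (h s) k * z) hz
    (fun s => by rw [mul_smul_comm, ← mul_assoc, hz]) (fun s => by rw [mul_assoc, hz])
    (fun s => by
      rw [mul_smul_comm, mul_assoc, ← mul_assoc z, hz, ← mul_assoc, he, smul_smul,
        mul_inv_cancel₀ (hc s), one_smul])
    (fun s t hst => by
      rw [mul_smul_comm, mul_assoc, ← mul_assoc z, hz, ← mul_assoc,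
        young_mul_mul_young_of_ne (fun e => hst (hmu e)), smul_zero])
    (fun s => by rw [← mul_assoc, young_mul_young])
  -- Equality of traces holds in `k`; characteristic zero transfers it to the natural number `d`.
  have hd0 : d = 0 := by
    rw [hdim] at hd
    have : (d : k) = 0 := by simpa using hd
    exact_mod_cast this
  refine (h0 hd0).trans (Finset.sum_congr rfl fun s _ => ?_)
  rw [smul_mul_assoc]

end Blocks

/-! ### Explicit row fillings of hooks and two-row diagrams -/

section Shapes

theorem rowLen_hook (a b : ℕ) (ha : 1 ≤ a) (i : ℕ) :
    (hook a b ha).rowLen i = if i = 0 then a else if i ≤ b then 1 else 0 := by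
  apply rowLen_eq_of_mem
  intro j
  rw [hook, YoungDiagram.mem_ofRowLens]
  rcases i with _ | i
  · simp
  · simp only [List.length_cons, List.length_replicate, List.getElem_cons_succ,
      List.getElem_replicate, Nat.add_lt_add_iff_right, Nat.succ_ne_zero, if_false]
    split_ifs <;> simp <;> omega

theorem rowLen_twoRow (a b : ℕ) (hab : b ≤ a) (i : ℕ) :
    (twoRow a b hab).rowLen i = if i = 0 then a else if i = 1 then b else 0 := by
  apply rowLen_eq_of_mem
  intro j
  rw [twoRow, YoungDiagram.mem_ofRowLens]
  rcases i with _ | _ | i <;> simp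

variable {N : ℕ}

/-- The box with entry `i` in the standard row filling of a hook with first row of length `a`. -/
def hookFilling (N a : ℕ) (i : Fin N) : ℕ ×ₗ ℕ :=
  toLex (if i.1 < a then (0, i.1) else (i.1 - a + 1, 0))

/-- The box with entry `i` in the standard row filling of a diagram with two rows, the first of
length `a`. -/
def twoRowFilling (N a : ℕ) (i : Fin N) : ℕ ×ₗ ℕ :=
  toLex (if i.1 < a then (0, i.1) else (1, i.1 - a))

theorem strictMono_hookFilling (N a : ℕ) : StrictMono (hookFilling N a) := by
  intro i j hij
  have : i.1 < j.1 := hij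
  rw [hookFilling, hookFilling, Prod.Lex.toLex_lt_toLex]
  split_ifs <;> simp <;> omega

theorem strictMono_twoRowFilling (N a : ℕ) : StrictMono (twoRowFilling N a) := by
  intro i j hij
  have : i.1 < j.1 := hij
  rw [twoRowFilling, twoRowFilling, Prod.Lex.toLex_lt_toLex]
  split_ifs <;> simp <;> omega

theorem hookFilling_mem {a b : ℕ} {ha : 1 ≤ a} (h : (hook a b ha).card = N) (i : Fin N) :
    ofLex (hookFilling N a i) ∈ hook a b ha := by
  rw [card_hook] at h
  have := i.2
  rw [hookFilling, ofLex_toLex]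
  split_ifs with hi
  · rw [YoungDiagram.mem_iff_lt_rowLen, rowLen_hook]; simpa using hi
  · rw [YoungDiagram.mem_iff_lt_rowLen, rowLen_hook, if_neg (by omega), if_pos (by omega)]
    omega

theorem twoRowFilling_mem {a b : ℕ} {hab : b ≤ a} (h : (twoRow a b hab).card = N) (i : Fin N) :
    ofLex (twoRowFilling N a i) ∈ twoRow a b hab := by
  rw [card_twoRow] at h
  have := i.2
  rw [twoRowFilling, ofLex_toLex]
  split_ifs with hi
  · rw [YoungDiagram.mem_iff_lt_rowLen, rowLen_twoRow]; simpa using hi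
  · rw [YoungDiagram.mem_iff_lt_rowLen, rowLen_twoRow, if_neg (by omega), if_pos (by omega)]
    omega

theorem rowOf_hook {a b : ℕ} {ha : 1 ≤ a} (h : (hook a b ha).card = N) (i : Fin N) :
    rowOf (hook a b ha) h i = if i.1 < a then 0 else i.1 - a + 1 := by
  rw [rowOf_eq h (strictMono_hookFilling N a) (hookFilling_mem h), hookFilling, ofLex_toLex]
  split_ifs <;> rfl

theorem colOf_hook {a b : ℕ} {ha : 1 ≤ a} (h : (hook a b ha).card = N) (i : Fin N) :
    colOf (hook a b ha) h i = if i.1 < a then i.1 else 0 := by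
  rw [colOf_eq h (strictMono_hookFilling N a) (hookFilling_mem h), hookFilling, ofLex_toLex]
  split_ifs <;> rfl

theorem rowOf_twoRow {a b : ℕ} {hab : b ≤ a} (h : (twoRow a b hab).card = N) (i : Fin N) :
    rowOf (twoRow a b hab) h i = if i.1 < a then 0 else 1 := by
  rw [rowOf_eq h (strictMono_twoRowFilling N a) (twoRowFilling_mem h), twoRowFilling, ofLex_toLex]
  split_ifs <;> rfl

theorem colOf_twoRow {a b : ℕ} {hab : b ≤ a} (h : (twoRow a b hab).card = N) (i : Fin N) :
    colOf (twoRow a b hab) h i = if i.1 < a then i.1 else i.1 - a := by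
  rw [colOf_eq h (strictMono_twoRowFilling N a) (twoRowFilling_mem h), twoRowFilling, ofLex_toLex]
  split_ifs <;> rfl

end Shapes

/-! ### Scalars by which the Young idempotents of hooks and two-row shapes meet block idempotents -/

section Multiplicity

variable {k : Type*} [Field k] [CharZero k] {m n : ℕ}

theorem viaEmbeddingHom_castAdd_mem_rowGroup {lam : YoungDiagram} (h : lam.card = m + n)
    (hr : ∀ i : Fin m, rowOf lam h (Fin.castAdd n i) = 0) (σ : Equiv.Perm (Fin m)) :
    Equiv.Perm.viaEmbeddingHom (Fin.castAddEmb n) σ ∈ rowGroup lam h :=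
  viaEmbeddingHom_mem_fibreGroup (f := fun _ => 0) hr (fun _ => rfl)

/-- The symmetrizer on the first strands is absorbed by the row symmetrizer. -/
theorem anti_mul_blockMul_mul_sym {lam : YoungDiagram} (h : lam.card = m + n)
    (hr : ∀ i : Fin m, rowOf lam h (Fin.castAdd n i) = 0)
    (y : MonoidAlgebra k (Equiv.Perm (Fin n))) :
    antiBox k (colGroup lam h) * blockMul (symBox k ⊤) y * symBox k (rowGroup lam h) =
      antiBox k (colGroup lam h) * push k (Fin.natAddEmb m) y * symBox k (rowGroup lam h) := by
  rw [blockMul, push_castAdd_mul_push_natAdd, mul_assoc, mul_assoc (push k _ y),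
    push_symBox_mul (fun σ _ => viaEmbeddingHom_castAdd_mem_rowGroup h hr σ), ← mul_assoc]

/-- The first `a` strands fill the first row and the last `b` strands lie in the first column, so
both boxes are absorbed. -/
theorem young_hook_top {a b : ℕ} {ha : 1 ≤ a} (h : (hook a b ha).card = a + b) :
    young (hook a b ha) h k * blockMul (symBox k ⊤) (antiBox k ⊤) * young (hook a b ha) h k =
      young (hook a b ha) h k := by
  have := young_mul_mul_young_of_smul (k := k) h (z := blockMul (symBox k ⊤) (antiBox k ⊤)) (c := 1)
    (by
      rw [anti_mul_blockMul_mul_sym h (fun i => by rw [rowOf_hook, if_pos]; exact i.2),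
        antiBox_mul_push (H := colGroup (hook a b ha) h) (G := ⊤)
          (fun σ _ => viaEmbeddingHom_mem_fibreGroup (f := fun _ => 0)
          (fun i => by rw [colOf_hook, if_neg]; simp) (fun _ => rfl)), one_smul])
  rw [this, one_smul]

/-- The first `n + 1` strands form the first row, so only the first of the last `m` strands is not
in the first column. Only permutations fixing that strand contribute to the antisymmetrizer, a
proportion `1 / m`. -/
theorem young_hook_low {n m : ℕ} (hn : 1 ≤ n) (hm : 1 < m)
    (h : (hook (n + 1) (m - 1) (Nat.le_add_left 1 n)).card = n + m) :
    young _ h k * blockMul (symBox k ⊤) (antiBox k ⊤) * young _ h k =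
      ((m : ℕ) : k)⁻¹ • young _ h k := by
  obtain ⟨m, rfl⟩ : ∃ l, m = l + 1 := ⟨m - 1, by omega⟩
  apply young_mul_mul_young_of_smul
  rw [anti_mul_blockMul_mul_sym h (fun i => by
    rw [rowOf_hook, if_pos]
    exact Nat.lt_succ_of_lt i.2)]
  have hs : Fintype.card {a : Fin (m + 1) // decide (a = 0) = true} = 1 := by simp
  have := mul_push_box_mul (k := k) (Fin.natAddEmb n) Equiv.Perm.sign
    (X := antiBox k (colGroup _ h)) (Y := symBox k (rowGroup _ h))
    (W := antiBox k (colGroup _ h) * symBox k (rowGroup _ h))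
    (fun a : Fin (m + 1) => decide (a = 0)) hs
    (fun τ hτ => by
      have h0 : τ 0 = 0 := by simpa using congrFun hτ 0
      have hmem : Equiv.Perm.viaEmbeddingHom (Fin.natAddEmb n) τ ∈ colGroup _ h := by
        -- The labels are columns: strand `0` of the second block ends the first row in column `n`,
        -- the others lie in column `0`.
        refine viaEmbeddingHom_mem_fibreGroup (f := fun a => if a = 0 then n else 0)
          (fun i => ?_) (fun i => ?_)
        · change colOf _ h (Fin.natAdd n i) = _
          rw [colOf_hook]
          by_cases hi : i = 0
          · subst hi; simp
          · have : i.1 ≠ 0 := fun e => hi (Fin.ext e)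
            rw [if_neg hi, if_neg]
            simp only [Fin.val_natAdd]; omega
        · have : τ i = 0 ↔ i = 0 := by
            constructor
            · intro e; exact τ.injective (e.trans h0.symm)
            · rintro rfl; exact h0
          simp only [this]
      rw [antiBox, box_mul_single _ hmem, sign_viaEmbeddingHom, smul_mul_assoc, smul_smul, chi_sq,
        one_smul])
    (fun τ hτ => by
      have h0 : τ 0 ≠ 0 := by
        intro h0
        apply hτ
        funext i
        have : τ i = 0 ↔ i = 0 := by
          constructor
          · intro e; exact τ.injective (e.trans h0.symm)
          · rintro rfl; exact h0
        simp [this]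
      have h1 : (τ 0).1 ≠ 0 := fun e => h0 (Fin.ext e)
      -- The strands `n` and `0` share the first row; `τ` fixes the latter and sends the former to
      -- the first column, where the latter already is.
      refine anti_single_sym_eq_zero (x := Fin.natAdd n 0)
        (y := Fin.castAdd (m + 1) ⟨0, hn⟩) ?_ (swap_mem_fibreGroup ?_) (swap_mem_fibreGroup ?_)
      · intro e
        have := congrArg Fin.val e
        simp at this
        omega
      · rw [rowOf_hook, rowOf_hook, if_pos (by simp), if_pos (by simp)]
      · rw [viaEmbeddingHom_natAdd_natAdd, viaEmbeddingHom_natAdd_castAdd, colOf_hook, colOf_hook,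
          if_neg (by simp; omega), if_pos (by simp)]
        simp)
  rw [this, Nat.choose_one_right]

/-- The first `m` strands lie in the first row, and of the last `n` exactly the last `s` lie in the
second. Only permutations preserving these `s` strands contribute, a proportion of one in `n.choose
s`. -/
theorem young_twoRow {m n s : ℕ} (hs : s ≤ n) (hnm : n ≤ m) (hab : s ≤ m + n - s)
    (h : (twoRow (m + n - s) s hab).card = m + n) :
    young _ h k * blockMul (symBox k ⊤) (symBox k ⊤) * young _ h k =
      ((n.choose s : ℕ) : k)⁻¹ • young _ h k := by
  apply young_mul_mul_young_of_smul
  rw [anti_mul_blockMul_mul_sym h (fun i => by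
    have := i.2
    rw [rowOf_twoRow, if_pos]
    simp only [Fin.val_castAdd]; omega)]
  have hcard : Fintype.card {a : Fin n // decide (n - s ≤ a.1) = true} = s := by
    rw [Fintype.card_subtype, ← Finset.card_map Fin.valEmbedding]
    have : (Finset.univ.filter fun a : Fin n => decide (n - s ≤ a.1) = true).map Fin.valEmbedding =
        Finset.Ico (n - s) n := by
      ext a
      simp only [Finset.mem_map, Finset.mem_filter, Finset.mem_univ, true_and, decide_eq_true_eq,
        Fin.valEmbedding_apply, Finset.mem_Ico]
      exact ⟨by rintro ⟨b, hb, rfl⟩; exact ⟨hb, b.2⟩, fun ha => ⟨⟨a, ha.2⟩, ha.1, rfl⟩⟩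
    rw [this, Nat.card_Ico]
    omega
  apply mul_push_box_mul (k := k) (Fin.natAddEmb m) 1 (fun a : Fin n => decide (n - s ≤ a.1)) hcard
  · intro τ hτ
    have hmem : Equiv.Perm.viaEmbeddingHom (Fin.natAddEmb m) τ ∈ rowGroup _ h := by
      refine viaEmbeddingHom_mem_fibreGroup (f := fun a => if n - s ≤ a.1 then 1 else 0)
        (fun i => ?_) (fun i => ?_)
      · change rowOf _ h (Fin.natAdd m i) = _
        rw [rowOf_twoRow]
        by_cases hi : n - s ≤ i.1
        · rw [if_pos hi, if_neg]
          simp only [Fin.val_natAdd]; omega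
        · rw [if_neg hi, if_pos]
          simp only [Fin.val_natAdd]; omega
      · have := congrFun hτ i
        simp only [Function.comp_apply, decide_eq_decide] at this
        simp only [this]
    rw [mul_assoc, symBox, single_mul_box _ hmem]
    simp
  · intro τ hτ
    obtain ⟨x, hx, hx'⟩ := exists_of_comp_ne hτ
    simp only [decide_eq_true_eq, decide_eq_false_iff_not, not_le] at hx hx'
    -- This difference is the column of the box of `τ x` in the second row. It is less than `s ≤ n ≤
    -- m`, so the box above it belongs to one of the first `m` strands, which `τ` leaves in place;
    -- with the strand `x`, also from the first row, it gives the vanishing pair.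
    have hy : (τ x).1 - (n - s) < m := by have := (τ x).2; omega
    refine anti_single_sym_eq_zero (x := Fin.natAdd m x)
      (y := Fin.castAdd n ⟨(τ x).1 - (n - s), hy⟩) ?_ (swap_mem_fibreGroup ?_)
      (swap_mem_fibreGroup ?_)
    · intro e
      have := congrArg Fin.val e
      simp at this
      omega
    · rw [rowOf_twoRow, rowOf_twoRow, if_pos (by simp; omega), if_pos (by simp; omega)]
    · rw [viaEmbeddingHom_natAdd_natAdd, viaEmbeddingHom_natAdd_castAdd, colOf_twoRow, colOf_twoRow,
        if_neg (by simp; omega), if_pos (by simp; omega)]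
      simp only [Fin.val_natAdd, Fin.val_castAdd]
      omega

end Multiplicity

/-! ### Dimensions of hooks and two-row shapes, and completeness of the block decompositions -/

section Dimensions

variable (k : Type*) [Field k] [CharZero k]

theorem spechtDim_eq_sum (mu : YoungDiagram) (hmu : mu.card ≠ 0) :
    spechtDim mu rfl k =
      ∑ s ∈ removableRows mu, spechtDim (removeBoxOrSelf mu s) rfl k := by
  have hf : ∀ {m : ℕ} {lam : YoungDiagram} (h : lam.card = m),
      spechtDim lam h k = spechtDim lam rfl k := by
    rintro m lam rfl; rfl
  obtain ⟨n, hn⟩ := Nat.exists_eq_succ_of_ne_zero hmu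
  have h1 := (spechtDim_branching k n).2 mu hn
  simp only [hf] at h1
  rw [← h1, sum_removeBox mu fun lam => spechtDim lam rfl k]

/-- The group algebra itself is one-dimensional and the Specht module is a nonzero left ideal. This
starts the inductions below. -/
theorem spechtDim_of_le_one {n : ℕ} (hn : n ≤ 1) {lam : YoungDiagram} (h : lam.card = n) :
    spechtDim lam h k = 1 := by
  have h1 := spechtDim_ne_zero (k := k) lam h
  have h2 : spechtDim lam h k ≤ Module.finrank k (MonoidAlgebra k (Equiv.Perm (Fin n))) :=
    Submodule.finrank_le _
  have h3 : Module.finrank k (MonoidAlgebra k (Equiv.Perm (Fin n))) = 1 := by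
    have : Fintype.card (Equiv.Perm (Fin n)) = 1 := by
      rw [Fintype.card_perm, Fintype.card_fin]
      interval_cases n <;> rfl
    rw [(MonoidAlgebra.coeffLinearEquiv k).finrank_eq, Module.finrank_finsupp_self, this]
  omega

/-- Induction by the branching rule, which is Pascal's rule when both corners are removable. The
shape is given through its row lengths so that the hypothesis passes to the diagram with a box
removed. -/
theorem spechtDim_of_rowLen_hook (N : ℕ) : ∀ (lam : YoungDiagram) (a b : ℕ), 1 ≤ a →
    a + b = N + 1 → (∀ i, lam.rowLen i = if i = 0 then a else if i ≤ b then 1 else 0) →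
    ∀ h : lam.card = N + 1, spechtDim lam h k = (a + b - 1).choose b := by
  have hf : ∀ {m : ℕ} {lam : YoungDiagram} (h : lam.card = m),
      spechtDim lam h k = spechtDim lam rfl k := by
    rintro m lam rfl; rfl
  induction N with
  | zero =>
    intro lam a b ha hab hr h
    obtain rfl : b = 0 := by omega
    rw [spechtDim_of_le_one k (by omega), Nat.choose_zero_right]
  | succ N ih =>
    intro lam a b ha hab hr h
    rw [hf, spechtDim_eq_sum k _ (by omega)]
    have hcard : ∀ s ∈ removableRows lam, (removeBoxOrSelf lam s).card = N + 1 := by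
      intro s hs
      rw [removeBoxOrSelf, dif_pos hs]; exact card_removeBox' h ⟨s, hs⟩
    have htop : 2 ≤ a → 0 ∈ removableRows lam →
        spechtDim (removeBoxOrSelf lam 0) rfl k = (a + b - 2).choose b := by
      intro h2 h0
      rw [← hf (hcard 0 h0), ih _ (a - 1) b (by omega) (by omega) (fun i => by
        simp only [rowLen_removeBoxOrSelf h0, hr]; split_ifs <;> omega)]
      congr 1; omega
    have hlow : 1 ≤ b → b ∈ removableRows lam →
        spechtDim (removeBoxOrSelf lam b) rfl k = (a + b - 2).choose (b - 1) := by
      intro h2 h0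
      rw [← hf (hcard b h0), ih _ a (b - 1) (by omega) (by omega) (fun i => by
        simp only [rowLen_removeBoxOrSelf h0, hr]; split_ifs <;> omega)]
      congr 1; omega
    rcases Nat.eq_zero_or_pos b with rfl | hb
    · have hrem : removableRows lam = {0} := by
        ext s
        simp only [mem_removableRows, hr, Finset.mem_singleton]
        split_ifs <;> first | contradiction | omega
      rw [hrem, Finset.sum_singleton, htop (by omega) (by simp [hrem])]
      simp
    rcases Nat.lt_or_ge a 2 with ha2 | ha2
    · obtain rfl : a = 1 := by omega
      have hrem : removableRows lam = {b} := by
        ext s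
        simp only [mem_removableRows, hr, Finset.mem_singleton]
        split_ifs <;> first | contradiction | omega
      rw [hrem, Finset.sum_singleton, hlow hb (by simp [hrem])]
      rw [show 1 + b - 2 = b - 1 by omega, show 1 + b - 1 = b by omega, Nat.choose_self,
        Nat.choose_self]
    · have hrem : removableRows lam = {0, b} := by
        ext s
        simp only [mem_removableRows, hr, Finset.mem_insert, Finset.mem_singleton]
        split_ifs <;> first | contradiction | omega
      rw [hrem, Finset.sum_pair (by omega), htop ha2 (by simp [hrem]), hlow hb (by simp [hrem])]
      obtain ⟨c, rfl⟩ : ∃ c, b = c + 1 := ⟨b - 1, by omega⟩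
      rw [show a + (c + 1) - 1 = (a + (c + 1) - 2) + 1 by omega, Nat.choose_succ_succ, add_comm]
      rfl

theorem spechtDim_hook (a b : ℕ) (ha : 1 ≤ a) {n : ℕ} (h : (hook a b ha).card = n) :
    spechtDim (hook a b ha) h k = (a + b - 1).choose b := by
  have hc := h
  rw [card_hook] at hc
  obtain ⟨N, rfl⟩ : ∃ N, n = N + 1 := ⟨n - 1, by omega⟩
  exact spechtDim_of_rowLen_hook k N _ a b ha hc (rowLen_hook a b ha) h

/-- This is the ballot number `C(a + b, b) - C(a + b, b - 1)`, written without subtraction, with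
subtracted term zero if `b = 0`. The induction uses Pascal's rule for both binomials. -/
theorem spechtDim_of_rowLen_twoRow (N : ℕ) : ∀ (lam : YoungDiagram) (a b : ℕ), b ≤ a →
    a + b = N → (∀ i, lam.rowLen i = if i = 0 then a else if i = 1 then b else 0) →
    ∀ h : lam.card = N, spechtDim lam h k + (if b = 0 then 0 else (a + b).choose (b - 1)) =
      (a + b).choose b := by
  have hf : ∀ {m : ℕ} {lam : YoungDiagram} (h : lam.card = m),
      spechtDim lam h k = spechtDim lam rfl k := by
    rintro m lam rfl; rfl
  induction N with
  | zero =>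
    intro lam a b hba hab hr h
    obtain rfl : b = 0 := by omega
    rw [spechtDim_of_le_one k (by omega), Nat.choose_zero_right, if_pos rfl]
  | succ N ih =>
    intro lam a b hba hab hr h
    rw [hf, spechtDim_eq_sum k _ (by omega)]
    have hcard : ∀ s ∈ removableRows lam, (removeBoxOrSelf lam s).card = N := by
      intro s hs
      rw [removeBoxOrSelf, dif_pos hs]; exact card_removeBox' h ⟨s, hs⟩
    have htop : b < a → 0 ∈ removableRows lam →
        spechtDim (removeBoxOrSelf lam 0) rfl k +
          (if b = 0 then 0 else (a - 1 + b).choose (b - 1)) = (a - 1 + b).choose b := by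
      intro h2 h0
      rw [← hf (hcard 0 h0), ih _ (a - 1) b (by omega) (by omega) (fun i => by
        simp only [rowLen_removeBoxOrSelf h0, hr]; split_ifs <;> omega)]
    have hlow : 1 ≤ b → 1 ∈ removableRows lam →
        spechtDim (removeBoxOrSelf lam 1) rfl k +
          (if b - 1 = 0 then 0 else (a + (b - 1)).choose (b - 1 - 1)) =
            (a + (b - 1)).choose (b - 1) := by
      intro h2 h0
      rw [← hf (hcard 1 h0), ih _ a (b - 1) (by omega) (by omega) (fun i => by
        simp only [rowLen_removeBoxOrSelf h0, hr]; split_ifs <;> omega)]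
    rcases Nat.eq_zero_or_pos b with rfl | hb
    · have hrem : removableRows lam = {0} := by
        ext s
        simp only [mem_removableRows, hr, Finset.mem_singleton]
        split_ifs <;> first | contradiction | omega
      have := htop (by omega) (by simp [hrem])
      rw [hrem, Finset.sum_singleton]
      simpa using this
    obtain ⟨c, rfl⟩ : ∃ c, b = c + 1 := ⟨b - 1, by omega⟩
    have hpas : (a + c + 1).choose (c + 1) = (a + c).choose c + (a + c).choose (c + 1) :=
      Nat.choose_succ_succ _ _
    have hpas' : (a + c + 1).choose c =
        (if c = 0 then 0 else (a + c).choose (c - 1)) + (a + c).choose c := by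
      rcases c with _ | c
      · simp
      · rw [if_neg (by omega)]; exact Nat.choose_succ_succ _ _
    simp only [Nat.add_sub_cancel, Nat.succ_ne_zero, if_false, ← add_assoc] at htop hlow ⊢
    rw [hpas, hpas']
    rcases Nat.lt_or_ge (c + 1) a with ha2 | ha2
    · have hrem : removableRows lam = {0, 1} := by
        ext s
        simp only [mem_removableRows, hr, Finset.mem_insert, Finset.mem_singleton]
        split_ifs <;> first | contradiction | omega
      have h1 := htop ha2 (by simp [hrem])
      have h2 := hlow hb (by simp [hrem])
      rw [show a - 1 + c + 1 = a + c by omega] at h1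
      rw [hrem, Finset.sum_pair (by omega)]
      omega
    · have hrem : removableRows lam = {1} := by
        ext s
        simp only [mem_removableRows, hr, Finset.mem_singleton]
        split_ifs <;> first | contradiction | omega
      have h2 := hlow hb (by simp [hrem])
      -- With equal rows only the second row is removable; the missing term is zero by symmetry of
      -- the binomials of `2c + 1`.
      have h3 : (a + c).choose (c + 1) = (a + c).choose c := by
        obtain rfl : a = c + 1 := by omega
        exact Nat.choose_symm_of_eq_add (by omega)
      rw [hrem, Finset.sum_singleton]
      omega

theorem spechtDim_twoRow (a b : ℕ) (hab : b ≤ a) {n : ℕ} (h : (twoRow a b hab).card = n) :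
    spechtDim (twoRow a b hab) h k + (if b = 0 then 0 else (a + b).choose (b - 1)) =
      (a + b).choose b :=
  spechtDim_of_rowLen_twoRow k n _ a b hab ((card_twoRow a b hab).symm.trans h)
    (rowLen_twoRow a b hab) h

theorem hook_ne_hook {a b a' b' : ℕ} {ha : 1 ≤ a} {ha' : 1 ≤ a'} (hne : a ≠ a') :
    hook a b ha ≠ hook a' b' ha' := by
  intro e
  apply hne
  have := congrArg (fun l => YoungDiagram.rowLen l 0) e
  simpa [rowLen_hook] using this

theorem twoRow_ne_twoRow {a b a' b' : ℕ} {hab : b ≤ a} {hab' : b' ≤ a'} (hne : b ≠ b') :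
    twoRow a b hab ≠ twoRow a' b' hab' := by
  intro e
  apply hne
  have := congrArg (fun l => YoungDiagram.rowLen l 1) e
  simpa [rowLen_twoRow] using this

/-- The two hooks have the multiplicity scalars `1` and `1 / m`, and their dimensions add up to the
trace of the block idempotent by Pascal's rule. -/
theorem blockMul_sym_anti_eq {n m : ℕ} (hn : 1 ≤ n) (hm : 1 < m)
    (h : (hook n m hn).card = n + m)
    (h' : (hook (n + 1) (m - 1) (Nat.le_add_left 1 n)).card = n + m) :
    blockMul (symBox k ⊤) (antiBox k ⊤) =
      blockMul (symBox k ⊤) (antiBox k ⊤) * young _ h k *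
        (young _ h k * blockMul (symBox k ⊤) (antiBox k ⊤)) +
      (m : k) • (blockMul (symBox k ⊤) (antiBox k ⊤) * young _ h' k *
        (young _ h' k * blockMul (symBox k ⊤) (antiBox k ⊤))) := by
  have hm0 : (m : k) ≠ 0 := by exact_mod_cast (by omega : m ≠ 0)
  have key := eq_sum_of_young_mul_mul_young (k := k) (ι := Bool)
    (blockMul_mul_self (box_mul_box 1) (box_mul_box Equiv.Perm.sign))
    (fun b => bif b then hook n m hn else hook (n + 1) (m - 1) (Nat.le_add_left 1 n))
    (fun b => by cases b; exacts [h', h])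
    (by
      intro b b' e
      rcases b with _ | _ <;> rcases b' with _ | _
      · rfl
      · exact absurd e (hook_ne_hook (ha := Nat.le_add_left 1 n) (ha' := hn) (by omega))
      · exact absurd e (hook_ne_hook (ha := hn) (ha' := Nat.le_add_left 1 n) (by omega))
      · rfl)
    (fun b => bif b then 1 else (m : k)) (by rintro (_ | _); exacts [hm0, one_ne_zero])
    (by
      rintro (_ | _)
      · exact young_hook_low hn hm h'
      · exact (young_hook_top h).trans (by simp))
    (by
      rw [factorial_mul_blockMul_coeff_one, Fintype.sum_bool]
      simp only [cond_true, cond_false]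
      rw [spechtDim_hook, spechtDim_hook]
      obtain ⟨l, rfl⟩ : ∃ l, m = l + 1 := ⟨m - 1, by omega⟩
      have : (n + (l + 1)).choose (l + 1) =
          (n + (l + 1) - 1).choose (l + 1) + (n + 1 + (l + 1 - 1) - 1).choose (l + 1 - 1) := by
        rw [show n + (l + 1) = (n + l) + 1 by omega, Nat.choose_succ_succ, add_comm]
        congr 2 <;> omega
      rw [this]; push_cast; rfl)
  refine key.trans ?_
  rw [Fintype.sum_bool]
  simp

/-- The ballot numbers telescope to `C(m + n, n)`, the trace of the block idempotent, so the shapes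
with second row at most `n` exhaust it. -/
theorem blockMul_sym_sym_eq {n m : ℕ} (hnm : n ≤ m) (hs : ∀ s : Fin (n + 1), s.1 ≤ m + n - s.1)
    (h : ∀ s : Fin (n + 1), (twoRow (m + n - s) s (hs s)).card = m + n) :
    blockMul (symBox k ⊤) (symBox k ⊤) = ∑ s : Fin (n + 1), ((n.choose s : ℕ) : k) •
      (blockMul (symBox k ⊤) (symBox k ⊤) * young _ (h s) k *
        (young _ (h s) k * blockMul (symBox k ⊤) (symBox k ⊤))) := by
  refine eq_sum_of_young_mul_mul_young (k := k) (ι := Fin (n + 1))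
    (blockMul_mul_self (box_mul_box 1) (box_mul_box 1)) (fun s => twoRow (m + n - s.1) s.1 (hs s)) h
    (fun s t e => by
      by_contra hne
      exact twoRow_ne_twoRow (fun e' => hne (Fin.ext e')) e)
    (fun s => ((n.choose s : ℕ) : k))
    (fun s => by exact_mod_cast (Nat.choose_pos (Nat.lt_succ_iff.1 s.2)).ne')
    (fun s => young_twoRow (Nat.lt_succ_iff.1 s.2) hnm (hs s) (h s)) ?_
  rw [factorial_mul_blockMul_coeff_one]
  norm_cast
  have hd : ∀ s : Fin (n + 1), spechtDim _ (h s) k +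
      (if s.1 = 0 then 0 else (m + n).choose (s.1 - 1)) = (m + n).choose s.1 := by
    intro s
    have := spechtDim_twoRow k _ _ (hs s) (h s)
    have h2 := hs s
    have h3 := s.2
    rwa [show m + n - s.1 + s.1 = m + n by omega] at this
  -- After splitting off the first subtracted term, which is `0`, and the last binomial, the
  -- remaining sums of binomials coincide.
  have hsum := Finset.sum_congr rfl fun s (_ : s ∈ Finset.univ) => hd s
  rw [Finset.sum_add_distrib, Fin.sum_univ_succ (fun s : Fin (n + 1) => if s.1 = 0 then 0 else _),
    Fin.sum_univ_castSucc (fun s : Fin (n + 1) => (m + n).choose s.1)] at hsum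
  simp at hsum
  omega

end Dimensions

end Heis


namespace Heis

/-! ### Permutation diagrams on tensor powers and on blocks of strands -/

section Diagrams

variable {C : Type*} [Category C] [MonoidalCategory C] (S : SymStrand C)

theorem permDiagram_swap {n i : ℕ} (h : i + 1 < n) :
    permDiagram S n (Equiv.swap ⟨i, by omega⟩ ⟨i + 1, h⟩) = crossAt S n i :=
  (exists_permDiagram S n).choose_spec i h

/-- Adjacent transpositions generate the symmetric group as a monoid. With this, compatibilities of
`permDiagram` are checked on single crossings only. -/
theorem permHom_ext {M : Type*} [Monoid M] {n : ℕ} {f g : Equiv.Perm (Fin n) →* M}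
    (h : ∀ (i : ℕ) (hi : i + 1 < n), f (Equiv.swap ⟨i, by omega⟩ ⟨i + 1, hi⟩) =
      g (Equiv.swap ⟨i, by omega⟩ ⟨i + 1, hi⟩)) : f = g := by
  rcases n with _ | n
  · ext σ
    rw [Subsingleton.elim σ 1, map_one, map_one]
  · refine MonoidHom.eq_of_eqOn_denseM (Equiv.Perm.mclosure_swap_castSucc_succ n) ?_
    rintro _ ⟨i, rfl⟩
    exact h i.1 (by omega)

theorem viaEmbeddingHom_swap {n N : ℕ} (ι : Fin n ↪ Fin N) (i j : Fin n) :
    Equiv.Perm.viaEmbeddingHom ι (Equiv.swap i j) = Equiv.swap (ι i) (ι j) := by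
  ext x
  congr 1
  by_cases hx : x ∈ Set.range ι
  · obtain ⟨y, rfl⟩ := hx
    rw [viaEmbeddingHom_apply_apply, ι.injective.swap_apply]
  · rw [viaEmbeddingHom_apply_of_notMem _ _ hx, Equiv.swap_apply_of_ne_of_ne] <;>
      rintro rfl <;> exact hx ⟨_, rfl⟩

theorem crossAt_whiskerRight : ∀ {n i : ℕ}, i + 1 < n →
    crossAt S (n + 1) i = crossAt S n i ▷ S.X
  | 0, i, h => by omega
  | 1, i, h => by omega
  | n + 2, i, h => crossAt_of_ne S (by omega)

theorem permDiagram_addLast {n : ℕ} (σ : Equiv.Perm (Fin n)) :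
    permDiagram S (n + 1) (addLast n σ) = permDiagram S n σ ▷ S.X := by
  let g : Equiv.Perm (Fin n) →* End (pow S (n + 1)) :=
    { toFun := fun σ => permDiagram S n σ ▷ S.X
      map_one' := by rw [map_one]; exact id_whiskerRight _ _
      map_mul' := fun σ τ => by rw [map_mul]; exact comp_whiskerRight _ _ _ }
  have : (permDiagram S (n + 1)).comp (addLast n) = g := permHom_ext fun i hi => by
    change permDiagram S (n + 1) (Equiv.Perm.viaEmbeddingHom _ _) = permDiagram S n _ ▷ S.X
    rw [viaEmbeddingHom_swap, permDiagram_swap, ← crossAt_whiskerRight S hi]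
    exact permDiagram_swap S _
  exact DFunLike.congr_fun this σ

theorem splitIso_succ_hom (m n : ℕ) : (splitIso S m (n + 1)).hom =
    (splitIso S m n).hom ▷ S.X ≫ (α_ (pow S m) (pow S n) S.X).hom := rfl

theorem splitIso_succ_inv (m n : ℕ) : (splitIso S m (n + 1)).inv =
    (α_ (pow S m) (pow S n) S.X).inv ≫ (splitIso S m n).inv ▷ S.X := rfl

theorem permDiagram_castAdd {m : ℕ} (σ : Equiv.Perm (Fin m)) : ∀ n : ℕ,
    permDiagram S (m + n) (Equiv.Perm.viaEmbeddingHom (Fin.castAddEmb n) σ) =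
      (splitIso S m n).hom ≫ permDiagram S m σ ▷ pow S n ≫ (splitIso S m n).inv
  | 0 => by
    have : Equiv.Perm.viaEmbeddingHom (Fin.castAddEmb 0) σ = σ := by
      ext x; exact congrArg Fin.val (viaEmbeddingHom_apply_apply (Fin.castAddEmb 0) σ x)
    rw [this]
    change _ = (ρ_ _).inv ≫ _ ▷ 𝟙_ C ≫ (ρ_ _).hom
    simp
  | n + 1 => by
    have : Equiv.Perm.viaEmbeddingHom (Fin.castAddEmb (n + 1)) σ =
        addLast (m + n) (Equiv.Perm.viaEmbeddingHom (Fin.castAddEmb n) σ) := by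
      ext x
      congr 1
      induction x using Fin.lastCases with
      | last =>
        exact (viaEmbeddingHom_castAdd_natAdd σ (Fin.last n)).trans
          (addLast_last (n := m + n) _).symm
      | cast x =>
        refine Eq.trans ?_ (addLast_castSucc (n := m + n) _ x).symm
        induction x using Fin.addCases with
        | left x =>
          rw [viaEmbeddingHom_castAdd_castAdd]
          exact viaEmbeddingHom_castAdd_castAdd σ x
        | right x =>
          rw [viaEmbeddingHom_castAdd_natAdd]
          exact viaEmbeddingHom_castAdd_natAdd σ x.castSucc
    rw [this]
    refine (permDiagram_addLast S (n := m + n) _).trans ?_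
    rw [permDiagram_castAdd σ n, splitIso_succ_hom, splitIso_succ_inv]
    simp

/-- Tensor powers are bracketed to the left, so prepending strands costs associators. Only the
crossing of the last two strands needs rebracketing by hand; the others follow by induction. -/
theorem crossAt_natAdd (m : ℕ) : ∀ {n i : ℕ}, i + 1 < n →
    crossAt S (m + n) (m + i) =
      (splitIso S m n).hom ≫ pow S m ◁ crossAt S n i ≫ (splitIso S m n).inv
  | 0, i, h => by omega
  | 1, i, h => by omega
  | n + 2, i, h => by
    by_cases hi : i = n
    · subst hi
      rw [crossAt_last]
      refine (crossAt_last S (m + i)).trans ?_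
      rw [splitIso_succ_hom, splitIso_succ_inv, splitIso_succ_hom, splitIso_succ_inv]
      have e : onLast (pow S (m + i)) S.c = ((splitIso S m i).hom ▷ S.X) ▷ S.X ≫
          onLast (pow S m ⊗ pow S i) S.c ≫ ((splitIso S m i).inv ▷ S.X) ▷ S.X := by
        simp only [onLast, Category.assoc, associator_naturality_left_assoc,
          ← whisker_exchange_assoc]
        simp
      rw [e]
      simp [onLast]
    · rw [crossAt_of_ne S hi]
      refine (crossAt_of_ne S (n := m + n) (i := m + i) (by omega)).trans ?_
      have ih : crossAt S (m + n + 1) (m + i) = _ :=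
        crossAt_natAdd m (n := n + 1) (i := i) (by omega)
      rw [ih, splitIso_succ_hom S m (n + 1), splitIso_succ_inv S m (n + 1)]
      simp

theorem permDiagram_natAdd (m : ℕ) {n : ℕ} (σ : Equiv.Perm (Fin n)) :
    permDiagram S (m + n) (Equiv.Perm.viaEmbeddingHom (Fin.natAddEmb m) σ) =
      (splitIso S m n).hom ≫ pow S m ◁ permDiagram S n σ ≫ (splitIso S m n).inv := by
  let g : Equiv.Perm (Fin n) →* End (pow S (m + n)) :=
    { toFun := fun σ => (splitIso S m n).hom ≫ pow S m ◁ permDiagram S n σ ≫ (splitIso S m n).inv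
      map_one' := by
        rw [map_one]
        change _ ≫ _ ◁ (𝟙 _) ≫ _ = 𝟙 _
        simp
      map_mul' := fun σ τ => by rw [map_mul, End.mul_def, End.mul_def]; simp }
  have : (permDiagram S (m + n)).comp (Equiv.Perm.viaEmbeddingHom (Fin.natAddEmb m)) = g :=
    permHom_ext fun i hi => by
      change permDiagram S (m + n) (Equiv.Perm.viaEmbeddingHom _ _) =
        (splitIso S m n).hom ≫ pow S m ◁ permDiagram S n _ ≫ (splitIso S m n).inv
      rw [viaEmbeddingHom_swap, permDiagram_swap, ← crossAt_natAdd S m hi]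
      exact permDiagram_swap S _
  exact DFunLike.congr_fun this σ

variable {k : Type*} [Field k] [Preadditive C] [Linear k C]

theorem algDiagram_single {n : ℕ} (σ : Equiv.Perm (Fin n)) (r : k) :
    algDiagram S k n (MonoidAlgebra.single σ r) = r • permDiagram S n σ := by
  simp [algDiagram, MonoidAlgebra.lift_single]

/-- Multiplication in `End` is composition of functions, while `≫` is in diagram order; hence the
reversed product. -/
theorem algDiagram_comp {n : ℕ} (x y : MonoidAlgebra k (Equiv.Perm (Fin n))) :
    algDiagram S k n x ≫ algDiagram S k n y = algDiagram S k n (y * x) :=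
  (map_mul (algDiagram S k n) y x).symm

variable [MonoidalPreadditive C] [MonoidalLinear k C]

theorem algDiagram_incl {n : ℕ} (x : MonoidAlgebra k (Equiv.Perm (Fin n))) :
    algDiagram S k (n + 1) (incl k n x) = algDiagram S k n x ▷ S.X := by
  induction x using MonoidAlgebra.induction_linear with
  | zero => rw [map_zero, map_zero, map_zero]; exact (MonoidalPreadditive.zero_whiskerRight).symm
  | add a b ha hb =>
    rw [map_add, map_add, map_add, ha, hb]
    exact (MonoidalPreadditive.add_whiskerRight _ _).symm
  | single σ r =>
    rw [incl, push_single, algDiagram_single, algDiagram_single, permDiagram_addLast]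
    exact (MonoidalLinear.smul_whiskerRight _ _ _).symm

theorem algDiagram_castAdd {m n : ℕ} (x : MonoidAlgebra k (Equiv.Perm (Fin m))) :
    algDiagram S k (m + n) (push k (Fin.castAddEmb n) x) =
      (splitIso S m n).hom ≫ algDiagram S k m x ▷ pow S n ≫ (splitIso S m n).inv := by
  induction x using MonoidAlgebra.induction_linear with
  | zero =>
    rw [map_zero, map_zero, map_zero]
    change _ = _ ≫ (0 : pow S m ⟶ pow S m) ▷ _ ≫ _
    simp
  | add a b ha hb =>
    rw [map_add, map_add, map_add, ha, hb]
    refine Eq.symm ((congrArg (fun f => _ ≫ f ≫ _)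
      (MonoidalPreadditive.add_whiskerRight _ _)).trans ?_)
    simp
  | single σ r =>
    rw [push_single, algDiagram_single, algDiagram_single, permDiagram_castAdd]
    refine Eq.symm ((congrArg (fun f => _ ≫ f ≫ _)
      (MonoidalLinear.smul_whiskerRight _ _ _)).trans ?_)
    simp

theorem algDiagram_natAdd {m n : ℕ} (x : MonoidAlgebra k (Equiv.Perm (Fin n))) :
    algDiagram S k (m + n) (push k (Fin.natAddEmb m) x) =
      (splitIso S m n).hom ≫ pow S m ◁ algDiagram S k n x ≫ (splitIso S m n).inv := by
  induction x using MonoidAlgebra.induction_linear with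
  | zero =>
    rw [map_zero, map_zero, map_zero]
    change _ = _ ≫ _ ◁ (0 : pow S n ⟶ pow S n) ≫ _
    simp
  | add a b ha hb =>
    rw [map_add, map_add, map_add, ha, hb]
    refine Eq.symm ((congrArg (fun f => _ ≫ f ≫ _)
      (MonoidalPreadditive.whiskerLeft_add _ _)).trans ?_)
    simp
  | single σ r =>
    rw [push_single, algDiagram_single, algDiagram_single, permDiagram_natAdd]
    refine Eq.symm ((congrArg (fun f => _ ≫ f ≫ _)
      (MonoidalLinear.whiskerLeft_smul _ _ _)).trans ?_)
    simp

theorem algDiagram_blockMul {m n : ℕ} (x : MonoidAlgebra k (Equiv.Perm (Fin m)))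
    (y : MonoidAlgebra k (Equiv.Perm (Fin n))) :
    algDiagram S k (m + n) (blockMul x y) = (splitIso S m n).hom ≫
      (algDiagram S k m x ⊗ₘ algDiagram S k n y) ≫ (splitIso S m n).inv := by
  rw [blockMul, ← algDiagram_comp, algDiagram_castAdd, algDiagram_natAdd]
  simp [tensorHom_def']

end Diagrams

end Heis


namespace Heis

open Limits Idempotents

/-! ### Morphisms between idempotents in the Heisenberg category -/

section Between

variable {k : Type*} [CommRing k]

theorem toHeis_map_add {A B : Karoubi (Word k)} (f g : A ⟶ B) :
    (toHeis k).map (f + g) = (toHeis k).map f + (toHeis k).map g := by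
  apply Karoubi.hom_ext
  exact (Mat_.embedding (Word k)).map_add

instance : (toHeis k).Additive where
  map_add := toHeis_map_add _ _

theorem between_congr {A B : Karoubi (Word k)} {f g : A.X ⟶ B.X}
    (h : A.p ≫ f ≫ B.p = A.p ≫ g ≫ B.p) : between A B f = between A B g := by
  simp only [between, h]

theorem between_comp {A B C : Karoubi (Word k)} (f : A.X ⟶ B.X) (g : B.X ⟶ C.X) :
    between A B f ≫ between B C g = between A C (f ≫ B.p ≫ g) := by
  rw [between, between, between, ← Functor.map_comp]
  congr 1
  apply Karoubi.hom_ext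
  simp

theorem between_eq_id {A : Karoubi (Word k)} {f : A.X ⟶ A.X} (h : A.p ≫ f ≫ A.p = A.p) :
    between A A f = 𝟙 _ := by
  rw [between, ← (toHeis k).map_id]
  congr 1
  exact Karoubi.hom_ext _ _ h

theorem between_eq_zero {A B : Karoubi (Word k)} {f : A.X ⟶ B.X} (h : A.p ≫ f ≫ B.p = 0) :
    between A B f = 0 := by
  rw [between, ← (toHeis k).map_zero]
  congr 1
  exact Karoubi.hom_ext _ _ h

theorem between_add {A B : Karoubi (Word k)} (f g : A.X ⟶ B.X) :
    between A B (f + g) = between A B f + between A B g := by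
  rw [between, between, between, ← toHeis_map_add]
  congr 1
  apply Karoubi.hom_ext
  simp

theorem between_sum {A B : Karoubi (Word k)} {ι : Type*} (s : Finset ι) (f : ι → (A.X ⟶ B.X)) :
    between A B (∑ i ∈ s, f i) = ∑ i ∈ s, between A B (f i) := by
  classical
  induction s using Finset.induction_on with
  | empty => rw [Finset.sum_empty, Finset.sum_empty]; exact between_eq_zero (by simp)
  | insert i s hi ih => rw [Finset.sum_insert hi, Finset.sum_insert hi, between_add, ih]

end Between

/-! ### From inclusions and projections to direct sums -/

section Biproducts

variable {D : Type*} [Category D] [Preadditive D]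

theorem nonempty_iso_biproduct [HasFiniteBiproducts D] {ι : Type} [Finite ι] {X : D} {Y : ι → D}
    {i : ∀ s, Y s ⟶ X} {p : ∀ s, X ⟶ Y s} [Fintype ι] (h1 : ∀ s, i s ≫ p s = 𝟙 _)
    (h0 : ∀ s t, s ≠ t → i s ≫ p t = 0) (h : ∑ s, p s ≫ i s = 𝟙 X) :
    Nonempty (X ≅ ⨁ Y) := by
  classical
  refine ⟨⟨biproduct.lift p, biproduct.desc i, by rw [biproduct.lift_desc, h], ?_⟩⟩
  ext s t
  by_cases hst : s = t
  · subst hst; simp [h1]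
  · simp [h0 t s (Ne.symm hst), biproduct.ι_π_ne _ (Ne.symm hst)]

theorem nonempty_iso_biprod [HasBinaryBiproducts D] {X Y Z : D} {i : Y ⟶ X} {p : X ⟶ Y}
    {j : Z ⟶ X} {q : X ⟶ Z} (h1 : i ≫ p = 𝟙 _) (h2 : j ≫ q = 𝟙 _) (h3 : j ≫ p = 0)
    (h4 : i ≫ q = 0) (h : p ≫ i + q ≫ j = 𝟙 X) : Nonempty (X ≅ Y ⊞ Z) := by
  refine ⟨⟨biprod.lift p q, biprod.desc i j, by rw [biprod.lift_desc, h], ?_⟩⟩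
  ext <;> simp [h1, h2, h3, h4]

end Biproducts

section RowBox

variable {k : Type*} [Field k] [CharZero k] {n : ℕ}

theorem fixingSubgroup_le_rowGroup (lam : YoungDiagram) (h : lam.card = n) (s : ℕ) :
    fixingSubgroup (Equiv.Perm (Fin n)) {i | rowOf lam h i ≠ s} ≤ rowGroup lam h := by
  intro σ hσ i
  rw [mem_fixingSubgroup_iff] at hσ
  by_cases h1 : rowOf lam h i = s
  · by_contra h2
    have h3 := hσ (σ i) (show rowOf lam h (σ i) ≠ s from fun e => h2 (e.trans h1.symm))
    exact h2 (congrArg (rowOf lam h) (σ.injective h3))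
  · exact congrArg (rowOf lam h) (hσ i h1)

/-- The symmetrizer of one row is absorbed by the row symmetrizer. Hence the factors `W_s` in the
inclusions and projections have no effect next to the Young idempotents. -/
theorem rowBox_mul_young (lam : YoungDiagram) (h : lam.card = n) (s : ℕ) :
    rowBox k lam h s * young lam h k = young lam h k := by
  rw [young, youngQuasi, mul_smul_comm, ← mul_assoc]
  congr 2
  refine box_average_mul (AlgHom.id k _) fun g hg => ?_
  rw [AlgHom.id_apply, symBox, single_mul_box _ (fixingSubgroup_le_rowGroup lam h s hg)]

end RowBox

/-! ### Transport of group algebra identities to decompositions of objects -/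

section Decomposition

variable {k : Type*} [Field k] {n : ℕ}

theorem upDia_comp (x y : MonoidAlgebra k (Equiv.Perm (Fin n))) :
    upDia k x ≫ upDia k y = upDia k (y * x) := algDiagram_comp _ x y

theorem upPerm_eq (σ : Equiv.Perm (Fin n)) :
    upPerm k σ = upDia k (MonoidAlgebra.single σ 1) :=
  ((algDiagram_single (upStrand k) σ (1 : k)).trans (one_smul k _)).symm

theorem upDia_one : upDia k (1 : MonoidAlgebra k (Equiv.Perm (Fin n))) = 𝟙 _ :=
  map_one (algDiagram (upStrand k) k n)

theorem upDia_zero : upDia k (0 : MonoidAlgebra k (Equiv.Perm (Fin n))) = 0 :=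
  map_zero (algDiagram (upStrand k) k n)

theorem upDia_smul (c : k) (x : MonoidAlgebra k (Equiv.Perm (Fin n))) :
    upDia k (c • x) = c • upDia k x :=
  map_smul (algDiagram (upStrand k) k n) c x

theorem upDia_sum {ι : Type*} (s : Finset ι) (x : ι → MonoidAlgebra k (Equiv.Perm (Fin n))) :
    upDia k (∑ i ∈ s, x i) = ∑ i ∈ s, upDia k (x i) :=
  map_sum (algDiagram (upStrand k) k n) x s

theorem upDia_incl (x : MonoidAlgebra k (Equiv.Perm (Fin n))) :
    upDia k (incl k n x) = upDia k x ▷ up k := algDiagram_incl (upStrand k) x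

variable {B : Karoubi (Word k)} {f : pow (upStrand k) n ⟶ B.X} {g : B.X ⟶ pow (upStrand k) n}
  {z : MonoidAlgebra k (Equiv.Perm (Fin n))}

section Pairs

variable {e e' : MonoidAlgebra k (Equiv.Perm (Fin n))} {he : e * e = e} {he' : e' * e' = e'}
  {i : pow (upStrand k) n ⟶ B.X} {r : B.X ⟶ pow (upStrand k) n}
  {u v : MonoidAlgebra k (Equiv.Perm (Fin n))}

/-- Here `f` and `g` identify the idempotent of `B` with `z` in the group algebra. Inclusions and
projections that factor through them as `u` and `v` then compose by a product in the group algebra.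
-/
theorem upDia_between_comp (hz : f ≫ B.p ≫ g = upDia k z)
    (hi : upDia k e ≫ i ≫ B.p = upDia k u ≫ f ≫ B.p)
    (hr : B.p ≫ r ≫ upDia k e' = B.p ≫ g ≫ upDia k v) :
    upDia k e ≫ (i ≫ B.p ≫ r) ≫ upDia k e' = upDia k (v * z * u) := by
  have h1 : upDia k e ≫ (i ≫ B.p ≫ r) ≫ upDia k e' =
      (upDia k e ≫ i ≫ B.p) ≫ B.p ≫ r ≫ upDia k e' := by simp
  have h2 : (upDia k u ≫ f ≫ B.p) ≫ B.p ≫ g ≫ upDia k v =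
      upDia k u ≫ (f ≫ B.p ≫ g) ≫ upDia k v := by simp
  rw [h1, hi, hr, h2, hz, upDia_comp, upDia_comp]

theorem between_comp_eq_zero (hz : f ≫ B.p ≫ g = upDia k z)
    (hi : upDia k e ≫ i ≫ B.p = upDia k u ≫ f ≫ B.p)
    (hr : B.p ≫ r ≫ upDia k e' = B.p ≫ g ≫ upDia k v)
    (h0 : v * z * u = 0) :
    between (upOb e he) B i ≫ between B (upOb e' he') r = 0 := by
  refine (between_comp _ _).trans (between_eq_zero ((upDia_between_comp hz hi hr).trans ?_))
  exact (congrArg (upDia k) h0).trans upDia_zero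

end Pairs

theorem between_comp_eq_id (hz : f ≫ B.p ≫ g = upDia k z)
    {e : MonoidAlgebra k (Equiv.Perm (Fin n))} {he : e * e = e}
    {i : pow (upStrand k) n ⟶ B.X} {r : B.X ⟶ pow (upStrand k) n}
    {u v : MonoidAlgebra k (Equiv.Perm (Fin n))} (hi : upDia k e ≫ i ≫ B.p = upDia k u ≫ f ≫ B.p)
    (hr : B.p ≫ r ≫ upDia k e = B.p ≫ g ≫ upDia k v) (h1 : v * z * u = e) :
    between (upOb e he) B i ≫ between B (upOb e he) r = 𝟙 _ := by
  refine (between_comp _ _).trans (between_eq_id ((upDia_between_comp hz hi hr).trans ?_))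
  rw [h1]; rfl

/-- The hypothesis `hB` says that `g` and `f` split `B`, so `z` can be inserted next to them freely.
The sum of the composites becomes the image of the decomposition `h1` of `z`. -/
theorem sum_between_comp_eq_id (hz : f ≫ B.p ≫ g = upDia k z)
    (hB : B.p ≫ g ≫ f ≫ B.p = B.p) {ι : Type*} {s : Finset ι}
    {e : ι → MonoidAlgebra k (Equiv.Perm (Fin n))} {he : ∀ t, e t * e t = e t}
    {i : ι → (pow (upStrand k) n ⟶ B.X)} {r : ι → (B.X ⟶ pow (upStrand k) n)}
    {u v : ι → MonoidAlgebra k (Equiv.Perm (Fin n))}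
    (hi : ∀ t, upDia k (e t) ≫ i t ≫ B.p = upDia k (u t) ≫ f ≫ B.p)
    (hr : ∀ t, B.p ≫ r t ≫ upDia k (e t) = B.p ≫ g ≫ upDia k (v t))
    (h1 : z = ∑ t ∈ s, z * u t * (v t * z)) :
    ∑ t ∈ s, between B (upOb (e t) (he t)) (r t) ≫ between (upOb (e t) (he t)) B (i t) =
      𝟙 _ := by
  have hg : B.p ≫ g = B.p ≫ g ≫ upDia k z := by
    rw [← hz]
    conv_lhs => rw [← hB]
    simp only [Category.assoc]
  have hf : f ≫ B.p = upDia k z ≫ f ≫ B.p := by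
    rw [← hz]
    conv_lhs => rw [← hB]
    simp only [Category.assoc]
  have key : ∀ t, B.p ≫ (r t ≫ upDia k (e t) ≫ i t) ≫ B.p =
      B.p ≫ (g ≫ upDia k (z * u t * (v t * z)) ≫ f) ≫ B.p := by
    intro t
    have e1 : upDia k (e t) ≫ upDia k (e t) = upDia k (e t) := by rw [upDia_comp, he]
    calc B.p ≫ (r t ≫ upDia k (e t) ≫ i t) ≫ B.p
        = (B.p ≫ r t ≫ upDia k (e t)) ≫ upDia k (e t) ≫ i t ≫ B.p := by
          conv_lhs => rw [← e1]
          simp only [Category.assoc]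
      _ = (B.p ≫ g) ≫ upDia k (v t) ≫ upDia k (u t) ≫ f ≫ B.p := by
          rw [hr, hi]; simp only [Category.assoc]
      _ = (B.p ≫ g ≫ upDia k z) ≫ upDia k (v t) ≫ upDia k (u t) ≫ upDia k z ≫ f ≫ B.p := by
          rw [← hg, ← hf]
      _ = _ := by
          rw [← upDia_comp, ← upDia_comp, ← upDia_comp]
          simp only [Category.assoc]
  calc _ = ∑ t ∈ s, between B B (g ≫ upDia k (z * u t * (v t * z)) ≫ f) :=
        Finset.sum_congr rfl fun t _ =>
          (between_comp _ _).trans (between_congr (key t))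
    _ = between B B (g ≫ upDia k z ≫ f) := by
        rw [← between_sum]
        congr 1
        rw [← Preadditive.comp_sum, ← Preadditive.sum_comp, ← upDia_sum, ← h1]
    _ = 𝟙 _ := by
        refine between_eq_id ?_
        simp only [Category.assoc]
        rw [← hf, hB]

end Decomposition

end Heis


namespace Heis

open Limits Idempotents

/-! ### The decomposition of `P^λ P` -/

section AddBox

variable {k : Type*} [Field k] {n : ℕ}

theorem tens_P1_p {x : MonoidAlgebra k (Equiv.Perm (Fin n))} {hx : x * x = x} :
    (tens (upOb x hx) (P1 k)).p = upDia k (incl k n x) := by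
  rw [upDia_incl]
  exact tensorHom_id _ _

variable [CharZero k] (lam : YoungDiagram) (h : lam.card = n)

theorem PP_hz : 𝟙 (pow (upStrand k) (n + 1)) ≫ (tens (P k lam h) (P1 k)).p ≫
    𝟙 (pow (upStrand k) (n + 1)) = upDia k (incl k n (young lam h k)) :=
  (Category.id_comp _).trans ((Category.comp_id _).trans tens_P1_p)

theorem rowBox_comp_addPerm (s : addableRows lam) {Z : Word k}
    (w : pow (upStrand k) (n + 1) ⟶ Z) :
    upDia k (young (addBox lam s) (card_addBox lam s h) k) ≫
      (upDia k (rowBox k (addBox lam s) (card_addBox lam s h) s) ≫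
      upPerm k (addPerm lam h s)) ≫ w =
    upDia k (MonoidAlgebra.single (addPerm lam h s) 1 *
      young (addBox lam s) (card_addBox lam s h) k) ≫ 𝟙 (pow (upStrand k) (n + 1)) ≫ w := by
  rw [Category.id_comp, ← Category.assoc]
  congr 1
  rw [upPerm_eq, upDia_comp, upDia_comp, mul_assoc, rowBox_mul_young]

theorem PP_hi (s : addableRows lam) :
    upDia k (young (addBox lam s) (card_addBox lam s h) k) ≫
      (upDia k (rowBox k (addBox lam s) (card_addBox lam s h) s) ≫
      upPerm k (addPerm lam h s)) ≫ (tens (P k lam h) (P1 k)).p =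
    upDia k (MonoidAlgebra.single (addPerm lam h s) 1 *
      young (addBox lam s) (card_addBox lam s h) k) ≫
      𝟙 (pow (upStrand k) (n + 1)) ≫ (tens (P k lam h) (P1 k)).p :=
  rowBox_comp_addPerm lam h s (tens (P k lam h) (P1 k)).p

theorem incl_young_comp_rowBox (s : ℕ) (σ : Equiv.Perm (Fin (n + 1)))
    (x : MonoidAlgebra k (Equiv.Perm (Fin (n + 1)))) :
    upDia k (incl k n (young lam h k)) ≫ (upDia k (incl k n (rowBox k lam h s)) ≫
      upPerm k σ) ≫ upDia k x =
    upDia k (incl k n (young lam h k)) ≫ 𝟙 (pow (upStrand k) (n + 1)) ≫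
      upDia k (x * MonoidAlgebra.single σ 1) := by
  rw [Category.id_comp, upPerm_eq]
  simp only [upDia_comp, ← map_mul, mul_assoc, rowBox_mul_young]

theorem PP_hr (s : addableRows lam) :
    (tens (P k lam h) (P1 k)).p ≫ (upDia k (rowBox k lam h s) ▷ up k ≫
      upPerm k (addPerm lam h s)⁻¹) ≫ upDia k (young (addBox lam s) (card_addBox lam s h) k) =
    (tens (P k lam h) (P1 k)).p ≫ 𝟙 (pow (upStrand k) (n + 1)) ≫
      upDia k (young (addBox lam s) (card_addBox lam s h) k *
        MonoidAlgebra.single (addPerm lam h s)⁻¹ 1) := by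
  have hp : (tens (P k lam h) (P1 k)).p = upDia k (incl k n (young lam h k)) := tens_P1_p
  rw [hp, ← upDia_incl]
  exact incl_young_comp_rowBox lam h s _ _

theorem PP_iota_comp_rho (s : addableRows lam) : PP.iota k lam h s ≫ PP.rho k lam h s = 𝟙 _ := by
  refine between_comp_eq_id (PP_hz lam h) (PP_hi lam h s) (PP_hr lam h s) ?_
  have := young_mul_conj_mul_young (k := k) h (card_addBox lam s h) (newBox_mem lam s)
    (cells_addBox lam s)
  simp only [mul_assoc] at this ⊢
  exact this

theorem PP_iota_comp_rho_of_ne {s t : addableRows lam} (hst : s ≠ t) :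
    PP.iota k lam h s ≫ PP.rho k lam h t = 0 := by
  refine between_comp_eq_zero (PP_hz lam h) (PP_hi lam h s) (PP_hr lam h t) ?_
  have := young_mul_mul_young_of_ne (k := k) (fun e => hst (addBox_injective lam e).symm)
    (h := card_addBox lam t h) (h' := card_addBox lam s h)
    (MonoidAlgebra.single (addPerm lam h t)⁻¹ 1 *
     incl k n (young lam h k) * MonoidAlgebra.single (addPerm lam h s) 1)
  simp only [mul_assoc] at this ⊢
  exact this

theorem PP_sum : ∑ s : addableRows lam, PP.rho k lam h s ≫ PP.iota k lam h s = 𝟙 _ := by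
  refine sum_between_comp_eq_id (PP_hz lam h) ?_ (PP_hi lam h) (PP_hr lam h) ?_
  · refine (congrArg (fun f => _ ≫ f) ((Category.id_comp _).trans (Category.id_comp _))).trans
      (tens (P k lam h) (P1 k)).idem
  · refine (incl_young_eq_sum lam h).trans (Finset.sum_congr rfl fun s _ => ?_)
    simp only [mul_assoc]

end AddBox

end Heis


namespace Heis

open Limits Idempotents

/-! ### Block transpositions and thick crossings -/

section Push

variable {k : Type*} [Field k]

theorem viaEmbeddingHom_trans {l n N : ℕ} (κ : Fin l ↪ Fin n) (ι : Fin n ↪ Fin N)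
    (σ : Equiv.Perm (Fin l)) :
    Equiv.Perm.viaEmbeddingHom ι (Equiv.Perm.viaEmbeddingHom κ σ) =
      Equiv.Perm.viaEmbeddingHom (κ.trans ι) σ := by
  ext x
  congr 1
  by_cases hx : x ∈ Set.range ι
  · obtain ⟨y, rfl⟩ := hx
    rw [viaEmbeddingHom_apply_apply]
    by_cases hy : y ∈ Set.range κ
    · obtain ⟨y, rfl⟩ := hy
      rw [viaEmbeddingHom_apply_apply]
      exact (viaEmbeddingHom_apply_apply (κ.trans ι) σ y).symm
    · rw [viaEmbeddingHom_apply_of_notMem _ _ hy, viaEmbeddingHom_apply_of_notMem]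
      rintro ⟨z, hz⟩
      exact hy ⟨z, ι.injective hz⟩
  · rw [viaEmbeddingHom_apply_of_notMem _ _ hx, viaEmbeddingHom_apply_of_notMem]
    rintro ⟨z, hz⟩
    exact hx ⟨κ z, hz⟩

theorem push_push {l n N : ℕ} (κ : Fin l ↪ Fin n) (ι : Fin n ↪ Fin N)
    (x : MonoidAlgebra k (Equiv.Perm (Fin l))) :
    push k ι (push k κ x) = push k (κ.trans ι) x := by
  induction x using MonoidAlgebra.induction_linear with
  | zero => simp only [map_zero]
  | add a b ha hb => simp only [map_add, ha, hb]
  | single σ r => simp only [push_single, viaEmbeddingHom_trans]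

theorem single_mul_push {n N : ℕ} (ι : Fin n ↪ Fin N) (π : Equiv.Perm (Fin N))
    (x : MonoidAlgebra k (Equiv.Perm (Fin n))) :
    MonoidAlgebra.single π 1 * push k ι x =
      push k (ι.trans π.toEmbedding) x * MonoidAlgebra.single π 1 := by
  induction x using MonoidAlgebra.induction_linear with
  | zero => simp only [map_zero, mul_zero, zero_mul]
  | add a b ha hb => simp only [map_add, mul_add, add_mul, ha, hb]
  | single σ r =>
    rw [push_single, push_single, MonoidAlgebra.single_mul_single, MonoidAlgebra.single_mul_single,
      one_mul, mul_one]
    congr 1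
    ext x
    congr 1
    rw [Equiv.Perm.mul_apply, Equiv.Perm.mul_apply]
    by_cases hx : x ∈ Set.range ι
    · obtain ⟨y, rfl⟩ := hx
      rw [viaEmbeddingHom_apply_apply]
      exact (viaEmbeddingHom_apply_apply (ι.trans π.toEmbedding) σ y).symm
    · rw [viaEmbeddingHom_apply_of_notMem _ _ hx, viaEmbeddingHom_apply_of_notMem]
      rintro ⟨y, hy⟩
      exact hx ⟨y, π.injective hy⟩

theorem castAddEmb_trans_blockSwap (m n : ℕ) :
    (Fin.castAddEmb n : Fin m ↪ Fin (m + n)).trans (blockSwap m n).toEmbedding =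
      (Fin.natAddEmb n).trans (finCongr (Nat.add_comm n m)).toEmbedding := by
  ext i
  simp [blockSwap]

theorem natAddEmb_trans_blockSwap (m n : ℕ) :
    (Fin.natAddEmb m : Fin n ↪ Fin (m + n)).trans (blockSwap m n).toEmbedding =
      (Fin.castAddEmb m).trans (finCongr (Nat.add_comm n m)).toEmbedding := by
  ext i
  simp [blockSwap]

/-- Conjugation by the block transposition exchanges the two block embeddings. The cast appears
because the exchanged blocks live on `n + m` points. -/
theorem single_blockSwap_mul_blockMul {m n : ℕ} (x : MonoidAlgebra k (Equiv.Perm (Fin m)))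
    (y : MonoidAlgebra k (Equiv.Perm (Fin n))) :
    MonoidAlgebra.single (blockSwap m n) 1 * blockMul x y =
      push k (finCongr (Nat.add_comm n m)).toEmbedding (blockMul y x) *
        MonoidAlgebra.single (blockSwap m n) 1 := by
  rw [blockMul, blockMul, push_castAdd_mul_push_natAdd, push_castAdd_mul_push_natAdd, map_mul,
    ← mul_assoc, single_mul_push,
    mul_assoc, single_mul_push, ← mul_assoc, push_push, push_push, castAddEmb_trans_blockSwap,
    natAddEmb_trans_blockSwap, ← push_push, ← push_push, ← map_mul, ← map_mul,
    push_castAdd_mul_push_natAdd]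

theorem finCongr_blockSwap_mul_blockSwap (m n : ℕ) :
    Equiv.Perm.viaEmbeddingHom (finCongr (Nat.add_comm n m)).toEmbedding (blockSwap n m) *
      blockSwap m n = 1 := by
  ext x
  congr 1
  have h := viaEmbeddingHom_apply_apply (finCongr (Nat.add_comm n m)).toEmbedding (blockSwap n m)
    ((finCongr (Nat.add_comm m n)) (blockSwap m n x))
  rw [Equiv.Perm.mul_apply, Equiv.Perm.one_apply]
  refine Eq.trans h ?_
  induction x using Fin.addCases <;> ext <;> simp [blockSwap]

end Push

section Cross

variable {C : Type*} [Category C] [MonoidalCategory C] (S : SymStrand C)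

theorem castIso_inv {n N : ℕ} (h : n = N) : (castIso S h).inv = (castIso S h.symm).hom := rfl

variable {k : Type*} [Field k] [Preadditive C] [Linear k C]

/-- Once the numbers of strands are identified, the cast is the identity on both sides. Its purpose
is to move relabellings between `m + n` and `n + m` into the group algebra. -/
theorem algDiagram_cast {n N : ℕ} (h : n = N) (x : MonoidAlgebra k (Equiv.Perm (Fin n))) :
    (castIso S h).inv ≫ algDiagram S k n x ≫ (castIso S h).hom =
      algDiagram S k N (push k (finCongr h).toEmbedding x) := by
  subst h
  have : push k (finCongr rfl).toEmbedding x = x := by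
    induction x using MonoidAlgebra.induction_linear with
    | zero => simp only [map_zero]
    | add a b ha hb => rw [map_add, ha, hb]
    | single σ r =>
      rw [push_single]
      congr 1
      ext i
      exact congrArg Fin.val (viaEmbeddingHom_apply_apply (finCongr rfl).toEmbedding σ i)
  rw [this]
  simp [castIso]

end Cross

section ThickCross

variable {k : Type*} [Field k]

theorem splitIso_inv_comp_upDia {m n : ℕ} (x : MonoidAlgebra k (Equiv.Perm (Fin m)))
    (y : MonoidAlgebra k (Equiv.Perm (Fin n))) :
    (splitIso (upStrand k) m n).inv ≫ upDia k (blockMul x y) =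
      (upDia k x ⊗ₘ upDia k y) ≫ (splitIso (upStrand k) m n).inv := by
  rw [Iso.inv_comp_eq]
  exact algDiagram_blockMul (upStrand k) x y

theorem upDia_comp_splitIso {m n : ℕ} (x : MonoidAlgebra k (Equiv.Perm (Fin m)))
    (y : MonoidAlgebra k (Equiv.Perm (Fin n))) :
    upDia k (blockMul x y) ≫ (splitIso (upStrand k) m n).hom =
      (splitIso (upStrand k) m n).hom ≫ (upDia k x ⊗ₘ upDia k y) := by
  rw [← Iso.inv_comp_eq, ← Category.assoc, splitIso_inv_comp_upDia, Category.assoc,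
    Iso.inv_hom_id, Category.comp_id]

theorem castIso_hom_comp_upDia {n N : ℕ} (h : n = N) (x : MonoidAlgebra k (Equiv.Perm (Fin N))) :
    (castIso (upStrand k) h).hom ≫ upDia k x =
      upDia k (push k (finCongr h.symm).toEmbedding x) ≫ (castIso (upStrand k) h).hom := by
  rw [← Iso.comp_inv_eq, Category.assoc]
  exact algDiagram_cast (upStrand k) h.symm x

theorem tensorHom_comp_thickCross {m n : ℕ} (x : MonoidAlgebra k (Equiv.Perm (Fin m)))
    (y : MonoidAlgebra k (Equiv.Perm (Fin n))) :
    (upDia k x ⊗ₘ upDia k y) ≫ thickCross k m n =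
      thickCross k m n ≫ (upDia k y ⊗ₘ upDia k x) := by
  rw [thickCross, ← Category.assoc, ← splitIso_inv_comp_upDia]
  simp only [Category.assoc]
  rw [← upDia_comp_splitIso, ← Category.assoc (castIso _ _).hom, castIso_hom_comp_upDia, upPerm_eq]
  congr 1
  simp only [← Category.assoc]
  congr 2
  rw [upDia_comp, upDia_comp, single_blockSwap_mul_blockMul]

/-- The two block transpositions are inverse to each other in the symmetric group, after the
relabelling of the points. -/
theorem thickCross_comp_thickCross (m n : ℕ) : thickCross k m n ≫ thickCross k n m = 𝟙 _ := by
  rw [thickCross, thickCross]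
  simp only [Category.assoc, Iso.hom_inv_id_assoc]
  rw [upPerm_eq, upPerm_eq, ← Category.assoc (castIso _ _).hom, castIso_hom_comp_upDia,
    push_single, ← castIso_inv (upStrand k) (Nat.add_comm m n)]
  simp only [Category.assoc, Iso.hom_inv_id_assoc]
  rw [← Category.assoc (upDia k _), upDia_comp, MonoidAlgebra.single_mul_single,
    finCongr_blockSwap_mul_blockSwap, mul_one, ← MonoidAlgebra.one_def, upDia_one,
    Category.id_comp, Iso.inv_hom_id]

end ThickCross

end Heis


namespace Heis

open Limits Idempotents

/-! ### The decomposition of `P^{(n)} P^{(m)^t}` -/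

section Hook

variable {k : Type*} [Field k]

theorem split_hz {m n : ℕ} {x : MonoidAlgebra k (Equiv.Perm (Fin m))} (hx : x * x = x)
    {y : MonoidAlgebra k (Equiv.Perm (Fin n))} (hy : y * y = y) :
    (splitIso (upStrand k) m n).hom ≫ (tens (upOb x hx) (upOb y hy)).p ≫
      (splitIso (upStrand k) m n).inv = upDia k (blockMul x y) :=
  (algDiagram_blockMul (upStrand k) x y).symm

theorem split_hB {m n : ℕ} {x : MonoidAlgebra k (Equiv.Perm (Fin m))} (hx : x * x = x)
    {y : MonoidAlgebra k (Equiv.Perm (Fin n))} (hy : y * y = y) :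
    (tens (upOb x hx) (upOb y hy)).p ≫ (splitIso (upStrand k) m n).inv ≫
      (splitIso (upStrand k) m n).hom ≫ (tens (upOb x hx) (upOb y hy)).p =
      (tens (upOb x hx) (upOb y hy)).p :=
  (congrArg (fun f => (tens (upOb x hx) (upOb y hy)).p ≫ f)
    (Iso.inv_hom_id_assoc (splitIso (upStrand k) m n) (tens (upOb x hx) (upOb y hy)).p)).trans
    (tens (upOb x hx) (upOb y hy)).idem

theorem upDia_comp_smul {N : ℕ} (c : k) (x : MonoidAlgebra k (Equiv.Perm (Fin N))) {Y Z : Word k}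
    (f : pow (upStrand k) N ⟶ Y) (p : Y ⟶ Z) :
    upDia k x ≫ (c • f) ≫ p = upDia k (c • x) ≫ f ≫ p := by
  rw [upDia_smul, Linear.smul_comp, Linear.smul_comp, Linear.comp_smul]

variable [CharZero k]

theorem hook_relations (n m : ℕ) (hn : 1 ≤ n) (hm : 1 < m) :
    Hook.iotaTop k n m hn ≫ Hook.rhoTop k n m hn = 𝟙 _ ∧
    Hook.iotaLow k n m hm ≫ Hook.rhoLow k n m hm = 𝟙 _ ∧
    Hook.iotaLow k n m hm ≫ Hook.rhoTop k n m hn = 0 ∧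
    Hook.iotaTop k n m hn ≫ Hook.rhoLow k n m hm = 0 ∧
    Hook.rhoTop k n m hn ≫ Hook.iotaTop k n m hn +
      Hook.rhoLow k n m hm ≫ Hook.iotaLow k n m hm = 𝟙 _ := by
  have hm0 : (m : k) ≠ 0 := by exact_mod_cast (by omega : m ≠ 0)
  have hz := split_hz (k := k) (m := n) (n := m) (box_mul_box (G := ⊤) 1)
    (box_mul_box (G := ⊤) Equiv.Perm.sign)
  have hne : hook n m hn ≠ hook (n + 1) (m - 1) (Nat.le_add_left 1 n) :=
    hook_ne_hook (by omega)
  refine ⟨?_, ?_, ?_, ?_, ?_⟩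
  · refine between_comp_eq_id hz rfl rfl ?_
    exact young_hook_top (card_hook n m hn)
  · refine between_comp_eq_id hz (upDia_comp_smul (m : k) _ _ _) rfl ?_
    rw [mul_smul_comm, young_hook_low hn hm (Hook.card_low n m hm), smul_smul,
      mul_inv_cancel₀ hm0, one_smul]
  · refine between_comp_eq_zero hz (upDia_comp_smul (m : k) _ _ _) rfl ?_
    rw [mul_smul_comm, young_mul_mul_young_of_ne hne, smul_zero]
  · refine between_comp_eq_zero hz rfl rfl ?_
    exact young_mul_mul_young_of_ne hne.symm _
  · have := sum_between_comp_eq_id (s := Finset.univ) hz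
      (split_hB (box_mul_box 1) (box_mul_box Equiv.Perm.sign))
      (e := fun b : Bool => bif b then young (hook n m hn) (card_hook n m hn) k else
        young (hook (n + 1) (m - 1) (Nat.le_add_left 1 n)) (Hook.card_low n m hm) k)
      (he := by rintro (_ | _) <;> exact young_mul_young _ _ k)
      (i := fun b => bif b then (splitIso (upStrand k) n m).hom else
        (m : k) • (splitIso (upStrand k) n m).hom)
      (r := fun _ => (splitIso (upStrand k) n m).inv)
      (u := fun b => bif b then young (hook n m hn) (card_hook n m hn) k else
        (m : k) • young (hook (n + 1) (m - 1) (Nat.le_add_left 1 n)) (Hook.card_low n m hm) k)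
      (v := fun b => bif b then young (hook n m hn) (card_hook n m hn) k else
        young (hook (n + 1) (m - 1) (Nat.le_add_left 1 n)) (Hook.card_low n m hm) k)
      (by
        rintro (_ | _)
        · exact upDia_comp_smul (m : k) _ _ _
        · rfl)
      (by rintro (_ | _) <;> rfl)
      (by
        refine (blockMul_sym_anti_eq k hn hm (card_hook n m hn) (Hook.card_low n m hm)).trans ?_
        rw [Fintype.sum_bool]
        simp only [cond_true, cond_false, mul_smul_comm, smul_mul_assoc])
    rw [Fintype.sum_bool] at this
    exact this

end Hook

/-! ### The decomposition of `P^{(m)} P^{(n)}` -/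

section TwoRow

variable {k : Type*} [Field k] [CharZero k]

/-- The case `m < n`: the thick crossing `x` is invertible and intertwines the symmetrizers `p` and
`q`. Crossing into the other order, symmetrizing and returning therefore leaves just the symmetrizer
`p` of the larger block first. -/
theorem conj_cross {D : Type*} [Category D] {V W Y Z : D} (r : V ≅ W) (s : W ≅ Y) {p : Y ⟶ Y}
    (hp : p ≫ p = p) {x : Y ⟶ Z} {x' : Z ⟶ Y} {q : Z ⟶ Z} (hq : q ≫ q = q) (hpx : p ≫ x = x ≫ q)
    (hx : x ≫ x' = 𝟙 _) (hx' : x' ≫ x = 𝟙 _) :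
    (r.hom ≫ s.hom ≫ p ≫ x) ≫ q ≫ x' ≫ p ≫ s.inv ≫ r.inv = r.hom ≫ (s.hom ≫ p ≫ s.inv) ≫ r.inv ∧
      q ≫ (x' ≫ p ≫ s.inv ≫ r.inv) ≫ (r.hom ≫ s.hom ≫ p ≫ x) ≫ q = q := by
  constructor
  · have : (r.hom ≫ s.hom ≫ p ≫ x) ≫ q ≫ x' ≫ p ≫ s.inv ≫ r.inv =
        r.hom ≫ s.hom ≫ p ≫ (x ≫ q) ≫ x' ≫ p ≫ s.inv ≫ r.inv := by simp only [Category.assoc]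
    rw [this, ← hpx]
    simp only [Category.assoc]
    rw [reassoc_of% hp, reassoc_of% hx, reassoc_of% hp]
  · simp only [Category.assoc, Iso.inv_hom_id_assoc]
    rw [reassoc_of% hp, reassoc_of% hpx, hq, reassoc_of% hx', hq]

/-- The numbers `M` and `N` are kept as variables, so that the decomposition for blocks of sizes `a
≥ b` can be used on `m + n` strands in either order. -/
theorem exists_twoRow {a b M N : ℕ} (hba : b ≤ a) (hM : M = b) (hN : N = a + b)
    (hs : ∀ s : Fin (M + 1), s.1 ≤ N - s.1)
    (h : ∀ s : Fin (M + 1), (twoRow (N - s) s (hs s)).card = N) :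
    ∃ z : MonoidAlgebra k (Equiv.Perm (Fin N)),
      (castIso (upStrand k) hN).hom ≫ upDia k (blockMul (symBox k ⊤) (symBox k ⊤)) ≫
        (castIso (upStrand k) hN).inv = upDia k z ∧
      (∀ s, young _ (h s) k * z * young _ (h s) k = ((M.choose s : ℕ) : k)⁻¹ • young _ (h s) k) ∧
      z = ∑ s : Fin (M + 1), z * ((M.choose s : k) • young _ (h s) k) * (young _ (h s) k * z) := by
  subst hM hN
  refine ⟨blockMul (symBox k ⊤) (symBox k ⊤), ?_, fun s =>
    young_twoRow (Nat.lt_succ_iff.1 s.2) hba (hs s) (h s), ?_⟩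
  · simp [castIso]
  · refine (blockMul_sym_sym_eq k hba hs h).trans (Finset.sum_congr rfl fun s _ => ?_)
    rw [mul_smul_comm, smul_mul_assoc]

theorem exists_twoRow_dia (m n : ℕ) : ∃ z : MonoidAlgebra k (Equiv.Perm (Fin (m + n))),
    TwoRow.splitDia k m n ≫ (tens (Psym k m) (Psym k n)).p ≫ TwoRow.mergeDia k m n = upDia k z ∧
    (tens (Psym k m) (Psym k n)).p ≫ TwoRow.mergeDia k m n ≫ TwoRow.splitDia k m n ≫
      (tens (Psym k m) (Psym k n)).p = (tens (Psym k m) (Psym k n)).p ∧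
    (∀ s, young _ (TwoRow.card_shape m n s) k * z * young _ (TwoRow.card_shape m n s) k =
      (((min m n).choose s : ℕ) : k)⁻¹ • young _ (TwoRow.card_shape m n s) k) ∧
    z = ∑ s : Fin (min m n + 1),
        z * (((min m n).choose s : k) • young _ (TwoRow.card_shape m n s) k) *
      (young _ (TwoRow.card_shape m n s) k * z) := by
  by_cases hmn : m < n
  · obtain ⟨z, h1, h2, h3⟩ := exists_twoRow (k := k) hmn.le (min_eq_left hmn.le) (Nat.add_comm m n)
      (fun s => by have := s.2; omega) (TwoRow.card_shape m n)
    have hcross := conj_cross (castIso (upStrand k) (Nat.add_comm m n)) (splitIso (upStrand k) n m)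
      (tens (Psym k n) (Psym k m)).idem (tens (Psym k m) (Psym k n)).idem
      (tensorHom_comp_thickCross (symBox k ⊤) (symBox k ⊤)) (thickCross_comp_thickCross n m)
      (thickCross_comp_thickCross m n)
    refine ⟨z, ?_, ?_, h2, h3⟩
    · rw [← h1, TwoRow.splitDia, TwoRow.mergeDia, if_pos hmn, if_pos hmn]
      exact hcross.1.trans (congrArg (fun f => _ ≫ f ≫ _)
        (split_hz (box_mul_box (G := ⊤) 1) (box_mul_box (G := ⊤) 1)))
    · rw [TwoRow.splitDia, TwoRow.mergeDia, if_pos hmn, if_pos hmn]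
      exact hcross.2
  · obtain ⟨z, h1, h2, h3⟩ := exists_twoRow (k := k) (not_lt.1 hmn)
      (min_eq_right (not_lt.1 hmn)) rfl
      (fun s => by have := s.2; omega) (TwoRow.card_shape m n)
    refine ⟨z, ?_, ?_, h2, h3⟩
    · rw [← h1, TwoRow.splitDia, TwoRow.mergeDia, if_neg hmn, if_neg hmn]
      refine (split_hz (box_mul_box 1) (box_mul_box 1)).trans ?_
      simp [castIso]
    · rw [TwoRow.splitDia, TwoRow.mergeDia, if_neg hmn, if_neg hmn]
      exact split_hB (box_mul_box 1) (box_mul_box 1)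

theorem twoRow_relations (m n : ℕ) :
    (∀ s t : Fin (min m n + 1), s ≠ t → TwoRow.iota k m n s ≫ TwoRow.rho k m n t = 0) ∧
    (∀ s : Fin (min m n + 1), TwoRow.iota k m n s ≫ TwoRow.rho k m n s = 𝟙 _) ∧
    ∑ s : Fin (min m n + 1), TwoRow.rho k m n s ≫ TwoRow.iota k m n s = 𝟙 _ := by
  obtain ⟨z, hz, hB, he, hsum⟩ := exists_twoRow_dia (k := k) m n
  refine ⟨fun s t hst => ?_, fun s => ?_, ?_⟩
  · refine between_comp_eq_zero hz (upDia_comp_smul _ _ _ _) rfl ?_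
    rw [mul_smul_comm, young_mul_mul_young_of_ne, smul_zero]
    exact twoRow_ne_twoRow (fun e => hst (Fin.ext e.symm))
  · refine between_comp_eq_id hz (upDia_comp_smul _ _ _ _) rfl ?_
    have h0 : (((min m n).choose s : ℕ) : k) ≠ 0 := by
      exact_mod_cast (Nat.choose_pos (Nat.lt_succ_iff.1 s.2)).ne'
    rw [mul_smul_comm, he, smul_smul, mul_inv_cancel₀ h0, one_smul]
  · exact sum_between_comp_eq_id (s := Finset.univ) hz hB
      (fun s => upDia_comp_smul _ _ _ _) (fun s => rfl) hsum

end TwoRow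

end Heis


namespace Heis

/-! ### Local diagrams to the right of an arbitrary object -/

section Strands

variable {C : Type*} [Category C] [MonoidalCategory C]

/-- A diagram with two strands at the bottom and at the top, to the right of `Y`. -/
def crossOn (Y : C) {A B A' B' : C} (f : A ⊗ B ⟶ A' ⊗ B') : (Y ⊗ A) ⊗ B ⟶ (Y ⊗ A') ⊗ B' :=
  (α_ Y A B).hom ≫ Y ◁ f ≫ (α_ Y A' B').inv

/-- A cap to the right of `Y`. -/
def capOn (Y : C) {A B : C} (f : A ⊗ B ⟶ 𝟙_ C) : (Y ⊗ A) ⊗ B ⟶ Y :=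
  (α_ Y A B).hom ≫ Y ◁ f ≫ (ρ_ Y).hom

/-- A cup to the right of `Y`. -/
def cupOn (Y : C) {A B : C} (f : 𝟙_ C ⟶ A ⊗ B) : Y ⟶ (Y ⊗ A) ⊗ B :=
  (ρ_ Y).inv ≫ Y ◁ f ≫ (α_ Y A B).inv

/-- Diagrams on disjoint strands commute. With diagrams placed to the right of `Y`, isotopies become
rewriting by such naturality rules, and associators stay hidden in the definitions. -/
theorem crossOn_naturality {Y Z : C} (g : Y ⟶ Z) {A B A' B' : C} (f : A ⊗ B ⟶ A' ⊗ B') :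
    (g ▷ A) ▷ B ≫ crossOn Z f = crossOn Y f ≫ (g ▷ A') ▷ B' := by
  rw [crossOn, crossOn, associator_naturality_left_assoc, ← whisker_exchange_assoc,
    associator_inv_naturality_left, Category.assoc, Category.assoc]

theorem crossOn_naturality_assoc {Y Z : C} (g : Y ⟶ Z) {A B A' B' : C}
    (f : A ⊗ B ⟶ A' ⊗ B') {W : C} (w : (Z ⊗ A') ⊗ B' ⟶ W) :
    (g ▷ A) ▷ B ≫ crossOn Z f ≫ w = crossOn Y f ≫ (g ▷ A') ▷ B' ≫ w := by
  rw [← Category.assoc, crossOn_naturality, Category.assoc]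

theorem capOn_naturality {Y Z : C} (g : Y ⟶ Z) {A B : C} (f : A ⊗ B ⟶ 𝟙_ C) :
    (g ▷ A) ▷ B ≫ capOn Z f = capOn Y f ≫ g := by
  rw [capOn, capOn, associator_naturality_left_assoc, ← whisker_exchange_assoc,
    rightUnitor_naturality, Category.assoc, Category.assoc]

theorem capOn_naturality_assoc {Y Z : C} (g : Y ⟶ Z) {A B : C} (f : A ⊗ B ⟶ 𝟙_ C) {W : C}
    (w : Z ⟶ W) : (g ▷ A) ▷ B ≫ capOn Z f ≫ w = capOn Y f ≫ g ≫ w := by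
  rw [← Category.assoc, capOn_naturality, Category.assoc]

theorem cupOn_naturality {Y Z : C} (g : Y ⟶ Z) {A B : C} (f : 𝟙_ C ⟶ A ⊗ B) :
    g ≫ cupOn Z f = cupOn Y f ≫ (g ▷ A) ▷ B := by
  rw [cupOn, cupOn, rightUnitor_inv_naturality_assoc, ← whisker_exchange_assoc,
    associator_inv_naturality_left, Category.assoc, Category.assoc]

theorem cupOn_naturality_assoc {Y Z : C} (g : Y ⟶ Z) {A B : C} (f : 𝟙_ C ⟶ A ⊗ B) {W : C}
    (w : (Z ⊗ A) ⊗ B ⟶ W) : g ≫ cupOn Z f ≫ w = cupOn Y f ≫ (g ▷ A) ▷ B ≫ w := by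
  rw [← Category.assoc, cupOn_naturality, Category.assoc]

/-- Apply a diagram to the two middle factors. -/
def midOn (a d : C) {b c b' c' : C} (f : b ⊗ c ⟶ b' ⊗ c') :
    (a ⊗ b) ⊗ (c ⊗ d) ⟶ (a ⊗ b') ⊗ (c' ⊗ d) :=
  (α_ a b (c ⊗ d)).hom ≫ a ◁ ((α_ b c d).inv ≫ f ▷ d ≫ (α_ b' c' d).hom) ≫
    (α_ a b' (c' ⊗ d)).inv

variable {U D : C}

/-- Rotate a diagram by bending its bottom left strand to the top and its top right strand to the
bottom. -/
def rotateL (η : 𝟙_ C ⟶ D ⊗ U) (ε : U ⊗ D ⟶ 𝟙_ C) {c c' : C} (f : U ⊗ c ⟶ c' ⊗ U) :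
    c ⊗ D ⟶ D ⊗ c' :=
  (λ_ (c ⊗ D)).inv ≫ η ▷ (c ⊗ D) ≫ midOn D D f ≫ (D ⊗ c') ◁ ε ≫ (ρ_ (D ⊗ c')).hom

/-- Rotate a diagram by bending its bottom right strand to the top and its top left strand to the
bottom. -/
def rotateR (η : 𝟙_ C ⟶ U ⊗ D) (ε : D ⊗ U ⟶ 𝟙_ C) {c c' : C} (f : c ⊗ U ⟶ U ⊗ c') :
    D ⊗ c ⟶ c' ⊗ D :=
  (ρ_ (D ⊗ c)).inv ≫ (D ⊗ c) ◁ η ≫ midOn D D f ≫ ε ▷ (c' ⊗ D) ≫ (λ_ (c' ⊗ D)).hom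

theorem crossOn_rotateL (Y : C) (η : 𝟙_ C ⟶ D ⊗ U) (ε : U ⊗ D ⟶ 𝟙_ C) {c c' : C}
    (f : U ⊗ c ⟶ c' ⊗ U) : crossOn Y (rotateL η ε f) =
      (cupOn Y η ▷ c) ▷ D ≫ crossOn (Y ⊗ D) f ▷ D ≫ capOn ((Y ⊗ D) ⊗ c') ε := by
  simp only [crossOn, rotateL, cupOn, capOn, midOn]
  monoidal

theorem crossOn_rotateR (Y : C) (η : 𝟙_ C ⟶ U ⊗ D) (ε : D ⊗ U ⟶ 𝟙_ C) {c c' : C}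
    (f : c ⊗ U ⟶ U ⊗ c') : crossOn Y (rotateR η ε f) =
      cupOn ((Y ⊗ D) ⊗ c) η ≫ crossOn (Y ⊗ D) f ▷ D ≫ (capOn Y ε ▷ c') ▷ D := by
  simp only [crossOn, rotateR, cupOn, capOn, midOn]
  monoidal

theorem zigzag_left_on {A B : C} {η : 𝟙_ C ⟶ A ⊗ B} {ε : B ⊗ A ⟶ 𝟙_ C}
    (h : (λ_ A).inv ≫ η ▷ A ≫ (α_ A B A).hom ≫ A ◁ ε ≫ (ρ_ A).hom = 𝟙 A) (Y : C) :
    cupOn Y η ▷ A ≫ capOn (Y ⊗ A) ε = 𝟙 _ := by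
  have h1 : cupOn Y η ▷ A ≫ capOn (Y ⊗ A) ε =
      Y ◁ ((λ_ A).inv ≫ η ▷ A ≫ (α_ A B A).hom ≫ A ◁ ε ≫ (ρ_ A).hom) := by
    simp only [cupOn, capOn]
    monoidal
  rw [h1, h, MonoidalCategory.whiskerLeft_id]

theorem zigzag_right_on {A B : C} {η : 𝟙_ C ⟶ B ⊗ A} {ε : A ⊗ B ⟶ 𝟙_ C}
    (h : (ρ_ A).inv ≫ A ◁ η ≫ (α_ A B A).inv ≫ ε ▷ A ≫ (λ_ A).hom = 𝟙 A) (Y : C) :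
    cupOn (Y ⊗ A) η ≫ capOn Y ε ▷ A = 𝟙 _ := by
  have h1 : cupOn (Y ⊗ A) η ≫ capOn Y ε ▷ A =
      Y ◁ ((ρ_ A).inv ≫ A ◁ η ≫ (α_ A B A).inv ≫ ε ▷ A ≫ (λ_ A).hom) := by
    simp only [cupOn, capOn]
    monoidal
  rw [h1, h, MonoidalCategory.whiskerLeft_id]

end Strands

/-! ### Upward and downward strands -/

/-- An upward strand `U` and a downward strand `D` with their crossings, cups and caps, in terms of
diagrams to the right of an arbitrary object. -/
structure Strands (C : Type*) [Category C] [MonoidalCategory C] [Preadditive C] where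
  U : C
  S : SymStrand C
  qp : S.X ⊗ U ⟶ U ⊗ S.X
  pq : U ⊗ S.X ⟶ S.X ⊗ U
  cap : S.X ⊗ U ⟶ 𝟙_ C
  cup : 𝟙_ C ⟶ S.X ⊗ U
  qp_pq (Y : C) : crossOn Y qp ≫ crossOn Y pq = 𝟙 _ - capOn Y cap ≫ cupOn Y cup
  pq_qp (Y : C) : crossOn Y pq ≫ crossOn Y qp = 𝟙 _
  cup_cap (Y : C) : cupOn Y cup ≫ capOn Y cap = 𝟙 _
  pq_cap (Y : C) : crossOn Y pq ≫ capOn Y cap = 0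
  cup_qp (Y : C) : cupOn Y cup ≫ crossOn Y qp = 0
  cross_cap (Y : C) : crossOn Y S.c ▷ U ≫ capOn (Y ⊗ S.X) cap =
    crossOn (Y ⊗ S.X) qp ≫ capOn Y cap ▷ S.X
  cup_cross (Y : C) : cupOn (Y ⊗ S.X) cup ≫ crossOn Y S.c ▷ U =
    cupOn Y cup ▷ S.X ≫ crossOn (Y ⊗ S.X) pq
  cross_qp (Y : C) : crossOn Y S.c ▷ U ≫ crossOn (Y ⊗ S.X) qp ≫ crossOn Y qp ▷ S.X =
    crossOn (Y ⊗ S.X) qp ≫ crossOn Y qp ▷ S.X ≫ crossOn (Y ⊗ U) S.c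

/-! ### Sliding rules obtained by rotating the crossing -/

section Rotations

variable {C : Type*} [Category C] [MonoidalCategory C]

theorem crossOn_braid (S : SymStrand C) (Y : C) :
    crossOn Y S.c ▷ S.X ≫ crossOn (Y ⊗ S.X) S.c ≫ crossOn Y S.c ▷ S.X =
      crossOn (Y ⊗ S.X) S.c ≫ crossOn Y S.c ▷ S.X ≫ crossOn (Y ⊗ S.X) S.c := onLast_braid S Y

variable [Preadditive C] [MonoidalPreadditive C]

/-- A symmetric upward crossing with zigzags, all of whose rotations satisfy the relations of the
Heisenberg category. -/
def strandsOfRotations (U : C) (S : SymStrand C) (c : U ⊗ U ⟶ U ⊗ U) (cup : 𝟙_ C ⟶ S.X ⊗ U)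
    (cup' : 𝟙_ C ⟶ U ⊗ S.X) (cap : S.X ⊗ U ⟶ 𝟙_ C) (cap' : U ⊗ S.X ⟶ 𝟙_ C)
    (hL : S.c = rotateL cup cap' (rotateL cup cap' c))
    (hR : S.c = rotateR cup' cap (rotateR cup' cap c))
    (z1 : (λ_ U).inv ≫ cup' ▷ U ≫ (α_ U S.X U).hom ≫ U ◁ cap ≫ (ρ_ U).hom = 𝟙 U)
    (z2 : (ρ_ U).inv ≫ U ◁ cup ≫ (α_ U S.X U).inv ≫ cap' ▷ U ≫ (λ_ U).hom = 𝟙 U)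
    (qp_pq : rotateR cup' cap c ≫ rotateL cup cap' c = 𝟙 _ - cap ≫ cup)
    (pq_qp : rotateL cup cap' c ≫ rotateR cup' cap c = 𝟙 _)
    (cup_cap : cup ≫ cap = 𝟙 _)
    (curl : (λ_ U).inv ≫ cup ▷ U ≫ (α_ S.X U U).hom ≫ S.X ◁ c ≫ (α_ S.X U U).inv ≫
      cap ▷ U ≫ (λ_ U).hom = 0) : Strands C :=
  have curlOn (Y : C) : cupOn Y cup ▷ U ≫ crossOn (Y ⊗ S.X) c ≫ capOn Y cap ▷ U = 0 := by
    have h1 : cupOn Y cup ▷ U ≫ crossOn (Y ⊗ S.X) c ≫ capOn Y cap ▷ U =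
        Y ◁ ((λ_ U).inv ≫ cup ▷ U ≫ (α_ S.X U U).hom ≫ S.X ◁ c ≫ (α_ S.X U U).inv ≫
          cap ▷ U ≫ (λ_ U).hom) := by
      simp only [crossOn, cupOn, capOn]
      monoidal
    rw [h1, curl, MonoidalPreadditive.whiskerLeft_zero]
  let q := rotateR cup' cap c
  have cross_cap (Y : C) : crossOn Y S.c ▷ U ≫ capOn (Y ⊗ S.X) cap =
      crossOn (Y ⊗ S.X) q ≫ capOn Y cap ▷ S.X := by
    -- As a right rotation of the sideways crossing, the downward crossing contains a cup which the
    -- cap straightens; one rotation remains.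
    have h1 : crossOn Y S.c = crossOn Y (rotateR cup' cap (rotateR cup' cap c)) := by
      rw [← hR]
    rw [h1, crossOn_rotateR Y]
    simp only [comp_whiskerRight, Category.assoc]
    rw [capOn_naturality, capOn_naturality_assoc, ← Category.assoc, zigzag_left_on z1,
      Category.id_comp]
  have cross_cap_assoc (Y : C) {Z : C} (f : Y ⊗ S.X ⟶ Z) :
      crossOn Y S.c ▷ U ≫ capOn (Y ⊗ S.X) cap ≫ f =
        crossOn (Y ⊗ S.X) q ≫ capOn Y cap ▷ S.X ≫ f := by
    rw [← Category.assoc, cross_cap, Category.assoc]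
  { U := U
    S := S
    qp := rotateR cup' cap c
    pq := rotateL cup cap' c
    cap := cap
    cup := cup
    qp_pq := fun Y => by
      have h1 : crossOn Y (rotateR cup' cap c) ≫ crossOn Y (rotateL cup cap' c) =
          (α_ _ _ _).hom ≫ Y ◁ (rotateR cup' cap c ≫ rotateL cup cap' c) ≫ (α_ _ _ _).inv := by
        simp [crossOn]
      have h2 : capOn Y cap ≫ cupOn Y cup =
          (α_ _ _ _).hom ≫ Y ◁ (cap ≫ cup) ≫ (α_ _ _ _).inv := by simp [capOn, cupOn]
      rw [eq_sub_iff_add_eq, h1, h2, ← Preadditive.comp_add, ← Preadditive.add_comp,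
        ← MonoidalPreadditive.whiskerLeft_add, qp_pq]
      simp
    pq_qp := fun Y => by
      have h1 : crossOn Y (rotateL cup cap' c) ≫ crossOn Y (rotateR cup' cap c) =
          (α_ _ _ _).hom ≫ Y ◁ (rotateL cup cap' c ≫ rotateR cup' cap c) ≫ (α_ _ _ _).inv := by
        simp [crossOn]
      rw [h1, pq_qp]
      simp
    cup_cap := fun Y => by
      have h1 : cupOn Y cup ≫ capOn Y cap = (ρ_ Y).inv ≫ Y ◁ (cup ≫ cap) ≫ (ρ_ Y).hom := by
        simp [cupOn, capOn]
      rw [h1, cup_cap]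
      simp
    -- The two caps slide past each other, which exposes a left curl below the remaining cap. The
    -- relation `cup_qp` is the mirror situation.
    pq_cap := fun Y => by
      rw [crossOn_rotateL]
      simp only [Category.assoc]
      rw [← capOn_naturality, ← comp_whiskerRight_assoc, ← comp_whiskerRight_assoc,
        Category.assoc, curlOn, MonoidalPreadditive.zero_whiskerRight, Limits.zero_comp]
    cup_qp := fun Y => by
      rw [crossOn_rotateR, cupOn_naturality_assoc, ← comp_whiskerRight, ← comp_whiskerRight,
        curlOn, MonoidalPreadditive.zero_whiskerRight, Limits.comp_zero]
    cross_cap := cross_cap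
    cup_cross := fun Y => by
      have h1 : crossOn Y S.c = crossOn Y (rotateL cup cap' (rotateL cup cap' c)) := by
        rw [← hL]
      rw [h1, crossOn_rotateL Y]
      simp only [comp_whiskerRight]
      rw [← cupOn_naturality_assoc, ← cupOn_naturality_assoc, zigzag_right_on z2,
        Category.comp_id]
    cross_qp := fun Y => by
      -- The braid relation of three downward strands is closed by a cap on the right. Sliding the
      -- cap leftwards through the crossings turns the strand that it meets into an upward one, and
      -- gives the mixed triple relation with a cap attached at the end.
      have key (Z : C) : crossOn (Z ⊗ S.X) S.c ▷ U ≫ crossOn ((Z ⊗ S.X) ⊗ S.X) q ≫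
          crossOn (Z ⊗ S.X) q ▷ S.X ≫ (capOn Z cap ▷ S.X) ▷ S.X =
          crossOn ((Z ⊗ S.X) ⊗ S.X) q ≫ crossOn (Z ⊗ S.X) q ▷ S.X ≫
            crossOn ((Z ⊗ S.X) ⊗ U) S.c ≫ (capOn Z cap ▷ S.X) ▷ S.X := by
        have h1 := congrArg (fun f => f ▷ U ≫ capOn ((Z ⊗ S.X) ⊗ S.X) cap) (crossOn_braid S Z)
        simp only [comp_whiskerRight, Category.assoc] at h1
        rw [capOn_naturality, cross_cap_assoc, cross_cap, crossOn_naturality_assoc,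
          crossOn_naturality_assoc, ← comp_whiskerRight_assoc, ← comp_whiskerRight,
          cross_cap, comp_whiskerRight, Category.assoc, crossOn_naturality] at h1
        exact h1.symm
      -- A cup at the bottom bends the capped strand upright again, and the zigzag relation removes
      -- the bend.
      have hL := congrArg (fun f => ((cupOn Y cup' ▷ S.X) ▷ S.X) ▷ U ≫ f) (key (Y ⊗ U))
      rw [← comp_whiskerRight_assoc, crossOn_naturality, comp_whiskerRight_assoc,
        crossOn_naturality_assoc, crossOn_naturality_assoc, ← comp_whiskerRight_assoc,
        ← comp_whiskerRight_assoc, crossOn_naturality, comp_whiskerRight, Category.assoc,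
        Category.assoc, crossOn_naturality_assoc, ← comp_whiskerRight, ← comp_whiskerRight,
        ← comp_whiskerRight, zigzag_left_on z1, id_whiskerRight, id_whiskerRight,
        Category.comp_id, Category.comp_id] at hL
      exact hL }

end Rotations

end Heis


namespace Heis

theorem moveToLast_last (n : ℕ) : moveToLast (Fin.last n) = 1 := by
  simp only [moveToLast, Equiv.self_trans_symm]
  rfl

/-- Moving a strand to the far right passes all but the last strand first and then crosses the last
one; this drives the inductions on the number of strands. -/
theorem moveToLast_castSucc {n : ℕ} (i : Fin (n + 1)) : moveToLast i.castSucc =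
    Equiv.swap ⟨n, by omega⟩ ⟨n + 1, by omega⟩ * addLast (n + 1) (moveToLast i) := by
  ext x
  congr 1
  rw [Equiv.Perm.mul_apply]
  rcases Fin.eq_self_or_eq_succAbove i.castSucc x with rfl | ⟨j, rfl⟩
  · rw [moveToLast_self, addLast_castSucc, moveToLast_self]
    exact (Equiv.swap_apply_left _ _).symm
  · rw [moveToLast_succAbove]
    induction j using Fin.lastCases with
    | last =>
      have e : i.castSucc.succAbove (Fin.last n) = Fin.last (n + 1) := by
        rw [Fin.succAbove_of_le_castSucc _ _ (Fin.castSucc_le_castSucc_iff.2 (Fin.le_last i)),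
          Fin.succ_last]
      rw [e, addLast_last]
      exact (Equiv.swap_apply_right _ _).symm
    | cast j =>
      rw [Fin.castSucc_succAbove_castSucc, addLast_castSucc, moveToLast_succAbove,
        Equiv.swap_apply_of_ne_of_ne] <;>
      · intro e
        have := congrArg Fin.val e
        have := j.2
        simp at *
        omega

theorem exists_eq_addLast_mul {n : ℕ} (σ : Equiv.Perm (Fin (n + 1))) :
    ∃ τ, σ = addLast n τ * moveToLast (σ⁻¹ (Fin.last n)) := by
  obtain ⟨τ, hτ⟩ := exists_addLast_eq (σ := σ * (moveToLast (σ⁻¹ (Fin.last n)))⁻¹) (by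
    rw [Equiv.Perm.mul_apply, moveToLast_inv_last, ← Equiv.Perm.mul_apply, mul_inv_cancel,
      Equiv.Perm.one_apply])
  exact ⟨τ, by rw [hτ, inv_mul_cancel_right]⟩

/-! ### Crossing an upward strand with several downward strands -/

section Side

variable {C : Type*} [Category C] [MonoidalCategory C] [Preadditive C] (T : Strands C)

/-- The crossing of `n` downward strands with an upward strand on their right. -/
def Strands.sideQP : (n : ℕ) → (pow T.S n ⊗ T.U ⟶ T.U ⊗ pow T.S n)
  | 0 => (λ_ T.U).hom ≫ (ρ_ T.U).inv
  | n + 1 => crossOn (pow T.S n) T.qp ≫ Strands.sideQP n ▷ T.S.X ≫ (α_ _ _ _).hom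

/-- The crossing of `n` downward strands with an upward strand on their left. -/
def Strands.sidePQ : (n : ℕ) → (T.U ⊗ pow T.S n ⟶ pow T.S n ⊗ T.U)
  | 0 => (ρ_ T.U).hom ≫ (λ_ T.U).inv
  | n + 1 => (α_ _ _ _).inv ≫ Strands.sidePQ n ▷ T.S.X ≫ crossOn (pow T.S n) T.pq

namespace Strands

theorem sideQP_succ (n : ℕ) : T.sideQP (n + 1) =
    crossOn (pow T.S n) T.qp ≫ T.sideQP n ▷ T.S.X ≫ (α_ _ _ _).hom := rfl

theorem sidePQ_succ (n : ℕ) : T.sidePQ (n + 1) =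
    (α_ _ _ _).inv ≫ T.sidePQ n ▷ T.S.X ≫ crossOn (pow T.S n) T.pq := rfl

theorem sidePQ_comp_sideQP : ∀ n, T.sidePQ n ≫ T.sideQP n = 𝟙 _
  | 0 => by simp [sidePQ, sideQP]
  | n + 1 => by
    rw [sideQP_succ, sidePQ_succ]
    simp only [Category.assoc]
    rw [reassoc_of% (T.pq_qp (pow T.S n)), ← comp_whiskerRight_assoc, sidePQ_comp_sideQP n]
    simp

/-- For the last two strands this is the mixed triple relation; the other crossings commute past the
first sideways crossing and the induction applies. -/
theorem crossAt_comp_sideQP : ∀ {n i : ℕ}, i + 1 < n →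
    crossAt T.S n i ▷ T.U ≫ T.sideQP n = T.sideQP n ≫ T.U ◁ crossAt T.S n i
  | 0, i, h => by omega
  | 1, i, h => by omega
  | n + 2, i, h => by
    by_cases hi : i = n
    · subst hi
      have e : crossAt T.S (i + 2) i = crossOn (pow T.S i) T.S.c := crossAt_last T.S i
      rw [e, sideQP_succ, sideQP_succ]
      have := T.cross_qp (pow T.S i)
      simp only [comp_whiskerRight, Category.assoc]
      rw [reassoc_of% this, ← crossOn_naturality_assoc]
      have h2 : crossOn (T.U ⊗ pow T.S i) T.S.c ≫ (α_ T.U (pow T.S i) T.S.X).hom ▷ T.S.X ≫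
          (α_ T.U (pow T.S (i + 1)) T.S.X).hom = (α_ T.U (pow T.S i) T.S.X).hom ▷ T.S.X ≫
          (α_ T.U (pow T.S (i + 1)) T.S.X).hom ≫ T.U ◁ crossOn (pow T.S i) T.S.c := by
        simp only [crossOn]
        monoidal
      rw [h2]
    · have ih := crossAt_comp_sideQP (n := n + 1) (i := i) (by omega)
      rw [crossAt_of_ne T.S hi, sideQP_succ T (n + 1), crossOn_naturality_assoc,
        ← comp_whiskerRight_assoc, ih]
      simp

theorem permDiagram_comp_sideQP {n : ℕ} (σ : Equiv.Perm (Fin n)) :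
    permDiagram T.S n σ ▷ T.U ≫ T.sideQP n = T.sideQP n ≫ T.U ◁ permDiagram T.S n σ := by
  have h1 : permDiagram T.S n 1 = 𝟙 (pow T.S n) := map_one _
  have h2 : ∀ σ τ, permDiagram T.S n (σ * τ) = permDiagram T.S n τ ≫ permDiagram T.S n σ :=
    fun σ τ => map_mul _ σ τ
  let M : Submonoid (Equiv.Perm (Fin n)) :=
    { carrier := {σ | permDiagram T.S n σ ▷ T.U ≫ T.sideQP n =
        T.sideQP n ≫ T.U ◁ permDiagram T.S n σ}
      one_mem' := by
        change _ ▷ _ ≫ _ = _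
        rw [h1]
        simp
      mul_mem' := fun {a b} ha hb => by
        change _ ▷ _ ≫ _ = _
        change _ ▷ _ ≫ _ = _ at ha
        change _ ▷ _ ≫ _ = _ at hb
        rw [h2, comp_whiskerRight, Category.assoc, ha, reassoc_of% hb,
          MonoidalCategory.whiskerLeft_comp] }
  have hM : M = ⊤ := by
    rcases n with _ | n
    · rw [eq_top_iff]
      rintro σ -
      rw [Subsingleton.elim σ 1]
      exact M.one_mem
    · rw [eq_top_iff, ← Equiv.Perm.mclosure_swap_castSucc_succ, Submonoid.closure_le]
      rintro _ ⟨i, rfl⟩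
      have := T.crossAt_comp_sideQP (n := n + 1) (i := i) (by omega)
      rw [← permDiagram_swap T.S (n := n + 1) (i := i) (by omega)] at this
      exact this
  exact (hM ▸ Submonoid.mem_top σ : σ ∈ M)

theorem permDiagram_castSucc {n : ℕ} (i : Fin (n + 1)) :
    permDiagram T.S (n + 2) (moveToLast i.castSucc) =
      permDiagram T.S (n + 1) (moveToLast i) ▷ T.S.X ≫ crossOn (pow T.S n) T.S.c := by
  rw [moveToLast_castSucc, map_mul, End.mul_def, permDiagram_addLast,
    permDiagram_swap T.S (n := n + 2) (i := n) (by omega), crossAt_last]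
  rfl

theorem permDiagram_castSucc_inv {n : ℕ} (i : Fin (n + 1)) :
    permDiagram T.S (n + 2) (moveToLast i.castSucc)⁻¹ =
      crossOn (pow T.S n) T.S.c ≫ permDiagram T.S (n + 1) (moveToLast i)⁻¹ ▷ T.S.X := by
  rw [moveToLast_castSucc, mul_inv_rev, ← map_inv, Equiv.swap_inv, map_mul, End.mul_def,
    permDiagram_addLast, permDiagram_swap T.S (n := n + 2) (i := n) (by omega), crossAt_last]
  rfl

theorem sidePQ_comp_capOn (n : ℕ) : T.sidePQ (n + 1) ≫ capOn (pow T.S n) T.cap = 0 := by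
  rw [sidePQ_succ]
  simp only [Category.assoc]
  rw [T.pq_cap, Limits.comp_zero, Limits.comp_zero]

theorem cupOn_comp_sideQP (n : ℕ) : cupOn (pow T.S n) T.cup ≫ T.sideQP (n + 1) = 0 := by
  rw [sideQP_succ, reassoc_of% (T.cup_qp (pow T.S n)), Limits.zero_comp]

theorem moveToLast_comp_capOn (n : ℕ) (i : Fin (n + 1)) :
    permDiagram T.S (n + 2) (moveToLast i.castSucc) ▷ T.U ≫ capOn (pow T.S (n + 1)) T.cap =
      crossOn (pow T.S (n + 1)) T.qp ≫ (permDiagram T.S (n + 1) (moveToLast i) ▷ T.U) ▷ T.S.X ≫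
        capOn (pow T.S n) T.cap ▷ T.S.X := by
  rw [permDiagram_castSucc, comp_whiskerRight, Category.assoc, T.cross_cap,
    crossOn_naturality_assoc]

theorem cupOn_comp_moveToLast_inv (n : ℕ) (i : Fin (n + 1)) :
    cupOn (pow T.S (n + 1)) T.cup ≫ permDiagram T.S (n + 2) (moveToLast i.castSucc)⁻¹ ▷ T.U =
      cupOn (pow T.S n) T.cup ▷ T.S.X ≫
        (permDiagram T.S (n + 1) (moveToLast i)⁻¹ ▷ T.U) ▷ T.S.X ≫
          crossOn (pow T.S (n + 1)) T.pq := by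
  rw [permDiagram_castSucc_inv, comp_whiskerRight, reassoc_of% (T.cup_cross (pow T.S n)),
    crossOn_naturality]

theorem permDiagram_last (n : ℕ) : permDiagram T.S (n + 1) (moveToLast (Fin.last n)) = 𝟙 _ := by
  rw [moveToLast_last]; exact map_one _

theorem permDiagram_last_inv (n : ℕ) :
    permDiagram T.S (n + 1) (moveToLast (Fin.last n))⁻¹ = 𝟙 _ := by
  rw [moveToLast_last, inv_one]; exact map_one _

/-- The projection to the part of `n` downward strands and an upward strand in which the strand `i`
is connected with the upward strand. -/
noncomputable def capCup (n : ℕ) (i : Fin (n + 1)) :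
    pow T.S (n + 1) ⊗ T.U ⟶ pow T.S (n + 1) ⊗ T.U :=
  permDiagram T.S (n + 1) (moveToLast i) ▷ T.U ≫ capOn (pow T.S n) T.cap ≫
    cupOn (pow T.S n) T.cup ≫ permDiagram T.S (n + 1) (moveToLast i)⁻¹ ▷ T.U

theorem capCup_last (n : ℕ) : T.capCup n (Fin.last n) =
    capOn (pow T.S n) T.cap ≫ cupOn (pow T.S n) T.cup := by
  rw [capCup, permDiagram_last, permDiagram_last_inv]
  simp

/-- The last downward strand takes no part in the connection and can be pulled over the cap and the
cup, which turns its crossings with the strand `i` into sideways crossings with the upward one. -/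
theorem capCup_castSucc (n : ℕ) (i : Fin (n + 1)) : T.capCup (n + 1) i.castSucc =
    crossOn (pow T.S (n + 1)) T.qp ≫ T.capCup n i ▷ T.S.X ≫ crossOn (pow T.S (n + 1)) T.pq := by
  rw [capCup, reassoc_of% (T.moveToLast_comp_capOn n i), cupOn_comp_moveToLast_inv, capCup]
  simp only [comp_whiskerRight, Category.assoc]

theorem permDiagram_addLast_comp_capOn {n : ℕ} (σ : Equiv.Perm (Fin n)) :
    permDiagram T.S (n + 1) (addLast n σ) ▷ T.U ≫ capOn (pow T.S n) T.cap =
      capOn (pow T.S n) T.cap ≫ permDiagram T.S n σ := by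
  rw [permDiagram_addLast, capOn_naturality]

/-- The strand starting at the cup is not the one that is capped, so sliding the cap makes the cup
run directly into a sideways crossing, which vanishes by the curl relation. -/
theorem cupOn_comp_moveToLast (n : ℕ) (i : Fin (n + 1)) (hi : i ≠ Fin.last n) :
    cupOn (pow T.S n) T.cup ≫ permDiagram T.S (n + 1) (moveToLast i) ▷ T.U ≫
      capOn (pow T.S n) T.cap = 0 := by
  rcases n with _ | n
  · exact absurd (Fin.ext (by omega)) hi
  · induction i using Fin.lastCases with
    | last => exact absurd rfl hi
    | cast i =>
      rw [moveToLast_comp_capOn, reassoc_of% (T.cup_qp (pow T.S (n + 1))), Limits.zero_comp]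

/-- If `σ` fixes the last strand, cup and cap close to a circle of value `1`. Otherwise `σ` differs
from a `moveToLast` only by a permutation of the other strands, which slides through the cap, and
the previous vanishing applies. -/
theorem cupOn_comp_permDiagram {k : Type*} [Field k] [Linear k C] (n : ℕ)
    (σ : Equiv.Perm (Fin (n + 1))) :
    cupOn (pow T.S n) T.cup ≫ permDiagram T.S (n + 1) σ ▷ T.U ≫ capOn (pow T.S n) T.cap =
      algDiagram T.S k n (restr k n (MonoidAlgebra.single σ 1)) := by
  by_cases hσ : σ (Fin.last n) = Fin.last n
  · obtain ⟨τ, rfl⟩ := exists_addLast_eq hσ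
    rw [restr_single_addLast, algDiagram_single, one_smul, permDiagram_addLast_comp_capOn,
      reassoc_of% (T.cup_cap (pow T.S n))]
  · rw [restr_single_of_ne hσ, map_zero]
    obtain ⟨τ, hτ⟩ := exists_eq_addLast_mul σ
    have hne : σ⁻¹ (Fin.last n) ≠ Fin.last n := fun e => hσ (by
      rw [Equiv.Perm.inv_eq_iff_eq] at e
      exact e.symm)
    have key := T.cupOn_comp_moveToLast n _ hne
    rw [hτ, map_mul, End.mul_def, comp_whiskerRight, Category.assoc,
      permDiagram_addLast_comp_capOn, ← Category.assoc, ← Category.assoc,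
      Category.assoc (cupOn _ _), key, Limits.zero_comp]

section

variable [MonoidalPreadditive C]

/-- Sliding the cap past the last strand produces a double sideways crossing of up-down type, which
is the identity. Repeating this, the cap finally sits on a single sideways crossing and gives a left
curl. -/
theorem sidePQ_comp_moveToLast (n : ℕ) (i : Fin (n + 1)) :
    T.sidePQ (n + 1) ≫ permDiagram T.S (n + 1) (moveToLast i) ▷ T.U ≫
      capOn (pow T.S n) T.cap = 0 := by
  induction n with
  | zero =>
    obtain rfl : i = Fin.last 0 := Fin.ext (by omega)
    rw [permDiagram_last, id_whiskerRight, Category.id_comp, sidePQ_comp_capOn]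
  | succ n ih =>
    induction i using Fin.lastCases with
    | last => rw [permDiagram_last, id_whiskerRight, Category.id_comp, sidePQ_comp_capOn]
    | cast i =>
      rw [moveToLast_comp_capOn, sidePQ_succ]
      simp only [Category.assoc]
      rw [reassoc_of% (T.pq_qp (pow T.S (n + 1))), ← comp_whiskerRight, ← comp_whiskerRight, ih,
        MonoidalPreadditive.zero_whiskerRight, Limits.comp_zero]

/-- Undoing the double crossings one strand at a time, each down-up double crossing costs a term
cap-cup; conjugated by the crossings of the strands to its right, this term is `capCup`. -/
theorem sideQP_comp_sidePQ (n : ℕ) :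
    T.sideQP (n + 1) ≫ T.sidePQ (n + 1) + ∑ i : Fin (n + 1), T.capCup n i = 𝟙 _ := by
  have hs : ∀ n, T.sideQP (n + 1) ≫ T.sidePQ (n + 1) = crossOn (pow T.S n) T.qp ≫
      (T.sideQP n ≫ T.sidePQ n) ▷ T.S.X ≫ crossOn (pow T.S n) T.pq := fun n => by
    rw [sideQP_succ, sidePQ_succ]
    simp
  induction n with
  | zero =>
    have h0 : T.sideQP 0 ≫ T.sidePQ 0 = 𝟙 _ := by simp [sideQP, sidePQ]
    rw [Fin.sum_univ_castSucc, Finset.univ_eq_empty, Finset.sum_empty, zero_add (T.capCup 0 _), capCup_last,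
      hs, h0, id_whiskerRight, Category.id_comp, T.qp_pq]
    exact sub_add_cancel _ _
  | succ n ih =>
    -- The sideways crossing of the new last strand, put below and above the induction hypothesis,
    -- carries the term of the strand `i` to the term of `i.castSucc`. The identity becomes a double
    -- crossing, whose defect is the term of the last strand.
    have h1 : crossOn (pow T.S (n + 1)) T.qp ≫
        (T.sideQP (n + 1) ≫ T.sidePQ (n + 1) + ∑ i : Fin (n + 1), T.capCup n i) ▷ T.S.X ≫
          crossOn (pow T.S (n + 1)) T.pq =
        T.sideQP (n + 2) ≫ T.sidePQ (n + 2) +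
          ∑ i : Fin (n + 1), T.capCup (n + 1) i.castSucc := by
      rw [MonoidalPreadditive.add_whiskerRight, Preadditive.add_comp, Preadditive.comp_add,
        ← hs]
      congr 1
      simp only [capCup_castSucc]
      rw [← Preadditive.comp_sum, ← Preadditive.sum_comp, sum_whiskerRight]
    rw [Fin.sum_univ_castSucc, ← add_assoc, ← h1, ih, id_whiskerRight, Category.id_comp, T.qp_pq,
      capCup_last]
    exact sub_add_cancel _ _

variable {k : Type*} [Field k] [Linear k C] [MonoidalLinear k C]

theorem algDiagram_comp_sideQP {n : ℕ} (x : MonoidAlgebra k (Equiv.Perm (Fin n))) :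
    algDiagram T.S k n x ▷ T.U ≫ T.sideQP n = T.sideQP n ≫ T.U ◁ algDiagram T.S k n x := by
  induction x using MonoidAlgebra.induction_linear with
  | zero =>
    rw [map_zero]
    change (0 : pow T.S n ⟶ pow T.S n) ▷ _ ≫ _ = _ ≫ _ ◁ (0 : pow T.S n ⟶ pow T.S n)
    simp
  | add a b ha hb =>
    rw [map_add]
    refine (congrArg (fun f => f ≫ _) (MonoidalPreadditive.add_whiskerRight _ _)).trans ?_
    rw [Preadditive.add_comp, ha, hb, ← Preadditive.comp_add]
    exact congrArg (fun f => _ ≫ f) (MonoidalPreadditive.whiskerLeft_add _ _).symm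
  | single σ r =>
    rw [algDiagram_single]
    refine (congrArg (fun f => f ≫ _) (MonoidalLinear.smul_whiskerRight _ _ _)).trans ?_
    rw [Linear.smul_comp, permDiagram_comp_sideQP, ← Linear.comp_smul]
    exact congrArg (fun f => _ ≫ f) (MonoidalLinear.whiskerLeft_smul _ _ _).symm

theorem algDiagram_comp_capOn {n : ℕ} (x : MonoidAlgebra k (Equiv.Perm (Fin n))) :
    algDiagram T.S k (n + 1) (incl k n x) ▷ T.U ≫ capOn (pow T.S n) T.cap =
      capOn (pow T.S n) T.cap ≫ algDiagram T.S k n x := by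
  rw [algDiagram_incl, capOn_naturality]

theorem cupOn_comp_algDiagram {n : ℕ} (x : MonoidAlgebra k (Equiv.Perm (Fin n))) :
    cupOn (pow T.S n) T.cup ≫ algDiagram T.S k (n + 1) (incl k n x) ▷ T.U =
      algDiagram T.S k n x ≫ cupOn (pow T.S n) T.cup := by
  rw [algDiagram_incl, cupOn_naturality]

theorem sidePQ_comp_permDiagram (n : ℕ) (σ : Equiv.Perm (Fin (n + 1))) :
    T.sidePQ (n + 1) ≫ permDiagram T.S (n + 1) σ ▷ T.U ≫ capOn (pow T.S n) T.cap = 0 := by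
  obtain ⟨τ, hτ⟩ := exists_eq_addLast_mul σ
  rw [hτ, map_mul, End.mul_def, comp_whiskerRight, Category.assoc,
    permDiagram_addLast_comp_capOn, ← Category.assoc, ← Category.assoc,
    Category.assoc (T.sidePQ _), sidePQ_comp_moveToLast, Limits.zero_comp]

theorem sidePQ_comp_algDiagram (n : ℕ) (x : MonoidAlgebra k (Equiv.Perm (Fin (n + 1)))) :
    T.sidePQ (n + 1) ≫ algDiagram T.S k (n + 1) x ▷ T.U ≫ capOn (pow T.S n) T.cap = 0 := by
  induction x using MonoidAlgebra.induction_linear with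
  | zero =>
    rw [map_zero]
    change _ ≫ (0 : pow T.S (n + 1) ⟶ pow T.S (n + 1)) ▷ _ ≫ _ = _
    simp
  | add a b ha hb =>
    rw [map_add]
    refine (congrArg (fun f => _ ≫ f ≫ _) (MonoidalPreadditive.add_whiskerRight _ _)).trans ?_
    rw [Preadditive.add_comp, Preadditive.comp_add, ha, hb, add_zero]
  | single σ r =>
    rw [algDiagram_single]
    refine (congrArg (fun f => _ ≫ f ≫ _) (MonoidalLinear.smul_whiskerRight _ _ _)).trans ?_
    rw [Linear.smul_comp, Linear.comp_smul, sidePQ_comp_permDiagram, smul_zero]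

theorem cupOn_comp_algDiagram_comp_capOn (n : ℕ)
    (x : MonoidAlgebra k (Equiv.Perm (Fin (n + 1)))) :
    cupOn (pow T.S n) T.cup ≫ algDiagram T.S k (n + 1) x ▷ T.U ≫ capOn (pow T.S n) T.cap =
      algDiagram T.S k n (restr k n x) := by
  induction x using MonoidAlgebra.induction_linear with
  | zero =>
    rw [map_zero, map_zero, map_zero]
    change _ ≫ (0 : pow T.S (n + 1) ⟶ pow T.S (n + 1)) ▷ _ ≫ _ = (0 : pow T.S n ⟶ pow T.S n)
    simp
  | add a b ha hb =>
    rw [map_add, map_add, map_add]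
    refine (congrArg (fun f => _ ≫ f ≫ _) (MonoidalPreadditive.add_whiskerRight _ _)).trans ?_
    rw [Preadditive.add_comp, Preadditive.comp_add, ha, hb]
  | single σ r =>
    have e : MonoidAlgebra.single σ r = r • MonoidAlgebra.single σ (1 : k) := by
      rw [MonoidAlgebra.smul_single, smul_eq_mul, mul_one]
    rw [e, map_smul, map_smul, map_smul, ← cupOn_comp_permDiagram, algDiagram_single, one_smul]
    refine (congrArg (fun f => _ ≫ f ≫ _) (MonoidalLinear.smul_whiskerRight _ _ _)).trans ?_
    rw [Linear.smul_comp, Linear.comp_smul]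

end

end Strands

end Side

end Heis


namespace Heis

/-! ### Upward and downward strands in the category of words -/

section WordStrands

variable (k : Type*) [CommRing k]

/-- The strands of the Heisenberg category. -/
def wordStrands : Strands (Word k) :=
  strandsOfRotations (C := Word k) (up k) (downStrand k) (dia (k := k) Tm.cross)
    (dia (k := k) Tm.cupQP) (dia (k := k) Tm.cupPQ) (dia (k := k) Tm.capQP)
    -- The downward crossing is defined as the double left rotation; planar isotopy identifies it
    -- with the double right one.
    (dia (k := k) Tm.capPQ) rfl (Quotient.sound Tm.Rel.cross_rot)
    (Quotient.sound Tm.Rel.zigzag_up_right) (Quotient.sound Tm.Rel.zigzag_up_left)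
    (by rw [sub_eq_add_neg]; exact Quotient.sound Tm.Rel.down_up)
    (Quotient.sound Tm.Rel.up_down) (Quotient.sound Tm.Rel.bubble)
    (Quotient.sound Tm.Rel.curl)

theorem sideQP_eq : ∀ n, sideQP k n = (wordStrands k).sideQP n
  | 0 => rfl
  | n + 1 => by
    rw [sideQP, sideQP_eq n, Strands.sideQP_succ]
    simp only [crossOn, Category.assoc]
    rfl

theorem sidePQ_eq : ∀ n, sidePQ k n = (wordStrands k).sidePQ n
  | 0 => rfl
  | n + 1 => by
    rw [sidePQ, sidePQ_eq n, Strands.sidePQ_succ]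
    rfl

end WordStrands

section Side

variable {k : Type*} [Field k] {n : ℕ}

theorem sidePQ_comp_sideQP (n : ℕ) : sidePQ k n ≫ sideQP k n = 𝟙 _ := by
  rw [sideQP_eq, sidePQ_eq]
  exact (wordStrands k).sidePQ_comp_sideQP n

theorem downDia_comp_sideQP (x : MonoidAlgebra k (Equiv.Perm (Fin n))) :
    downDia k x ▷ up k ≫ sideQP k n = sideQP k n ≫ up k ◁ downDia k x := by
  rw [sideQP_eq]
  exact (wordStrands k).algDiagram_comp_sideQP x

theorem sidePQ_comp_downDia (x : MonoidAlgebra k (Equiv.Perm (Fin (n + 1)))) :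
    sidePQ k (n + 1) ≫ downDia k x ▷ up k ≫ capLast k n = 0 := by
  rw [sidePQ_eq]
  exact (wordStrands k).sidePQ_comp_algDiagram n x

theorem cupLast_comp_sideQP : cupLast k n ≫ sideQP k (n + 1) = 0 := by
  rw [sideQP_eq]
  exact (wordStrands k).cupOn_comp_sideQP n

theorem cupLast_comp_downDia_comp_capLast (x : MonoidAlgebra k (Equiv.Perm (Fin (n + 1)))) :
    cupLast k n ≫ downDia k x ▷ up k ≫ capLast k n = downDia k (restr k n x) :=
  (wordStrands k).cupOn_comp_algDiagram_comp_capOn n x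

theorem downDia_comp (x y : MonoidAlgebra k (Equiv.Perm (Fin n))) :
    downDia k x ≫ downDia k y = downDia k (y * x) := algDiagram_comp _ x y

theorem downPerm_eq (σ : Equiv.Perm (Fin n)) :
    downPerm k σ = downDia k (MonoidAlgebra.single σ 1) :=
  ((algDiagram_single (downStrand k) σ (1 : k)).trans (one_smul k _)).symm

theorem downDia_smul (c : k) (x : MonoidAlgebra k (Equiv.Perm (Fin n))) :
    downDia k (c • x) = c • downDia k x :=
  map_smul (algDiagram (downStrand k) k n) c x

theorem downDia_zero : downDia k (0 : MonoidAlgebra k (Equiv.Perm (Fin n))) = 0 :=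
  map_zero (algDiagram (downStrand k) k n)

theorem downDia_add (x y : MonoidAlgebra k (Equiv.Perm (Fin n))) :
    downDia k (x + y) = downDia k x + downDia k y :=
  map_add (algDiagram (downStrand k) k n) x y

theorem downDia_incl_comp_capLast (x : MonoidAlgebra k (Equiv.Perm (Fin n))) :
    downDia k (incl k n x) ▷ up k ≫ capLast k n = capLast k n ≫ downDia k x :=
  (wordStrands k).algDiagram_comp_capOn x

theorem cupLast_comp_downDia_incl (x : MonoidAlgebra k (Equiv.Perm (Fin n))) :
    cupLast k n ≫ downDia k (incl k n x) ▷ up k = downDia k x ≫ cupLast k n :=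
  (wordStrands k).cupOn_comp_algDiagram x

theorem sideQP_comp_sidePQ : sideQP k (n + 1) ≫ sidePQ k (n + 1) +
    ∑ i : Fin (n + 1), downDia k (MonoidAlgebra.single (moveToLast i) 1) ▷ up k ≫ capLast k n ≫
      cupLast k n ≫ downDia k (MonoidAlgebra.single (moveToLast i)⁻¹ 1) ▷ up k = 𝟙 _ := by
  rw [sideQP_eq, sidePQ_eq]
  simp only [← downPerm_eq]
  exact (wordStrands k).sideQP_comp_sidePQ n

end Side

end Heis


namespace Heis

open Limits Idempotents

/-! ### The decomposition of `Q^μ P` -/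

section RemoveBox

variable {k : Type*} [Field k] {n : ℕ}

/-- The diagrams with a cap at the bottom and a cup at the top, as a bilinear map. -/
noncomputable def capCupDia (k : Type*) [Field k] (n : ℕ) :
    MonoidAlgebra k (Equiv.Perm (Fin (n + 1))) →ₗ[k]
    MonoidAlgebra k (Equiv.Perm (Fin (n + 1))) →ₗ[k]
      (pow (downStrand k) (n + 1) ⊗ up k ⟶ pow (downStrand k) (n + 1) ⊗ up k) :=
  LinearMap.mk₂ k (fun a b => downDia k b ▷ up k ≫ capLast k n ≫ cupLast k n ≫ downDia k a ▷ up k)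
    (fun a a' b => by
      rw [downDia_add, MonoidalPreadditive.add_whiskerRight]
      simp only [Preadditive.comp_add])
    (fun c a b => by
      rw [downDia_smul, MonoidalLinear.smul_whiskerRight]
      simp only [Linear.comp_smul])
    (fun a b b' => by
      rw [downDia_add, MonoidalPreadditive.add_whiskerRight, Preadditive.add_comp])
    (fun c a b => by
      rw [downDia_smul, MonoidalLinear.smul_whiskerRight, Linear.smul_comp])

theorem capCupDia_apply (a b : MonoidAlgebra k (Equiv.Perm (Fin (n + 1)))) :
    capCupDia k n a b =
      downDia k b ▷ up k ≫ capLast k n ≫ cupLast k n ≫ downDia k a ▷ up k := rfl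

/-- Permutations of the first `n` strands pass through the horizontal cut between cap and cup. This
is the hypothesis needed for the Casimir identity. -/
theorem capCupDia_balanced (a : MonoidAlgebra k (Equiv.Perm (Fin (n + 1))))
    (y : MonoidAlgebra k (Equiv.Perm (Fin n))) (b : MonoidAlgebra k (Equiv.Perm (Fin (n + 1)))) :
    capCupDia k n (a * incl k n y) b = capCupDia k n a (incl k n y * b) := by
  rw [capCupDia_apply, capCupDia_apply, ← downDia_comp, ← downDia_comp, comp_whiskerRight,
    comp_whiskerRight, reassoc_of% (cupLast_comp_downDia_incl (k := k) y), Category.assoc,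
    reassoc_of% (downDia_incl_comp_capLast (k := k) y)]

/-- The scalar of the inclusion of `Q^{μ(s⁻)}` into `Q^μ P`. -/
noncomputable def removeScalar (k : Type*) [Field k] (mu : YoungDiagram) (h : mu.card = n + 1)
    (s : removableRows mu) : k :=
  (((n + 1 : ℕ) : k) * (spechtDim (removeBox mu s) (card_removeBox' h s) k : k)) /
    (spechtDim mu h k : k)

/-- Between the cup and the cap stands a conjugate of `e_μ`, or a twisted one if `s ≠ t`, which
evaluates to its conditional expectation. -/
theorem cupLast_comp_capLast_smul (mu : YoungDiagram) (h : mu.card = n + 1)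
    (s t : removableRows mu) :
    downDia k (young (removeBox mu s) (card_removeBox' h s) k) ≫
      ((removeScalar k mu h s • (cupLast k n ≫
        downDia k (MonoidAlgebra.single (removePerm mu h s)⁻¹ 1) ▷ up k)) ≫
        downDia k (young mu h k) ▷ up k ≫
        (downDia k (MonoidAlgebra.single (removePerm mu h t) 1) ▷ up k ≫ capLast k n)) ≫
      downDia k (young (removeBox mu t) (card_removeBox' h t) k) =
    downDia k (removeScalar k mu h s • (young (removeBox mu t) (card_removeBox' h t) k *
      restr k n (MonoidAlgebra.single (removePerm mu h t) 1 * young mu h k *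
        MonoidAlgebra.single (removePerm mu h s)⁻¹ 1) *
      young (removeBox mu s) (card_removeBox' h s) k)) := by
  simp only [Linear.smul_comp, Linear.comp_smul, downDia_smul]
  congr 1
  rw [mul_assoc, ← downDia_comp, ← downDia_comp, ← cupLast_comp_downDia_comp_capLast,
    ← downDia_comp, ← downDia_comp]
  simp only [comp_whiskerRight, Category.assoc]

variable [CharZero k]

theorem tens_Q_P1_p (mu : YoungDiagram) (h : mu.card = n) :
    (tens (Q k mu h) (P1 k)).p = downDia k (young mu h k) ▷ up k :=
  tensorHom_id _ _

theorem tens_P1_Q_p (mu : YoungDiagram) (h : mu.card = n) :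
    (tens (P1 k) (Q k mu h)).p = up k ◁ downDia k (young mu h k) :=
  id_tensorHom _ _

theorem downDia_young_comp (mu : YoungDiagram) (h : mu.card = n) :
    downDia k (young mu h k) ≫ downDia k (young mu h k) = downDia k (young mu h k) := by
  rw [downDia_comp, young_mul_young]

theorem QP_iotaZero_comp_rhoZero (mu : YoungDiagram) (h : mu.card = n) :
    QP.iotaZero k mu h ≫ QP.rhoZero k mu h = 𝟙 _ := by
  refine (between_comp _ _).trans (between_eq_id ?_)
  rw [tens_Q_P1_p, tens_P1_Q_p]
  change up k ◁ downDia k (young mu h k) ≫ (sidePQ k n ≫ downDia k (young mu h k) ▷ up k ≫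
    sideQP k n) ≫ up k ◁ downDia k (young mu h k) = _
  rw [downDia_comp_sideQP, reassoc_of% (sidePQ_comp_sideQP (k := k) n),
    ← MonoidalCategory.whiskerLeft_comp, ← MonoidalCategory.whiskerLeft_comp, downDia_young_comp,
    downDia_young_comp]

theorem QP_rhoZero_comp_iotaZero (mu : YoungDiagram) (h : mu.card = n) :
    QP.rhoZero k mu h ≫ QP.iotaZero k mu h =
      between (tens (Q k mu h) (P1 k)) (tens (Q k mu h) (P1 k)) (sideQP k n ≫ sidePQ k n) := by
  refine (between_comp _ _).trans (between_congr ?_)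
  rw [tens_Q_P1_p, tens_P1_Q_p]
  have e : downDia k (young mu h k) ▷ up k ≫ (sideQP k n ≫ up k ◁ downDia k (young mu h k) ≫
      sidePQ k n) ≫ downDia k (young mu h k) ▷ up k =
      downDia k (young mu h k) ▷ up k ≫ (sideQP k n ≫ sidePQ k n) ≫
        downDia k (young mu h k) ▷ up k := by
    simp only [Category.assoc]
    rw [← reassoc_of% (downDia_comp_sideQP (k := k) (young mu h k)), ← comp_whiskerRight_assoc,
      downDia_young_comp]
  exact e

variable (mu : YoungDiagram) (h : mu.card = n + 1) (s t : removableRows mu)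

theorem QP_rho_eq : QP.rho k mu h s =
    between (tens (Q k mu h) (P1 k)) (Q k (removeBox mu s) (card_removeBox' h s))
      (downDia k (MonoidAlgebra.single (removePerm mu h s) 1) ▷ up k ≫ capLast k n) := by
  refine between_congr ?_
  rw [tens_Q_P1_p]
  -- For `n + 1` strands the cast from `n + 1` to `(n + 1 - 1) + 1` is definitionally the identity,
  -- and is written as such here.
  have e (Z : Word k) (w : pow (downStrand k) n ⟶ Z) :
      downDia k (young mu h k) ▷ up k ≫ ((downDia k (rowBox k mu h s) ≫
        downPerm k (removePerm mu h s) ≫ 𝟙 _) ▷ up k ≫ capLast k n) ≫ w =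
      downDia k (young mu h k) ▷ up k ≫
        (downDia k (MonoidAlgebra.single (removePerm mu h s) 1) ▷ up k ≫ capLast k n) ≫ w := by
    rw [Category.comp_id, downPerm_eq]
    simp only [← Category.assoc, ← comp_whiskerRight]
    rw [downDia_comp, rowBox_mul_young]
  exact e _ _

theorem QP_iota_eq : QP.iota k mu h s =
    between (Q k (removeBox mu s) (card_removeBox' h s)) (tens (Q k mu h) (P1 k))
      (removeScalar k mu h s • (cupLast k n ≫
        downDia k (MonoidAlgebra.single (removePerm mu h s)⁻¹ 1) ▷ up k)) := by
  refine between_congr ?_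
  have e (Z : Word k) (w : pow (downStrand k) (n + 1) ⊗ up k ⟶ Z) :
      downDia k (young (removeBox mu s) (card_removeBox' h s) k) ≫
        (removeScalar k mu h s • (downDia k (rowBox k (removeBox mu s) (card_removeBox' h s) s) ≫
          cupLast k n ≫ (𝟙 _ ≫ downPerm k (removePerm mu h s)⁻¹) ▷ up k)) ≫ w =
      downDia k (young (removeBox mu s) (card_removeBox' h s) k) ≫
        (removeScalar k mu h s • (cupLast k n ≫
          downDia k (MonoidAlgebra.single (removePerm mu h s)⁻¹ 1) ▷ up k)) ≫ w := by
    rw [Category.id_comp, downPerm_eq]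
    simp only [Linear.smul_comp, Linear.comp_smul, Category.assoc]
    rw [← Category.assoc, downDia_comp, rowBox_mul_young]
  exact e _ _

theorem QP_iota_comp_rho : QP.iota k mu h s ≫ QP.rho k mu h s = 𝟙 _ := by
  rw [QP_iota_eq, QP_rho_eq]
  refine (between_comp _ _).trans (between_eq_id ?_)
  rw [tens_Q_P1_p]
  refine (cupLast_comp_capLast_smul mu h s s).trans ?_
  rw [removeScalar, young_mul_restr_mul_young]
  rfl

theorem QP_iota_comp_rho_of_ne (hst : s ≠ t) : QP.iota k mu h s ≫ QP.rho k mu h t = 0 := by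
  rw [QP_iota_eq, QP_rho_eq]
  refine (between_comp _ _).trans (between_eq_zero ?_)
  rw [tens_Q_P1_p]
  refine (cupLast_comp_capLast_smul mu h s t).trans ?_
  rw [young_mul_mul_young_of_ne fun e => hst (removeBox_injective mu e).symm, smul_zero,
    downDia_zero]
  rfl

theorem QP_iotaZero_comp_rho : QP.iotaZero k mu h ≫ QP.rho k mu h s = 0 := by
  rw [QP_rho_eq]
  refine (between_comp _ _).trans (between_eq_zero ?_)
  rw [tens_Q_P1_p]
  have e := sidePQ_comp_downDia (k := k)
    (MonoidAlgebra.single (removePerm mu h s) 1 * young mu h k)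
  rw [← downDia_comp, comp_whiskerRight, Category.assoc] at e
  exact (congrArg (fun f => _ ≫ f ≫ _) e).trans
    ((congrArg (fun f => _ ≫ f) zero_comp).trans comp_zero)

theorem QP_iota_comp_rhoZero : QP.iota k mu h s ≫ QP.rhoZero k mu h = 0 := by
  rw [QP_iota_eq]
  refine (between_comp _ _).trans (between_eq_zero ?_)
  rw [tens_Q_P1_p]
  change _ ≫ ((removeScalar k mu h s • (cupLast k n ≫ _)) ≫ _ ≫ sideQP k (n + 1)) ≫ _ = _
  have e : (removeScalar k mu h s • (cupLast k n ≫
      downDia k (MonoidAlgebra.single (removePerm mu h s)⁻¹ 1) ▷ up k)) ≫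
        downDia k (young mu h k) ▷ up k ≫ sideQP k (n + 1) = 0 := by
    rw [downDia_comp_sideQP, Linear.smul_comp, Category.assoc,
      reassoc_of% (downDia_comp_sideQP (k := k) (MonoidAlgebra.single (removePerm mu h s)⁻¹ 1)),
      reassoc_of% (cupLast_comp_sideQP (k := k) (n := n)), zero_comp, smul_zero]
  exact (congrArg (fun f => _ ≫ f ≫ _) e).trans
    ((congrArg (fun f => _ ≫ f) zero_comp).trans comp_zero)

theorem QP_sum : QP.rhoZero k mu h ≫ QP.iotaZero k mu h +
    ∑ s : removableRows mu, QP.rho k mu h s ≫ QP.iota k mu h s = 𝟙 _ := by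
  -- The idempotent of the smaller shape, which sits at the cut between cap and cup, is moved into
  -- the first argument of `capCupDia`.
  have h1 : ∀ s : removableRows mu, QP.rho k mu h s ≫ QP.iota k mu h s =
      between (tens (Q k mu h) (P1 k)) (tens (Q k mu h) (P1 k)) (removeScalar k mu h s •
        capCupDia k n (MonoidAlgebra.single (removePerm mu h s)⁻¹ 1 *
          incl k n (young (removeBox mu s) (card_removeBox' h s) k))
          (MonoidAlgebra.single (removePerm mu h s) 1)) := by
    intro s
    rw [QP_rho_eq, QP_iota_eq]
    refine (between_comp _ _).trans (congrArg (between _ _) ?_)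
    rw [capCupDia_apply, ← downDia_comp, comp_whiskerRight,
      reassoc_of% (cupLast_comp_downDia_incl (k := k))]
    have e : (downDia k (MonoidAlgebra.single (removePerm mu h s) 1) ▷ up k ≫ capLast k n) ≫
        downDia k (young (removeBox mu s) (card_removeBox' h s) k) ≫
          (removeScalar k mu h s • (cupLast k n ≫
            downDia k (MonoidAlgebra.single (removePerm mu h s)⁻¹ 1) ▷ up k)) =
        removeScalar k mu h s • (downDia k (MonoidAlgebra.single (removePerm mu h s) 1) ▷ up k ≫
          capLast k n ≫ downDia k (young (removeBox mu s) (card_removeBox' h s) k) ≫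
            cupLast k n ≫ downDia k (MonoidAlgebra.single (removePerm mu h s)⁻¹ 1) ▷ up k) := by
      simp only [Linear.comp_smul, Category.assoc]
    exact e
  simp only [h1]
  rw [QP_rhoZero_comp_iotaZero]
  refine (congrArg (fun f => _ + f) (between_sum _ _).symm).trans
    ((between_add _ _).symm.trans (between_eq_id ?_))
  have h2 : ∀ a b, downDia k (young mu h k) ▷ up k ≫ capCupDia k n a b ≫
      downDia k (young mu h k) ▷ up k =
      capCupDia k n (young mu h k * a) (b * young mu h k) := by
    intro a b
    rw [capCupDia_apply, capCupDia_apply, ← downDia_comp, ← downDia_comp]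
    simp only [comp_whiskerRight, Category.assoc]
  have h3 := sum_balanced_young (capCupDia k n) capCupDia_balanced mu h
  simp only [mul_assoc] at h3
  have h4 := sideQP_comp_sidePQ (k := k) (n := n)
  -- Between two copies of `e_μ`, the sum over all strands is the Casimir sum and reduces to the
  -- removable rows.
  have h5 : downDia k (young mu h k) ▷ up k ≫ (∑ i : Fin (n + 1),
      capCupDia k n (MonoidAlgebra.single (moveToLast i)⁻¹ 1)
        (MonoidAlgebra.single (moveToLast i) 1)) ≫ downDia k (young mu h k) ▷ up k =
    downDia k (young mu h k) ▷ up k ≫ (∑ s : removableRows mu, removeScalar k mu h s •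
        capCupDia k n (MonoidAlgebra.single (removePerm mu h s)⁻¹ 1 *
          incl k n (young (removeBox mu s) (card_removeBox' h s) k))
          (MonoidAlgebra.single (removePerm mu h s) 1)) ≫ downDia k (young mu h k) ▷ up k := by
    simp only [Preadditive.sum_comp, Preadditive.comp_sum, Linear.smul_comp, Linear.comp_smul, h2]
    exact h3
  rw [tens_Q_P1_p]
  have h6 {a b c : pow (downStrand k) (n + 1) ⊗ up k ⟶ pow (downStrand k) (n + 1) ⊗ up k}
      (hab : a + b = 𝟙 _)
      (hbc : downDia k (young mu h k) ▷ up k ≫ b ≫ downDia k (young mu h k) ▷ up k =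
        downDia k (young mu h k) ▷ up k ≫ c ≫ downDia k (young mu h k) ▷ up k) :
      downDia k (young mu h k) ▷ up k ≫ (a + c) ≫ downDia k (young mu h k) ▷ up k =
        downDia k (young mu h k) ▷ up k := by
    rw [Preadditive.add_comp, Preadditive.comp_add, ← hbc, ← Preadditive.comp_add,
      ← Preadditive.add_comp, hab, Category.id_comp, ← comp_whiskerRight, downDia_young_comp]
  exact h6 h4 h5

end RemoveBox

section RemoveBoxZero

variable {k : Type*} [Field k] [CharZero k]

theorem QP_sum_zero (mu : YoungDiagram) (h : mu.card = 0) :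
    QP.rhoZero k mu h ≫ QP.iotaZero k mu h +
      ∑ s : removableRows mu, QP.rho k mu h s ≫ QP.iota k mu h s = 𝟙 _ := by
  -- Without strands there is no box to remove, and both sideways crossings are unitors.
  have : IsEmpty (removableRows mu) := ⟨fun s => by have := eq_pred_add_one mu s h; omega⟩
  rw [Finset.univ_eq_empty, Finset.sum_empty, add_zero, QP_rhoZero_comp_iotaZero]
  refine between_eq_id ?_
  have e : sideQP k 0 ≫ sidePQ k 0 = 𝟙 _ := by simp [sideQP, sidePQ]
  refine (congrArg (fun f => _ ≫ f ≫ _) e).trans ?_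
  exact (congrArg (fun f => _ ≫ f) (Category.id_comp _)).trans (tens (Q k mu h) (P1 k)).idem

end RemoveBoxZero

theorem QP_relations (k : Type*) [Field k] [CharZero k] (n : ℕ) (mu : YoungDiagram)
    (h : mu.card = n) :
    QP.iotaZero k mu h ≫ QP.rhoZero k mu h = 𝟙 _ ∧
    (∀ s : removableRows mu, QP.iota k mu h s ≫ QP.rho k mu h s = 𝟙 _) ∧
    (∀ s t : removableRows mu, s ≠ t → QP.iota k mu h s ≫ QP.rho k mu h t = 0) ∧
    (∀ s : removableRows mu, QP.iotaZero k mu h ≫ QP.rho k mu h s = 0) ∧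
    (∀ s : removableRows mu, QP.iota k mu h s ≫ QP.rhoZero k mu h = 0) ∧
    QP.rhoZero k mu h ≫ QP.iotaZero k mu h +
      ∑ s : removableRows mu, QP.rho k mu h s ≫ QP.iota k mu h s = 𝟙 _ := by
  rcases n with _ | n
  · have : IsEmpty (removableRows mu) := ⟨fun s => by have := eq_pred_add_one mu s h; omega⟩
    exact ⟨QP_iotaZero_comp_rhoZero mu h, isEmptyElim, isEmptyElim, isEmptyElim, isEmptyElim,
      QP_sum_zero mu h⟩
  · exact ⟨QP_iotaZero_comp_rhoZero mu h, QP_iota_comp_rho mu h,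
      fun s t => QP_iota_comp_rho_of_ne mu h s t, QP_iotaZero_comp_rho mu h,
      QP_iota_comp_rhoZero mu h, QP_sum mu h⟩

/-- A direct sum decomposition into one summand and a finite family of summands. -/
theorem nonempty_iso_biprod_biproduct {D : Type*} [Category D] [Preadditive D]
    [HasFiniteBiproducts D] [HasBinaryBiproducts D] {ι : Type} [Fintype ι] {X Y : D} {Z : ι → D}
    {i : Y ⟶ X} {p : X ⟶ Y} {j : ∀ s, Z s ⟶ X} {q : ∀ s, X ⟶ Z s} (h1 : i ≫ p = 𝟙 _)
    (h2 : ∀ s, j s ≫ q s = 𝟙 _) (h0 : ∀ s t, s ≠ t → j s ≫ q t = 0) (h3 : ∀ s, i ≫ q s = 0)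
    (h4 : ∀ s, j s ≫ p = 0) (h : p ≫ i + ∑ s, q s ≫ j s = 𝟙 X) :
    Nonempty (X ≅ Y ⊞ ⨁ Z) := by
  classical
  refine nonempty_iso_biprod (j := biproduct.desc j) (q := biproduct.lift q) h1 ?_ ?_ ?_ ?_
  · ext s t
    by_cases hst : s = t
    · subst hst; simp [h2]
    · simp [h0 t s (Ne.symm hst), biproduct.ι_π_ne _ (Ne.symm hst)]
  · ext s; simp [h4]
  · ext s; simp [h3]
  · rw [biproduct.lift_desc, h]

end Heis

theorem mainTheorem9 (k : Type*) [Field k] [CharZero k] :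
    -- `P^{(n)} P^{(m)^t} ≅ P^{(n, 1^m)} ⊕ P^{(n + 1, 1^(m - 1))}`
    (∀ (n m : ℕ) (hn : 1 ≤ n) (hm : 1 < m),
      Heis.Hook.iotaTop k n m hn ≫ Heis.Hook.rhoTop k n m hn = 𝟙 _ ∧
      Heis.Hook.iotaLow k n m hm ≫ Heis.Hook.rhoLow k n m hm = 𝟙 _ ∧
      Heis.Hook.iotaLow k n m hm ≫ Heis.Hook.rhoTop k n m hn = 0 ∧
      Heis.Hook.iotaTop k n m hn ≫ Heis.Hook.rhoLow k n m hm = 0 ∧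
      Heis.Hook.rhoTop k n m hn ≫ Heis.Hook.iotaTop k n m hn +
        Heis.Hook.rhoLow k n m hm ≫ Heis.Hook.iotaLow k n m hm = 𝟙 _ ∧
      Nonempty ((Heis.toHeis k).obj (Heis.tens (Heis.Psym k n) (Heis.Palt k m)) ≅
        (Heis.toHeis k).obj (Heis.P k (Heis.hook n m hn) (Heis.card_hook n m hn)) ⊞
        (Heis.toHeis k).obj (Heis.P k (Heis.hook (n + 1) (m - 1) (Nat.le_add_left 1 n))
          (Heis.Hook.card_low n m hm)))) ∧
    -- `P^{(m)} P^{(n)} ≅ ⨁ₛ P^{(m + n - s, s)}`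
    (∀ m n : ℕ,
      (∀ s t : Fin (min m n + 1), s ≠ t →
        Heis.TwoRow.iota k m n s ≫ Heis.TwoRow.rho k m n t = 0) ∧
      (∀ s : Fin (min m n + 1), Heis.TwoRow.iota k m n s ≫ Heis.TwoRow.rho k m n s = 𝟙 _) ∧
      ∑ s : Fin (min m n + 1), Heis.TwoRow.rho k m n s ≫ Heis.TwoRow.iota k m n s = 𝟙 _ ∧
      Nonempty ((Heis.toHeis k).obj (Heis.tens (Heis.Psym k m) (Heis.Psym k n)) ≅
        ⨁ fun s : Fin (min m n + 1) => (Heis.toHeis k).obj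
          (Heis.P k (Heis.TwoRow.shape m n s) (Heis.TwoRow.card_shape m n s)))) ∧
    -- `Q^μ P ≅ P Q^μ ⊕ ⨁ₛ Q^{μ(s⁻)}`
    (∀ (n : ℕ) (mu : YoungDiagram) (h : mu.card = n),
      Heis.QP.iotaZero k mu h ≫ Heis.QP.rhoZero k mu h = 𝟙 _ ∧
      (∀ s : Heis.removableRows mu, Heis.QP.iota k mu h s ≫ Heis.QP.rho k mu h s = 𝟙 _) ∧
      (∀ s t : Heis.removableRows mu, s ≠ t →
        Heis.QP.iota k mu h s ≫ Heis.QP.rho k mu h t = 0) ∧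
      (∀ s : Heis.removableRows mu, Heis.QP.iotaZero k mu h ≫ Heis.QP.rho k mu h s = 0) ∧
      (∀ s : Heis.removableRows mu, Heis.QP.iota k mu h s ≫ Heis.QP.rhoZero k mu h = 0) ∧
      Heis.QP.rhoZero k mu h ≫ Heis.QP.iotaZero k mu h +
        ∑ s : Heis.removableRows mu, Heis.QP.rho k mu h s ≫ Heis.QP.iota k mu h s = 𝟙 _ ∧
      Nonempty ((Heis.toHeis k).obj (Heis.tens (Heis.Q k mu h) (Heis.P1 k)) ≅
        (Heis.toHeis k).obj (Heis.tens (Heis.P1 k) (Heis.Q k mu h)) ⊞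
        ⨁ fun s : Heis.removableRows mu => (Heis.toHeis k).obj
          (Heis.Q k (Heis.removeBox mu s) (Heis.card_removeBox mu s h)))) ∧
    -- `P^λ P ≅ ⨁ₛ P^{λ(s⁺)}`
    (∀ (n : ℕ) (lam : YoungDiagram) (h : lam.card = n),
      (∀ s : Heis.addableRows lam, Heis.PP.iota k lam h s ≫ Heis.PP.rho k lam h s = 𝟙 _) ∧
      (∀ s t : Heis.addableRows lam, s ≠ t →
        Heis.PP.iota k lam h s ≫ Heis.PP.rho k lam h t = 0) ∧
      ∑ s : Heis.addableRows lam, Heis.PP.rho k lam h s ≫ Heis.PP.iota k lam h s = 𝟙 _ ∧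
      Nonempty ((Heis.toHeis k).obj (Heis.tens (Heis.P k lam h) (Heis.P1 k)) ≅
        ⨁ fun s : Heis.addableRows lam => (Heis.toHeis k).obj
          (Heis.P k (Heis.addBox lam s) (Heis.card_addBox lam s h)))) := by
  refine ⟨fun n m hn hm => ?_, fun m n => ?_, fun n mu h => ?_, fun n lam h => ?_⟩
  · obtain ⟨h1, h2, h3, h4, h5⟩ := Heis.hook_relations (k := k) n m hn hm
    exact ⟨h1, h2, h3, h4, h5, Heis.nonempty_iso_biprod h1 h2 h3 h4 h5⟩
  · obtain ⟨h1, h2, h3⟩ := Heis.twoRow_relations (k := k) m n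
    exact ⟨h1, h2, h3, Heis.nonempty_iso_biproduct h2 h1 h3⟩
  · obtain ⟨h1, h2, h3, h4, h5, h6⟩ := Heis.QP_relations k n mu h
    exact ⟨h1, h2, h3, h4, h5, h6, Heis.nonempty_iso_biprod_biproduct h1 h2 h3 h4 h5 h6⟩
  · exact ⟨Heis.PP_iota_comp_rho lam h, fun s t => Heis.PP_iota_comp_rho_of_ne lam h,
      Heis.PP_sum lam h, Heis.nonempty_iso_biproduct (Heis.PP_iota_comp_rho lam h)
        (fun s t => Heis.PP_iota_comp_rho_of_ne lam h) (Heis.PP_sum lam h)⟩
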